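/- **Setting.** Let $\alpha\ge 2$, $s\ge 1$, $m\ge 1$ be integers, $b$ a prime, $1\le q\le\infty$, and let $\gamma=(\gamma_{u})_{u\subseteq\{1,\dots,s\}}$ be nonnegative real weights. Write $\{1{:}d\}=\{1,\dots,d\}$. *Function space.* For $u\subseteq\{1{:}s\}$, $v\subseteq u$ and $\tau\in\{1{:}\alpha\}^{u\setminus v}$ let $(\alpha_v,\tau_{u\setminus v},0)\in\mathbb N_0^s$ be the multi-index with $j$-th entry $\alpha$ for $j\in v$, $\tau_j$ for $j\in u\setminus v$, and $0$ for $j\notin u$. For continuous $F:[0,1]^s\to\mathbb R$ having integrable weak mixed partial derivatives $\partial^\nu F$ for all $\nu\in\{0,\dots,\alpha\}^s$ (in the sense of integration by parts against $C_c^\infty((0,1)^s)$) put $$\|F\|_{s,\alpha,\gamma,q,\infty}=\max_{u\subseteq\{1:s\}}\gamma_u^{-1}\Bigl(\sum_{v\subseteq u}\ \sum_{\tau\in\{1:\alpha\}^{u\setminus v}}\int_{[0,1]^{|v|}}\Bigl|\int_{[0,1]^{s-|v|}}(\partial^{(\alpha_v,\tau_{u\setminus v},0)}F)(y)\,dy_{\{1:s\}\setminus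 v}\Bigr|^q dy_v\Bigr)^{1/q},$$ with the usual modification (maximum over $v,\tau$ of essential suprema) if $q=\infty$, and with $0^{-1}=\infty$, $\infty\cdot 0=0$. Let $\mathcal W$ be the set of such $F$ with finite norm. *Interlaced polynomial lattice rules.* Let $P\in\mathbb Z_b[x]$ be irreducible of degree $m$, and let $G_{b,m}$ be the set of nonzero polynomials over $\mathbb Z_b$ of degree less than $m$. To $k=\sum_{i\ge 0}\kappa_i b^i\in\mathbb N_0$ (base-$b$ expansion) associate $\mathrm{tr}_m(k)(x)=\sum_{i<m}\kappa_i x^i$. For a formal Laurent series over $\mathbb Z_b$ put $v_m(\sum_\ell t_\ell x^{-\ell})=\sum_{\ell=1}^m t_\ell b^{-\ell}$. For $g\in G_{b,m}^{\alpha s}$ and $0\le n<b^m$, let $z_n\in[0,1)^{\alpha s}$ have components $v_m(\mathrm{tr}_m(n)\,g_i/P)$, $i=1,\dots,\alpha s$. Let $\mathscr D_\alpha(x_1,\dots,x_\alpha)=\sum_{a\ge1}\sum_{j=1}^\alpha \xi_{j,a}b^{-j-(a-1)\alpha}$, where $\xi_{j,a}$ is the $a$-th base-$b$ digit of $x_j\in[0,1)$.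 The interlaced polynomial lattice rule of order $\alpha$ given by $P$ and $g$ is the equal-weight rule with the $b^m$ points $y_n\in[0,1)^s$ whose $j$-th component is $\mathscr D_\alpha(z_{n,(j-1)\alpha+1},\dots,z_{n,j\alpha})$. *Constants.* $$C_{\alpha,b}=\max\Bigl(\tfrac{2}{(2\sin\frac{\pi}{b})^{\alpha}},\max_{1\le z\le\alpha-1}\tfrac{1}{(2\sin\frac{\pi}{b})^z}\Bigr)\Bigl(1+\tfrac1b+\tfrac1{b(b+1)}\Bigr)^{\alpha-2}\Bigl(3+\tfrac2b+\tfrac{2b+1}{b-1}\Bigr),$$ $$\rho_{\alpha,b}(\lambda)=\bigl(C_{\alpha,b}\,b^{\alpha(\alpha-1)/2}\bigr)^{\lambda}\Bigl(\bigl(1+\tfrac{b-1}{b^{\alpha\lambda}-b}\bigr)^{\alpha}-1\Bigr).$$ *Component-by-component (CBC) construction.* For $w\subseteq\{1{:}\alpha s\}$ let $u(w)=\{\lceil j/\alpha\rceil:j\in w\}$ and $\widetilde\gamma_w=C_{\alpha,b}^{|u(w)|}\gamma_{u(w)}b^{\alpha(\alpha-1)|u(w)|/2}$. Let $\mu_1(k)$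 be the number of base-$b$ digits of $k\ge1$. For $1\le d\le\alpha s$ put $$E_d(g_1,\dots,g_d)=\sum_{\emptyset\ne w\subseteq\{1:d\}}\widetilde\gamma_w\sum_{\ell}b^{-\alpha\sum_{j\in w}\mu_1(\ell_j)},$$ where $\ell$ ranges over the positive integer vectors $(\ell_j)_{j\in w}$ with $\sum_{j\in w}\mathrm{tr}_m(\ell_j)\,g_j\equiv 0\pmod P$. A vector $g\in G_{b,m}^{\alpha s}$ is *CBC-constructed* if $g_1=1$ and, for each $d=2,\dots,\alpha s$, $g_d$ minimizes $E_d(g_1,\dots,g_{d-1},\cdot)$ over $G_{b,m}$. **Theorem.** There is an irreducible $P\in\mathbb Z_b[x]$ of degree $m$. For every such $P$ there is a CBC-constructed vector $g$, and for every such $P$ and every CBC-constructed $g$, the points $y_0,\dots,y_{b^m-1}$ of the interlaced polynomial lattice rule of order $\alpha$ given by $P$ and $g$ satisfy $$\Bigl|\frac1{b^m}\sum_{n=0}^{b^m-1}F(y_n)-\int_{[0,1]^s}F(y)\,dy\Bigr|\le\Bigl(\frac{2}{b^m-1}\sum_{\emptyset\ne u\subseteq\{1:s\}}\gamma_u^{\lambda}\,[\rho_{\alpha,b}(\lambda)]^{|u|}\Bigr)^{1/\lambda}\|F\|_{s,\alpha,\gamma,q,\infty}$$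 for all $\lambda\in(1/\alpha,1]$ and all $F\in\mathcal W$. -/

import Mathlib

open MeasureTheory Polynomial
open scoped NNReal ENNReal

noncomputable section

namespace IPL

/-! ### Function spaces on the unit cube -/

/-- The closed unit cube `[0,1]^s`. -/
def cube (s : ℕ) : Set (Fin s → ℝ) := Set.Icc 0 1

/-- The open unit cube `(0,1)^s`. -/
def openCube (s : ℕ) : Set (Fin s → ℝ) := Set.univ.pi fun _ => Set.Ioo (0 : ℝ) 1

/-- The classical partial derivative in the `j`-th coordinate direction. -/
def partialDeriv {s : ℕ} (j : Fin s) (f : (Fin s → ℝ) → ℝ) : (Fin s → ℝ) → ℝ :=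
  fun x => fderiv ℝ f x (Pi.single j 1)

/-- The classical mixed partial derivative `∂^ν f`, used below for smooth test functions only. -/
def mixedPartial {s : ℕ} (ν : Fin s → ℕ) (f : (Fin s → ℝ) → ℝ) : (Fin s → ℝ) → ℝ :=
  (List.finRange s).foldr (fun j g => (partialDeriv j)^[ν j] g) f

/-- `G` is a weak mixed partial derivative `∂^ν F` of `F` on the unit cube: it is integrable and
satisfies the integration by parts formula against all smooth functions with compact support in
the open cube. -/
structure IsWeakDeriv {s : ℕ} (ν : Fin s → ℕ) (F G : (Fin s → ℝ) → ℝ) : Prop where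
  integrableOn : IntegrableOn G (cube s)
  integral_eq : ∀ φ : (Fin s → ℝ) → ℝ, ContDiff ℝ (⊤ : ℕ∞) φ → HasCompactSupport φ →
    tsupport φ ⊆ openCube s →
    ∫ y in cube s, F y * mixedPartial ν φ y = (-1) ^ (∑ j, ν j) * ∫ y in cube s, G y * φ y

open Classical in
/-- The weak mixed partial derivative `∂^ν F`, unique up to null sets (and `0` if there is
none). -/
def weakDeriv {s : ℕ} (ν : Fin s → ℕ) (F : (Fin s → ℝ) → ℝ) : (Fin s → ℝ) → ℝ :=
  if h : ∃ G, IsWeakDeriv ν F G then h.choose else 0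

/-- The `ℓ^p` norm of a finite family in `[0,∞]`, for `1 ≤ p ≤ ∞`. -/
def lpSum {ι : Type*} (p : ℝ≥0∞) (S : Finset ι) (a : ι → ℝ≥0∞) : ℝ≥0∞ :=
  if p = ∞ then S.sup a else (∑ i ∈ S, a i ^ p.toReal) ^ (1 / p.toReal)

/-- The orders of differentiation `(α_v, τ_{u∖v}, 0)`: the order is `α` in the directions of `v`,
is any `τ_j ∈ {1,…,α}` for `j ∈ u ∖ v`, and is `0` outside of `u`. -/
def mixedOrders {s : ℕ} (α : ℕ) (u v : Finset (Fin s)) : Finset (Fin s → ℕ) :=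
  Fintype.piFinset fun j => if j ∈ v then {α} else if j ∈ u then Finset.Icc 1 α else {0}

/-- The higher order unanchored Sobolev norm `‖F‖_{s,α,γ,q,r}`, with values in `[0,∞]`. The inner
integral is over the coordinates outside `v`, so it depends on the coordinates of `y` in `v` only;
the variables over which nothing depends are integrated over `[0,1]` as well, which changes nothing.
For `γ_u = 0` one has `γ_u⁻¹ = ∞`, with `∞ * 0 = 0`. -/
def sobolevENorm {s : ℕ} (α : ℕ) (γ : Finset (Fin s) → ℝ≥0) (q r : ℝ≥0∞)
    (F : (Fin s → ℝ) → ℝ) : ℝ≥0∞ :=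
  lpSum r (Finset.univ : Finset (Finset (Fin s))) fun u =>
    (γ u : ℝ≥0∞)⁻¹ *
      lpSum q (u.powerset.sigma fun v => mixedOrders α u v) fun p =>
        eLpNorm (fun y => ∫ z in cube s, weakDeriv p.2 F (p.1.piecewise y z)) q
          (volume.restrict (cube s))

/-- Membership in the space `W_{s,α,γ,q,r}`: continuous functions on the cube with weak
mixed partial derivatives of order up to `α` in each variable and with finite norm. -/
structure MemSobolev {s : ℕ} (α : ℕ) (γ : Finset (Fin s) → ℝ≥0) (q r : ℝ≥0∞)
    (F : (Fin s → ℝ) → ℝ) : Prop where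
  continuousOn : ContinuousOn F (cube s)
  exists_weakDeriv : ∀ ν : Fin s → ℕ, (∀ j, ν j ≤ α) → ∃ G, IsWeakDeriv ν F G
  norm_lt_top : sobolevENorm α γ q r F < ∞

/-! ### Polynomial lattice point sets and interlacing -/

/-- `P` is an admissible modulus: an irreducible polynomial over `ℤ_b` of degree `m`. -/
def IsModulus (b m : ℕ) (P : (ZMod b)[X]) : Prop := Irreducible P ∧ P.natDegree = m

/-- The set `G_{b,m}` of nonzero polynomials over `ℤ_b` of degree less than `m`. -/
def polySet (b m : ℕ) : Set (ZMod b)[X] := {p | p ≠ 0 ∧ p.degree < m}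

/-- The polynomial `κ_0 + κ_1 x + ⋯ + κ_{m-1} x^{m-1}` made of the first `m` digits of
`k = κ_0 + κ_1 b + κ_2 b² + ⋯`. -/
def truncPoly (b m k : ℕ) : (ZMod b)[X] :=
  ∑ i ∈ Finset.range m, C ((k / b ^ i % b : ℕ) : ZMod b) * X ^ i

/-- The embedding of `ℤ_b[x]` in the field of formal Laurent series in `x⁻¹`, that is, in Mathlib's
Laurent series in a variable that plays the role of `x⁻¹`. -/
def toLaurentInv (b : ℕ) (p : (ZMod b)[X]) : LaurentSeries (ZMod b) :=
  p.eval₂ HahnSeries.C (HahnSeries.single (-1 : ℤ) 1)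

/-- The map `v_m`: `∑ t_ℓ x^{-ℓ} ↦ ∑_{1 ≤ ℓ ≤ m} t_ℓ b^{-ℓ}`. -/
def vmap (b m : ℕ) (L : LaurentSeries (ZMod b)) : ℝ :=
  ∑ l ∈ Finset.Icc 1 m, ((L.coeff (l : ℤ)).val : ℝ) / (b : ℝ) ^ l

/-- The `n`-th point of the polynomial lattice with modulus `P` and generating vector `g`. -/
def latticePoint (b m : ℕ) [Fact b.Prime] {d : ℕ} (P : (ZMod b)[X]) (g : Fin d → (ZMod b)[X])
    (n : ℕ) : Fin d → ℝ :=
  fun j => vmap b m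
    (toLaurentInv b (truncPoly b m n) * toLaurentInv b (g j) / toLaurentInv b P)

/-- The `a`-th digit (`a ≥ 1`) of `x ∈ [0,1)` in base `b`. -/
def digit (b : ℕ) (x : ℝ) (a : ℕ) : ℕ := ⌊(b : ℝ) ^ a * x⌋₊ % b

/-- The digit interlacing function with interlacing factor `α`; the indices `a` and `j` are
shifted to start from zero. -/
def interlace (b α : ℕ) (x : Fin α → ℝ) : ℝ :=
  ∑' a : ℕ, ∑ j : Fin α, (digit b (x j) (a + 1) : ℝ) / (b : ℝ) ^ ((j : ℕ) + 1 + a * α)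

/-- The `n`-th point of the interlaced polynomial lattice rule of order `α` in `s` dimensions:
the `j`-th coordinate interlaces the `j`-th block of `α` coordinates of the polynomial lattice
point. -/
def interlacedPoint (b m α : ℕ) [Fact b.Prime] {s : ℕ} (P : (ZMod b)[X])
    (g : Fin (s * α) → (ZMod b)[X]) (n : ℕ) : Fin s → ℝ :=
  fun j => interlace b α fun i => latticePoint b m P g n (finProdFinEquiv (j, i))

/-! ### The constants and the component-by-component construction -/

/-- The constant `C_{α,b}`, for `α ≥ 2`. -/
def constC (α b : ℕ) : ℝ :=
  max (2 / (2 * Real.sin (Real.pi / b)) ^ α)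
      (⨆ z : Finset.Icc 1 (α - 1), 1 / (2 * Real.sin (Real.pi / b)) ^ (z : ℕ)) *
    (1 + 1 / (b : ℝ) + 1 / ((b : ℝ) * (b + 1))) ^ (α - 2) *
    (3 + 2 / (b : ℝ) + (2 * b + 1) / ((b : ℝ) - 1))

/-- The constant `ρ_{α,b}(λ)`. -/
def rho (α b : ℕ) (lam : ℝ) : ℝ :=
  (constC α b * (b : ℝ) ^ (α * (α - 1) / 2)) ^ lam *
    ((1 + ((b : ℝ) - 1) / ((b : ℝ) ^ ((α : ℝ) * lam) - b)) ^ α - 1)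

/-- `μ_1(k)`: the number of digits of `k` in base `b`, with `μ_1(0) = 0`. -/
def mu1 (b k : ℕ) : ℕ := (b.digits k).length

/-- The set `u(v)` of the blocks of length `α` that meet `v`. -/
def blocks {s α : ℕ} (v : Finset (Fin (s * α))) : Finset (Fin s) := v.image Fin.divNat

/-- The weight `C_{α,b}^{|u(v)|} γ_{u(v)} b^{α(α-1)|u(v)|/2}`. -/
def cbcWeight (b : ℕ) {s α : ℕ} (γ : Finset (Fin s) → ℝ≥0) (v : Finset (Fin (s * α))) : ℝ :=
  constC α b ^ (blocks v).card * γ (blocks v) * (b : ℝ) ^ (α * (α - 1) / 2 * (blocks v).card)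

/-- The dual net without zero components, projected to the components in `v`. -/
def dualNet (b m : ℕ) {d : ℕ} (P : (ZMod b)[X]) (g : Fin d → (ZMod b)[X]) (v : Finset (Fin d)) :
    Set (v → ℕ) :=
  {l | (∀ j, 0 < l j) ∧ P ∣ ∑ j, truncPoly b m (l j) * g j}

/-- The search criterion `E_d(g_1,…,g_d)`; it depends on the first `d` components of `g` only. -/
def criterion (b m : ℕ) {s α : ℕ} (γ : Finset (Fin s) → ℝ≥0) (P : (ZMod b)[X])
    (d : ℕ) (g : Fin (s * α) → (ZMod b)[X]) : ℝ≥0∞ :=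
  ∑ v : Finset (Fin (s * α)) with v.Nonempty ∧ ∀ j ∈ v, j.val < d,
    ENNReal.ofReal (cbcWeight b γ v) *
      ∑' l : dualNet b m P g v, ((b : ℝ≥0∞) ^ (α * ∑ j, mu1 b (l.1 j)))⁻¹

/-- `g` is an output of the component-by-component algorithm: the first component is `1`, and
each further component minimizes the criterion over `G_{b,m}`, given the previous ones. -/
structure IsCBC (b m : ℕ) {s α : ℕ} (γ : Finset (Fin s) → ℝ≥0) (P : (ZMod b)[X])
    (g : Fin (s * α) → (ZMod b)[X]) : Prop where
  mem : ∀ j, g j ∈ polySet b m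
  first : ∀ j : Fin (s * α), j.val = 0 → g j = 1
  minimal : ∀ j : Fin (s * α), 0 < j.val → ∀ p ∈ polySet b m,
    criterion b m γ P (j.val + 1) g ≤ criterion b m γ P (j.val + 1) (Function.update g j p)

end IPL

end

/-! The proof is Fourier analysis in the Walsh system, followed by an averaging argument for the
generating vector.

Duality. Group the `α` indices of each block into one Walsh index by interlacing their digits
(`interDigits`). The average of such a Walsh function over the point set is 1 if the index vector
`l` satisfies `P ∣ ∑ p, truncPoly b m (l p) * g p`, and 0 otherwise (`sum_walProd_interlacedPoint`).
So the integration error is the sum of the Walsh coefficients of `F` over the nonzero dual vectors.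
Absolute convergence of the Walsh series is not needed: the partial sums over digit boxes are
integrals against a nonnegative kernel concentrated near the diagonal, hence converge uniformly for
continuous `F` (`walsh_partialSum_tendsto`).

Decay of the coefficients. The primitive of a Walsh function times a function periodic at the scale
of its finest digit is again of this form: the leading digit of the index is gone, the period is `b`
times longer, and a nonzero digit at position `N` gains a factor `b ^ (-N)`
(`IsCellPeriodic.integral_mul_wal`). Integrating by parts at most `α` times in each coordinate gains
`b` to the minus sum of the positions of the `α` leading nonzero digits, with constant `3 * max (2
sin (π / b)) ^ (-i)` over `1 ≤ i ≤ α`, which is at most `constC` (`IsDerivFamily.norm_mul_wal_le`,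
`pow_le_constC`). The mixed derivatives left at the end are exactly those in the Sobolev norm
(`norm_pairing_wal_le`); partial integration of weak derivatives is justified by approximation with
test functions (`IsWeakDeriv.pairing_parts`). The leading digits of the interlaced components sit at
distinct positions, so the gain is at least `b ^ (-α ∑ μ₁)` up to the factor `b ^ (α (α - 1) / 2)`
per active block (`mul_sum_mu1_le`). Hence the error is at most `criterion` times the norm
(`MemSobolev.error_le_criterion`).

Construction. A minimum is at most an average, also after raising to the power `lam ≤ 1`, where `(∑
a) ^ lam ≤ ∑ a ^ lam` applies. Averaging over the candidates for one component, a linear congruence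
modulo the irreducible `P` has at most one solution unless its coefficient vanishes, and vanishing
coefficients are rare enough to cost only a factor 2 (`sum_dualSum_update_le`). Induction over the
components gives `IsCBC.mul_criterion_rpow_le`, and grouping the index sets by the blocks they meet
turns the resulting sum into powers of `rho` (`sum_cbcWeight_rpow`). -/

namespace IPL

set_option linter.unusedSectionVars false

section
/-! ### Integrals of a periodic function against a step function -/

theorem integral_cell {δ : ℝ} {W u : ℝ → ℂ} {z : ℤ → ℂ} (hδ : 0 < δ)
    (hW : Function.Periodic W δ) (hu : ∀ x, u x = z ⌊x / δ⌋) (n : ℕ) {r : ℝ} (hr : r ≤ δ)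
    (hr0 : 0 ≤ r) :
    ∫ x in (n * δ)..(n * δ + r), W x * u x = z n * ∫ x in (0 : ℝ)..r, W x := by
  have h1 : ∫ x in (n * δ)..(n * δ + r), W x * u x =
      ∫ x in (n * δ)..(n * δ + r), W x * z n := by
    rw [intervalIntegral.integral_of_le (by linarith), intervalIntegral.integral_of_le (by linarith),
      integral_Ioc_eq_integral_Ioo, integral_Ioc_eq_integral_Ioo]
    refine setIntegral_congr_fun measurableSet_Ioo fun x hx => ?_
    have : ⌊x / δ⌋ = (n : ℤ) := by
      rw [Int.floor_eq_iff]
      constructor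
      · rw [le_div_iff₀ hδ]; exact_mod_cast hx.1.le
      · rw [div_lt_iff₀ hδ]; push_cast; nlinarith [hx.2]
    simp only [hu, this]
  rw [h1, intervalIntegral.integral_mul_const, mul_comm]
  congr 1
  have := intervalIntegral.integral_comp_add_left (f := W) (a := 0) (b := r) (n * δ)
  rw [add_zero] at this
  rw [← this]
  refine intervalIntegral.integral_congr fun x _ => ?_
  rw [add_comm]
  exact_mod_cast (hW.nat_mul n) x

/-- The step function is constant on each cell and `W` has the same integral over every cell, so
complete cells contribute a common factor times a sum of steps; only the last, incomplete cell is
left over. -/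
theorem integral_mul_step {δ : ℝ} {W u : ℝ → ℂ} {z : ℤ → ℂ} (hδ : 0 < δ)
    (hW : Function.Periodic W δ) (hu : ∀ x, u x = z ⌊x / δ⌋)
    (hi : ∀ c d, IntervalIntegrable (fun x => W x * u x) volume c d) (n : ℕ) {r : ℝ} (hr : r ≤ δ)
    (hr0 : 0 ≤ r) :
    ∫ x in (0 : ℝ)..(n * δ + r), W x * u x =
      (∫ x in (0 : ℝ)..δ, W x) * ∑ i ∈ Finset.range n, z i + z n * ∫ x in (0 : ℝ)..r, W x := by
  have key : ∫ x in (0 : ℝ)..(n * δ), W x * u x =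
      (∫ x in (0 : ℝ)..δ, W x) * ∑ i ∈ Finset.range n, z i := by
    induction n with
    | zero => simp
    | succ n ih =>
      have h2 := integral_cell hδ hW hu n le_rfl hδ.le
      have : ((n + 1 : ℕ) : ℝ) * δ = n * δ + δ := by push_cast; ring
      rw [this, ← intervalIntegral.integral_add_adjacent_intervals (hi 0 (n * δ)) (hi _ _), ih, h2,
        Finset.sum_range_succ]
      ring
  rw [← intervalIntegral.integral_add_adjacent_intervals (hi 0 (n * δ)) (hi _ _), key,
    integral_cell hδ hW hu n hr hr0]

/-- As the mean is zero, the integral over `[y, x]` is minus the integral over the rest of `[0, δ]`,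
and one of the two sets has measure at most `δ / 2`. This halving keeps the constants bounded under
repeated integration. -/
theorem norm_integral_le_half {δ O : ℝ} {g : ℝ → ℂ}
    (hg : IntervalIntegrable g volume 0 δ) (h0 : ∫ x in (0 : ℝ)..δ, g x = 0)
    (hO : ∀ x ∈ Set.Icc 0 δ, ‖g x‖ ≤ O) {x y : ℝ} (hy : 0 ≤ y) (hyx : y ≤ x) (hx : x ≤ δ) :
    ‖∫ t in y..x, g t‖ ≤ δ * O / 2 := by
  have i1 : IntervalIntegrable g volume 0 y := hg.mono_set (by
    rw [Set.uIcc_of_le hy, Set.uIcc_of_le (by linarith)]; exact Set.Icc_subset_Icc le_rfl (by linarith))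
  have i2 : IntervalIntegrable g volume y x := hg.mono_set (by
    rw [Set.uIcc_of_le hyx, Set.uIcc_of_le (by linarith)]; exact Set.Icc_subset_Icc hy (by linarith))
  have i3 : IntervalIntegrable g volume x δ := hg.mono_set (by
    rw [Set.uIcc_of_le hx, Set.uIcc_of_le (by linarith)]; exact Set.Icc_subset_Icc (by linarith) le_rfl)
  have e := intervalIntegral.integral_add_adjacent_intervals (i1.trans i2) i3
  rw [← intervalIntegral.integral_add_adjacent_intervals i1 i2, h0] at e
  have b1 : ‖∫ t in (0 : ℝ)..y, g t‖ ≤ O * |y - 0| :=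
    intervalIntegral.norm_integral_le_of_norm_le_const fun t ht => by
      rw [Set.uIoc_of_le hy] at ht; exact hO t ⟨ht.1.le, by linarith [ht.2]⟩
  have b2 : ‖∫ t in y..x, g t‖ ≤ O * |x - y| :=
    intervalIntegral.norm_integral_le_of_norm_le_const fun t ht => by
      rw [Set.uIoc_of_le hyx] at ht; exact hO t ⟨by linarith [ht.1], by linarith [ht.2]⟩
  have b3 : ‖∫ t in x..δ, g t‖ ≤ O * |δ - x| :=
    intervalIntegral.norm_integral_le_of_norm_le_const fun t ht => by
      rw [Set.uIoc_of_le hx] at ht; exact hO t ⟨by linarith [ht.1], by linarith [ht.2]⟩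
  rw [abs_of_nonneg (by linarith)] at b1 b2 b3
  have e2 : ∫ t in y..x, g t = -((∫ t in (0 : ℝ)..y, g t) + ∫ t in x..δ, g t) := by
    linear_combination e
  have b4 : ‖∫ t in y..x, g t‖ ≤ ‖∫ t in (0 : ℝ)..y, g t‖ + ‖∫ t in x..δ, g t‖ := by
    rw [e2, norm_neg]; exact norm_add_le _ _
  nlinarith

/-! ### Walsh functions -/

variable {b : ℕ} [Fact b.Prime]

theorem b_pos (b : ℕ) [Fact b.Prime] : (0 : ℝ) < b := by
  exact_mod_cast (Fact.out : b.Prime).pos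

theorem one_lt_b (b : ℕ) [Fact b.Prime] : (1 : ℝ) < b := by
  exact_mod_cast (Fact.out : b.Prime).one_lt

/-- The `c`-th value of the Walsh function with digits `κ` on the grid of width `b ^ (-N)`. -/
noncomputable def walGrid (κ : ℕ → ZMod b) : ℕ → ℤ → ℂ
  | 0, _ => 1
  | N + 1, c => ZMod.stdAddChar (κ N * (c : ZMod b)) * walGrid κ N (c / b)

/-- The Walsh function with the first `N` digits `κ`. -/
noncomputable def wal (N : ℕ) (κ : ℕ → ZMod b) (x : ℝ) : ℂ := walGrid κ N ⌊x * (b : ℝ) ^ N⌋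

theorem floor_mul_pow_div (x : ℝ) (N : ℕ) :
    ⌊x * (b : ℝ) ^ (N + 1)⌋ / (b : ℤ) = ⌊x * (b : ℝ) ^ N⌋ := by
  have hb := b_pos b
  rw [← Int.floor_div_natCast]
  congr 1
  field_simp
  ring

theorem wal_succ (N : ℕ) (κ : ℕ → ZMod b) (x : ℝ) :
    wal (N + 1) κ x = ZMod.stdAddChar (κ N * (⌊x * (b : ℝ) ^ (N + 1)⌋ : ZMod b)) * wal N κ x := by
  simp only [wal, walGrid, floor_mul_pow_div]

theorem wal_eq_prod (N : ℕ) (κ : ℕ → ZMod b) (x : ℝ) :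
    wal N κ x =
      ∏ i ∈ Finset.range N, ZMod.stdAddChar (κ i * (⌊x * (b : ℝ) ^ (i + 1)⌋ : ZMod b)) := by
  induction N with
  | zero => simp [wal, walGrid]
  | succ N ih => rw [wal_succ, ih, Finset.prod_range_succ, mul_comm]

theorem norm_stdAddChar (x : ZMod b) : ‖(ZMod.stdAddChar x : ℂ)‖ = 1 := by
  rw [ZMod.stdAddChar_apply]; exact Circle.norm_coe _

theorem norm_wal (N : ℕ) (κ : ℕ → ZMod b) (x : ℝ) : ‖wal N κ x‖ = 1 := by
  rw [wal_eq_prod, norm_prod]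
  exact Finset.prod_eq_one fun i _ => norm_stdAddChar _

theorem measurable_wal (N : ℕ) (κ : ℕ → ZMod b) : Measurable (wal N κ) := by
  have : Measurable fun c : ℤ => walGrid κ N c := measurable_of_countable _
  exact this.comp (Int.measurable_floor.comp (measurable_id.mul_const _))

theorem wal_of_eq_zero {N : ℕ} {κ : ℕ → ZMod b} (h : ∀ i < N, κ i = 0) (x : ℝ) :
    wal N κ x = 1 := by
  rw [wal_eq_prod]
  exact Finset.prod_eq_one fun i hi => by simp [h i (Finset.mem_range.1 hi)]

theorem one_sub_stdAddChar_ne_zero {t : ZMod b} (ht : t ≠ 0) :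
    (1 : ℂ) - ZMod.stdAddChar t ≠ 0 := by
  rw [sub_ne_zero]
  intro h
  apply ht
  apply ZMod.injective_stdAddChar
  simp [← h]

/-- The norm equals `2 sin (π t / b)` with `1 ≤ t ≤ b - 1`, and the sine is smallest at the two ends
of this range. -/
theorem two_sin_le_norm {t : ZMod b} (ht : t ≠ 0) :
    2 * Real.sin (Real.pi / b) ≤ ‖(1 : ℂ) - ZMod.stdAddChar t‖ := by
  have hb := b_pos b
  have h1 : 0 < t.val := Nat.pos_of_ne_zero (by simpa [ZMod.val_eq_zero] using ht)
  have h2 := ZMod.val_lt t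
  have e : t = ((t.val : ℤ) : ZMod b) := by simp
  have : (ZMod.stdAddChar t : ℂ) = Complex.exp (Complex.I * ((2 * Real.pi * t.val / b : ℝ))) := by
    conv_lhs => rw [e]
    rw [ZMod.stdAddChar_coe]
    congr 1; push_cast; ring
  rw [this, norm_sub_rev, Complex.norm_exp_I_mul_ofReal_sub_one]
  have e3 : 2 * Real.pi * t.val / b / 2 = Real.pi * t.val / b := by ring
  rw [e3, norm_mul, Real.norm_eq_abs, Real.norm_eq_abs, abs_of_pos two_pos]
  refine mul_le_mul_of_nonneg_left (le_trans ?_ (le_abs_self _)) two_pos.le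
  have hp := Real.pi_pos
  have h1' : (1 : ℝ) ≤ t.val := by exact_mod_cast h1
  have h2' : (t.val : ℝ) + 1 ≤ b := by exact_mod_cast h2
  rcases le_total (Real.pi * t.val / b) (Real.pi / 2) with h | h
  · apply Real.sin_le_sin_of_le_of_le_pi_div_two _ h
    · gcongr; nlinarith
    · have : 0 ≤ Real.pi / b := by positivity
      linarith
  · rw [← Real.sin_pi_sub (Real.pi * t.val / b)]
    apply Real.sin_le_sin_of_le_of_le_pi_div_two
    · have : 0 ≤ Real.pi / b := by positivity
      linarith
    · linarith
    · have : Real.pi - Real.pi * t.val / b = Real.pi * (b - t.val) / b := by field_simp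
      rw [this]; gcongr; nlinarith

theorem sin_pi_div_pos : 0 < Real.sin (Real.pi / b) := by
  have h := one_lt_b b
  apply Real.sin_pos_of_pos_of_lt_pi
  · positivity
  · rw [div_lt_iff₀ (by linarith)]; nlinarith [Real.pi_pos]

/-- Each complete group of `b` consecutive cells contributes a full sum of a nontrivial character,
which is zero. Only the geometric sum over the current group remains, multiplied by the coarser
Walsh value there. -/
theorem sum_walGrid {N : ℕ} {κ : ℕ → ZMod b} (h : κ N ≠ 0) (n : ℕ) :
    ∑ i ∈ Finset.range n, walGrid κ (N + 1) i =
      walGrid κ N ((n : ℤ) / b) * ((1 - ZMod.stdAddChar (κ N * (n : ZMod b))) /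
        (1 - ZMod.stdAddChar (κ N))) := by
  have hne := one_sub_stdAddChar_ne_zero h
  induction n with
  | zero => simp
  | succ n ih =>
    rw [Finset.sum_range_succ, ih]
    simp only [walGrid]
    by_cases hd : b ∣ n + 1
    · have z1 : (((n + 1 : ℕ)) : ZMod b) = 0 := (ZMod.natCast_eq_zero_iff _ _).2 hd
      have z2 : (n : ZMod b) = -1 := by
        push_cast at z1; linear_combination z1
      rw [z1]
      simp only [Int.cast_natCast, z2, mul_neg, mul_one, mul_zero, AddChar.map_zero_eq_one, sub_self, zero_div]
      have : (ZMod.stdAddChar (κ N) : ℂ) * ZMod.stdAddChar (-κ N) = 1 := by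
        rw [← AddChar.map_add_eq_mul]; simp
      field_simp
      linear_combination -walGrid κ N ((n : ℤ) / b) * this
    · have : ((n + 1 : ℕ) : ℤ) / (b : ℤ) = (n : ℤ) / b := by
        have := Nat.succ_div_of_not_dvd hd
        exact_mod_cast this
      rw [this]
      have h3 : (ZMod.stdAddChar (κ N * ((n + 1 : ℕ) : ZMod b)) : ℂ) =
          ZMod.stdAddChar (κ N * (n : ZMod b)) * ZMod.stdAddChar (κ N) := by
        rw [← AddChar.map_add_eq_mul]; congr 1; push_cast; ring
      rw [h3]
      simp only [Int.cast_natCast]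
      field_simp
      ring

end

/-! ### Primitives of periodic functions times Walsh functions. -/

section
variable {b : ℕ} [Fact b.Prime]

/-- A bounded measurable function of period `b ^ (-N)`, with mean `M` and oscillation at most
`O`. -/
structure IsCellPeriodic (b N : ℕ) (W : ℝ → ℂ) (M : ℂ) (O : ℝ) : Prop where
  measurable : Measurable W
  periodic : Function.Periodic W ((b : ℝ) ^ N)⁻¹
  mean : ∫ x in (0 : ℝ)..((b : ℝ) ^ N)⁻¹, W x = (((b : ℝ) ^ N)⁻¹ : ℝ) * M
  osc : ∀ x, ‖W x - M‖ ≤ O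

theorem intervalIntegrable_of_bound {f : ℝ → ℂ} (hf : Measurable f) {C : ℝ} (hC : ∀ x, ‖f x‖ ≤ C)
    (x y : ℝ) : IntervalIntegrable f volume x y :=
  intervalIntegrable_const (c := C) |>.mono_fun hf.aestronglyMeasurable
    (Filter.Eventually.of_forall fun t => (hC t).trans (le_abs_self _))

namespace IsCellPeriodic

variable {N : ℕ} {W : ℝ → ℂ} {M : ℂ} {O : ℝ}

theorem norm_le (h : IsCellPeriodic b N W M O) (x : ℝ) : ‖W x‖ ≤ ‖M‖ + O := by
  have := norm_add_le (W x - M) M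
  rw [sub_add_cancel] at this
  linarith [h.osc x]

theorem intervalIntegrable (h : IsCellPeriodic b N W M O) (x y : ℝ) :
    IntervalIntegrable W volume x y :=
  intervalIntegrable_of_bound h.measurable h.norm_le x y

theorem intervalIntegrable_mul (h : IsCellPeriodic b N W M O) {u : ℝ → ℂ} (hu : Measurable u)
    (hu1 : ∀ x, ‖u x‖ = 1) (x y : ℝ) : IntervalIntegrable (fun x => W x * u x) volume x y :=
  intervalIntegrable_of_bound (h.measurable.mul hu)
    (C := ‖M‖ + O) (fun x => by simp only [Pi.mul_apply, norm_mul, hu1, mul_one]; exact h.norm_le x) x y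

/-- A period may be multiplied by `b`. -/
theorem of_succ (h : IsCellPeriodic b (N + 1) W M O) : IsCellPeriodic b N W M O where
  measurable := h.measurable
  periodic := by
    have hb := b_pos b
    have := h.periodic.nat_mul b
    have e : (b : ℝ) * ((b : ℝ) ^ (N + 1))⁻¹ = ((b : ℝ) ^ N)⁻¹ := by rw [pow_succ]; field_simp
    rwa [e] at this
  mean := by
    have hb := b_pos b
    have h1 := integral_mul_step (W := W) (u := fun _ => 1) (z := fun _ => 1)
      (δ := ((b : ℝ) ^ (N + 1))⁻¹) (by positivity) h.periodic (fun _ => rfl)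
      (h.intervalIntegrable_mul measurable_const (by simp)) b (r := 0) (by positivity) le_rfl
    have h2 : (b : ℝ) * ((b : ℝ) ^ (N + 1))⁻¹ + 0 = ((b : ℝ) ^ N)⁻¹ := by rw [pow_succ]; field_simp; simp
    rw [h2] at h1
    simp only [mul_one, Finset.sum_const, Finset.card_range, nsmul_eq_mul,
      intervalIntegral.integral_same, mul_zero, add_zero] at h1
    rw [h1, h.mean, ← h2]
    push_cast; ring
  osc := h.osc

theorem const (N : ℕ) : IsCellPeriodic b N (fun _ => 1) 1 0 where
  measurable := measurable_const
  periodic := fun _ => rfl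
  mean := by simp
  osc := by simp

end IsCellPeriodic

/-- The periodic factor of the primitive of a periodic function times a Walsh function. -/
noncomputable def cellPrimitive (N : ℕ) (t : ZMod b) (W : ℝ → ℂ) (μ : ℂ) (x : ℝ) : ℂ :=
  μ + ZMod.stdAddChar (t * (⌊x * (b : ℝ) ^ (N + 1)⌋ : ZMod b)) *
    ((∫ y in (0 : ℝ)..(Int.fract (x * (b : ℝ) ^ (N + 1)) * ((b : ℝ) ^ (N + 1))⁻¹), W y) - μ)

/-- Write `W = (W - M) + M`. The mean-zero part is bounded by `norm_integral_le_half`. The constant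
part combines with the subtracted term to `δ M / (1 - ω)` times minus a convex combination of `1`
and `ω`, which has norm at most 1. -/
theorem integral_fract_bound {δ O : ℝ} {W : ℝ → ℂ} {M ω : ℂ} (hδ : 0 < δ)
    (hi : ∀ x y, IntervalIntegrable W volume x y) (hm : ∫ x in (0 : ℝ)..δ, W x = δ * M)
    (hO : ∀ x, ‖W x - M‖ ≤ O) (hω : ‖ω‖ = 1) (hω1 : 1 - ω ≠ 0) {θ : ℝ} (h0 : 0 ≤ θ) (h1 : θ ≤ 1) :
    ‖(∫ y in (0 : ℝ)..(θ * δ), W y) - δ * M / (1 - ω)‖ ≤ δ * (‖M‖ / ‖1 - ω‖ + O / 2) := by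
  have ig : ∀ x y, IntervalIntegrable (fun t => W t - M) volume x y :=
    fun x y => (hi x y).sub intervalIntegrable_const
  have e0 : ∫ x in (0 : ℝ)..δ, (W x - M) = 0 := by
    rw [intervalIntegral.integral_sub (hi _ _) intervalIntegrable_const, hm]
    simp
  have e1 := norm_integral_le_half (ig 0 δ) e0 (fun x _ => hO x) le_rfl (x := θ * δ)
    (by positivity) (by nlinarith)
  have e2 : ∫ y in (0 : ℝ)..(θ * δ), W y =
      (∫ y in (0 : ℝ)..(θ * δ), (W y - M)) + θ * δ * M := by
    rw [intervalIntegral.integral_sub (hi _ _) intervalIntegrable_const]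
    simp
  have e3 : (∫ y in (0 : ℝ)..(θ * δ), W y) - δ * M / (1 - ω) =
      (∫ y in (0 : ℝ)..(θ * δ), (W y - M)) + (δ * M / (1 - ω)) * (-((1 - θ : ℝ) + θ * ω)) := by
    rw [e2]; push_cast; field_simp; ring
  have e4 : ‖-(((1 - θ : ℝ) : ℂ) + θ * ω)‖ ≤ 1 := by
    rw [norm_neg]
    refine (norm_add_le _ _).trans ?_
    rw [norm_mul, hω, Complex.norm_real, Complex.norm_real, Real.norm_of_nonneg (by linarith),
      Real.norm_of_nonneg h0]
    linarith
  rw [e3]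
  refine (norm_add_le _ _).trans ?_
  have e5 : ‖(δ * M / (1 - ω) : ℂ)‖ = δ * (‖M‖ / ‖1 - ω‖) := by
    rw [norm_div, norm_mul, Complex.norm_real, Real.norm_of_nonneg hδ.le, mul_div_assoc]
  have e6 : ‖(δ * M / (1 - ω)) * (-(((1 - θ : ℝ) : ℂ) + θ * ω))‖ ≤ δ * (‖M‖ / ‖1 - ω‖) := by
    rw [norm_mul, ← e5]
    exact mul_le_of_le_one_right (norm_nonneg _) e4
  linarith

namespace IsCellPeriodic

variable {N : ℕ} {W : ℝ → ℂ} {M : ℂ} {O : ℝ}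

/-- Along `b` consecutive cells the character runs through all `b`-th roots of unity while its
cofactor is periodic with the length of one cell. The oscillating part therefore integrates to zero
and the mean is the constant term; the oscillation is bounded by `integral_fract_bound`. -/
theorem cellPrimitive {t : ZMod b} (h : IsCellPeriodic b (N + 1) W M O) (ht : t ≠ 0) :
    IsCellPeriodic b N
      (cellPrimitive N t W ((((b : ℝ) ^ (N + 1))⁻¹ : ℝ) * M / (1 - ZMod.stdAddChar t)))
      ((((b : ℝ) ^ (N + 1))⁻¹ : ℝ) * M / (1 - ZMod.stdAddChar t))
      (((b : ℝ) ^ (N + 1))⁻¹ * (‖M‖ / (2 * Real.sin (Real.pi / b)) + O / 2)) := by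
  have hb := b_pos b
  set T : ℝ := (b : ℝ) ^ (N + 1) with hT
  have hTpos : 0 < T := by positivity
  have hδ : 0 < T⁻¹ := by positivity
  set μ : ℂ := (T⁻¹ : ℝ) * M / (1 - ZMod.stdAddChar t) with hμ
  have hne := one_sub_stdAddChar_ne_zero ht
  set g : ℝ → ℂ := fun x => (∫ y in (0 : ℝ)..(Int.fract (x * T) * T⁻¹), W y) - μ with hg
  have hgm : Measurable g := by
    have : Continuous fun r => ∫ y in (0 : ℝ)..r, W y :=
      intervalIntegral.continuous_primitive h.intervalIntegrable 0
    exact (this.measurable.comp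
      ((measurable_fract.comp (measurable_id.mul_const _)).mul_const _)).sub_const _
  have hgb : ∀ x, ‖g x‖ ≤ T⁻¹ * (‖M‖ / (2 * Real.sin (Real.pi / b)) + O / 2) := by
    intro x
    refine (integral_fract_bound hδ h.intervalIntegrable h.mean h.osc (norm_stdAddChar t) hne
      (Int.fract_nonneg _) (Int.fract_lt_one _).le).trans ?_
    have := sin_pi_div_pos (b := b)
    gcongr
    exact two_sin_le_norm ht
  have hgp : Function.Periodic g T⁻¹ := by
    intro x
    simp only [hg]
    have : (x + T⁻¹) * T = x * T + 1 := by field_simp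
    rw [this, Int.fract_add_one]
  set u : ℝ → ℂ := fun x => ZMod.stdAddChar (t * (⌊x * T⌋ : ZMod b)) with hu
  have hum : Measurable u := by
    have : Measurable fun c : ℤ => (ZMod.stdAddChar (t * (c : ZMod b)) : ℂ) :=
      measurable_of_countable _
    exact this.comp (Int.measurable_floor.comp (measurable_id.mul_const _))
  have hW : IPL.cellPrimitive N t W μ = fun x => μ + u x * g x := rfl
  have hper : (b : ℝ) * T⁻¹ = ((b : ℝ) ^ N)⁻¹ := by rw [hT, pow_succ]; field_simp
  refine ⟨?_, ?_, ?_, ?_⟩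
  · rw [hW]; exact (hum.mul hgm).const_add _
  · rw [hW, ← hper]
    intro x
    have e1 : g (x + b * T⁻¹) = g x := hgp.nat_mul b x
    have e2 : u (x + b * T⁻¹) = u x := by
      simp only [hu]
      have : (x + b * T⁻¹) * T = x * T + (b : ℕ) := by field_simp
      rw [this, Int.floor_add_natCast]
      simp
    simp only [e1, e2]
  · rw [hW, ← hper]
    have ii : ∀ c d, IntervalIntegrable (fun x => g x * u x) volume c d :=
      intervalIntegrable_of_bound (hgm.mul hum)
        (C := T⁻¹ * (‖M‖ / (2 * Real.sin (Real.pi / b)) + O / 2)) fun x => by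
        simp only [norm_mul, hu, norm_stdAddChar, mul_one]; exact hgb x
    have key := integral_mul_step (z := fun c : ℤ => ZMod.stdAddChar (t * (c : ZMod b))) hδ hgp
      (u := u) (fun x => by simp only [hu, div_inv_eq_mul]) ii b (r := 0) hδ.le le_rfl
    have hs : ∑ i ∈ Finset.range b, (ZMod.stdAddChar (t * ((i : ℤ) : ZMod b)) : ℂ) = 0 := by
      have := sum_walGrid (N := 0) (κ := fun _ => t) ht b
      simpa [walGrid] using this
    rw [hs] at key
    simp only [add_zero, mul_zero, intervalIntegral.integral_same] at key
    simp_rw [mul_comm (u _)]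
    rw [intervalIntegral.integral_add intervalIntegrable_const (ii _ _), key]
    simp
  · intro x
    rw [hW]
    simp only [add_sub_cancel_left, norm_mul, hu, norm_stdAddChar, one_mul]
    exact hgb x

/-- With `ω` the character value of `κ N`, `c` the number of the current cell and `μ` the constant
term, the complete cells contribute `μ (1 - ω ^ c)` and the last one `ω ^ c` times a partial
integral, both multiplied by the coarser Walsh function. Thus one integration strips one digit. -/
theorem integral_mul_wal {κ : ℕ → ZMod b} (h : IsCellPeriodic b (N + 1) W M O) (ht : κ N ≠ 0)
    {x : ℝ} (hx : 0 ≤ x) :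
    ∫ y in (0 : ℝ)..x, W y * wal (N + 1) κ y =
      IPL.cellPrimitive N (κ N) W
        ((((b : ℝ) ^ (N + 1))⁻¹ : ℝ) * M / (1 - ZMod.stdAddChar (κ N))) x * wal N κ x := by
  have hb := b_pos b
  set T : ℝ := (b : ℝ) ^ (N + 1) with hT
  have hTpos : 0 < T := by positivity
  have hδ : 0 < T⁻¹ := by positivity
  have hne := one_sub_stdAddChar_ne_zero ht
  obtain ⟨c, hc⟩ : ∃ c : ℕ, ⌊x * T⌋ = c := Int.eq_ofNat_of_zero_le (Int.floor_nonneg.2 (by positivity))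
  have hfr : Int.fract (x * T) = x * T - c := by rw [Int.fract, hc]; simp
  have f0 := Int.fract_nonneg (x * T)
  have f1 := (Int.fract_lt_one (x * T)).le
  have key := integral_mul_step (z := walGrid κ (N + 1)) hδ h.periodic
      (u := wal (N + 1) κ) (fun x => by rw [wal, div_inv_eq_mul])
      (h.intervalIntegrable_mul (measurable_wal _ _) (norm_wal _ _)) c
      (r := Int.fract (x * T) * T⁻¹) (mul_le_of_le_one_left hδ.le f1) (by positivity)
  have ex : c * T⁻¹ + Int.fract (x * T) * T⁻¹ = x := by rw [hfr]; field_simp; ring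
  have ew : wal N κ x = walGrid κ N ((c : ℤ) / b) := by
    rw [wal, ← floor_mul_pow_div, ← hT, hc]
  rw [ex, h.mean, sum_walGrid ht, walGrid] at key
  rw [key, IPL.cellPrimitive, ew, hc]
  simp only [Int.cast_natCast]
  ring

/-- The point 1 begins a cell whose last digit is 0, so the two occurrences of `μ` cancel. This is
the vanishing boundary term of the integration by parts. -/
theorem cellPrimitive_one {t : ZMod b} (μ : ℂ) : IPL.cellPrimitive N t W μ 1 = 0 := by
  have e : (1 : ℝ) * (b : ℝ) ^ (N + 1) = ((b ^ (N + 1) : ℕ) : ℝ) := by simp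
  rw [IPL.cellPrimitive, e, Int.fract_natCast, Int.floor_natCast]
  simp

end IsCellPeriodic

end

section
variable {b : ℕ} [Fact b.Prime]

/-! ### Decay of Walsh coefficients in one variable -/

/-- Measurable and bounded on the unit interval. -/
def BoundedOnUnit (ψ : ℝ → ℂ) : Prop := Measurable ψ ∧ ∃ C, ∀ x ∈ Set.Icc (0 : ℝ) 1, ‖ψ x‖ ≤ C

/-- The functionals `ψ ↦ ∫ f^(i) ψ` for `i ≤ α`, with the properties of the derivatives of
a function that the decay of its Walsh coefficients depends on. -/
structure IsDerivFamily (α : ℕ) (A : ℕ → (ℝ → ℂ) → ℂ) (B : ℝ) : Prop where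
  add : ∀ i ≤ α, ∀ (c : ℂ) (ψ : ℝ → ℂ), BoundedOnUnit ψ →
    A i (fun x => c + ψ x) = c * A i (fun _ => 1) + A i ψ
  parts : ∀ i < α, ∀ ψ h : ℝ → ℂ, BoundedOnUnit ψ → BoundedOnUnit h →
    (∀ x ∈ Set.Icc (0 : ℝ) 1, ∫ y in (0 : ℝ)..x, ψ y = h x) → h 1 = 0 → A i ψ = -A (i + 1) h
  norm_one_le : ∀ i, 1 ≤ i → i ≤ α → ‖A i fun _ => 1‖ ≤ B
  norm_top_le : ∀ (K : ℝ → ℂ) (C : ℝ), Measurable K → (∀ x ∈ Set.Icc (0 : ℝ) 1, ‖K x‖ ≤ C) →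
    ‖A α K‖ ≤ B * C

/-- The sum of the positions (counted from one) of the `n` leading nonzero digits among the first
`N` digits `κ`. -/
def topDigitSum (κ : ℕ → ZMod b) : ℕ → ℕ → ℕ
  | 0, _ => 0
  | N + 1, n => if κ N = 0 ∨ n = 0 then topDigitSum κ N n else N + 1 + topDigitSum κ N (n - 1)

theorem topDigitSum_zero_right (κ : ℕ → ZMod b) (N : ℕ) : topDigitSum κ N 0 = 0 := by
  induction N with
  | zero => rfl
  | succ N ih => simp [topDigitSum, ih]

namespace IsDerivFamily

variable {α : ℕ} {A : ℕ → (ℝ → ℂ) → ℂ} {B : ℝ}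

theorem nonneg (h : IsDerivFamily α A B) (hα : 1 ≤ α) : 0 ≤ B :=
  (norm_nonneg _).trans (h.norm_one_le 1 le_rfl hα)

/-- Split off the mean and integrate the remainder by parts. Its primitive vanishes at both ends and
has mean and oscillation at most `O / 2` each, so the bound `‖M‖ + O` reproduces itself at order `i
+ 1`. Once order `α` is reached, the sup-norm bound ends the process. -/
theorem norm_le_mean_add_osc (h : IsDerivFamily α A B) (hα : 1 ≤ α) (n : ℕ) :
    ∀ (i : ℕ) (W : ℝ → ℂ) (M : ℂ) (O : ℝ), i + n = α → 1 ≤ i → Measurable W →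
      ∫ x in (0 : ℝ)..1, W x = M → (∀ x ∈ Set.Icc (0 : ℝ) 1, ‖W x - M‖ ≤ O) →
      ‖A i W‖ ≤ B * (‖M‖ + O) := by
  have hB := h.nonneg hα
  induction n with
  | zero =>
    intro i W M O hi _ hW _ hO
    rw [add_zero] at hi
    subst hi
    refine h.norm_top_le W _ hW fun x hx => ?_
    have := norm_add_le (W x - M) M
    rw [sub_add_cancel] at this
    linarith [hO x hx]
  | succ n ih =>
    intro i W M O hi h1 hW hM hO
    -- `W` is bounded only on the unit interval; cutting it off there makes the primitive continuous
    -- on the whole line.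
    set g : ℝ → ℂ := (Set.Icc (0 : ℝ) 1).indicator fun x => W x - M with hg
    have hgm : Measurable g := (hW.sub_const M).indicator measurableSet_Icc
    have hO0 : 0 ≤ O := (norm_nonneg _).trans (hO 0 (by simp))
    have hgb : ∀ x, ‖g x‖ ≤ O := by
      intro x
      by_cases hx : x ∈ Set.Icc (0 : ℝ) 1
      · rw [hg, Set.indicator_of_mem hx]; exact hO x hx
      · rw [hg, Set.indicator_of_notMem hx, norm_zero]; exact hO0
    have ii := intervalIntegrable_of_bound hgm hgb
    have hgW : ∀ x ∈ Set.Icc (0 : ℝ) 1, g x = W x - M := fun x hx => by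
      rw [hg, Set.indicator_of_mem hx]
    have hi' : IntervalIntegrable W volume 0 1 := by
      have : IntervalIntegrable (fun x => g x + M) volume 0 1 := (ii 0 1).add intervalIntegrable_const
      refine this.congr fun x hx => ?_
      rw [Set.uIoc_of_le zero_le_one] at hx
      simp only [hgW x ⟨hx.1.le, hx.2⟩, sub_add_cancel]
    have h0 : ∫ x in (0 : ℝ)..1, g x = 0 := by
      have : ∫ x in (0 : ℝ)..1, g x = ∫ x in (0 : ℝ)..1, (W x - M) :=
        intervalIntegral.integral_congr fun x hx => by
          rw [Set.uIcc_of_le zero_le_one] at hx; exact hgW x hx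
      rw [this, intervalIntegral.integral_sub hi' intervalIntegrable_const, hM]
      simp
    set H : ℝ → ℂ := fun x => ∫ y in (0 : ℝ)..x, g y with hH
    have hHc : Continuous H := intervalIntegral.continuous_primitive ii 0
    have osc : ∀ x ∈ Set.Icc (0 : ℝ) 1, ∀ y ∈ Set.Icc (0 : ℝ) 1, ‖H x - H y‖ ≤ O / 2 := by
      have aux : ∀ x ∈ Set.Icc (0 : ℝ) 1, ∀ y ∈ Set.Icc (0 : ℝ) 1, y ≤ x →
          ‖H x - H y‖ ≤ O / 2 := by
        intro x hx y hy hyx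
        have := norm_integral_le_half (ii 0 1) h0 (fun x _ => hgb x) hy.1 hyx hx.2
        rw [one_mul] at this
        rwa [hH, intervalIntegral.integral_interval_sub_left (ii _ _) (ii _ _)]
      intro x hx y hy
      rcases le_total y x with hyx | hyx
      · exact aux x hx y hy hyx
      · rw [norm_sub_rev]; exact aux y hy x hx hyx
    have hH0 : H 0 = 0 := by simp [hH]
    have hHb : ∀ x ∈ Set.Icc (0 : ℝ) 1, ‖H x‖ ≤ O / 2 := fun x hx => by
      simpa [hH0] using osc x hx 0 (by simp)
    have mean : ‖∫ x in (0 : ℝ)..1, H x‖ ≤ O / 2 := by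
      have := intervalIntegral.norm_integral_le_of_norm_le_const (f := H) (a := 0) (b := 1)
        (C := O / 2) fun x hx => by
          rw [Set.uIoc_of_le zero_le_one] at hx; exact hHb x ⟨hx.1.le, hx.2⟩
      simpa using this
    have oscm : ∀ x ∈ Set.Icc (0 : ℝ) 1, ‖H x - ∫ y in (0 : ℝ)..1, H y‖ ≤ O / 2 := by
      intro x hx
      have e : H x - ∫ y in (0 : ℝ)..1, H y = ∫ y in (0 : ℝ)..1, (H x - H y) := by
        rw [intervalIntegral.integral_sub intervalIntegrable_const (hHc.intervalIntegrable _ _)]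
        simp
      rw [e]
      have := intervalIntegral.norm_integral_le_of_norm_le_const (f := fun y => H x - H y) (a := 0)
        (b := 1) (C := O / 2) fun y hy => by
          rw [Set.uIoc_of_le zero_le_one] at hy; exact osc x hx y ⟨hy.1.le, hy.2⟩
      simpa using this
    have e1 : A i W = M * A i (fun _ => 1) + A i (fun x => W x - M) := by
      rw [← h.add i (by omega) M _ ⟨hW.sub_const M, O, hO⟩]
      simp
    have e2 : A i (fun x => W x - M) = -A (i + 1) H := by
      refine h.parts i (by omega) _ _ ⟨hW.sub_const M, O, hO⟩ ⟨hHc.measurable, _, hHb⟩ ?_ h0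
      intro x hx
      refine intervalIntegral.integral_congr fun y hy => ?_
      rw [Set.uIcc_of_le hx.1] at hy
      exact (hgW y ⟨hy.1, hy.2.trans hx.2⟩).symm
    have e3 := ih (i + 1) H _ (O / 2) (by omega) (by omega) hHc.measurable rfl oscm
    rw [e1, e2]
    refine (norm_add_le _ _).trans ?_
    rw [norm_neg, norm_mul]
    have e4 := mul_le_mul_of_nonneg_left (h.norm_one_le i h1 (by omega)) (norm_nonneg M)
    have e5 := mul_le_mul_of_nonneg_left mean hB
    nlinarith

/-- Here `i` counts the integrations by parts already done, `n` those still available, and `D` is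
the product of the factors `b ^ (-position)` gained so far. The invariants `‖M‖ ≤ D * m⁻¹ ^ i` and
`O ≤ 2 * E * D` survive every step. The process stops when no digit or no derivative is left, and
then mean plus oscillation is at most `3 * E * D`. A constant has no bound under `A 0`, which is why
some integration must have been done or some nonzero digit must remain. -/
theorem norm_mul_wal_le (h : IsDerivFamily α A B) (hα : 1 ≤ α) {E m : ℝ}
    (hm : m = 2 * Real.sin (Real.pi / b))
    (hE : ∀ i, 1 ≤ i → i ≤ α → (m⁻¹) ^ i ≤ E) (κ : ℕ → ZMod b) (N : ℕ) :
    ∀ (n i : ℕ) (D : ℝ) (W : ℝ → ℂ) (M : ℂ) (O : ℝ), i + n = α → 0 ≤ D →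
      (1 ≤ i ∨ ∃ j < N, κ j ≠ 0) →
      IsCellPeriodic b N W M O → ‖M‖ ≤ D * (m⁻¹) ^ i → O ≤ 2 * E * D →
      ‖A i (fun x => W x * wal N κ x)‖ ≤
        B * (3 * E * D * ((b : ℝ) ^ topDigitSum κ N n)⁻¹) := by
  have hb := b_pos b
  have hB := h.nonneg hα
  have hm0 : 0 < m := by rw [hm]; have := sin_pi_div_pos (b := b); positivity
  induction N with
  | zero =>
    intro n i D W M O hi hD hk hW hM hO
    have h1 : 1 ≤ i := by
      rcases hk with h | ⟨j, hj, _⟩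
      · exact h
      · omega
    have hmean := hW.mean
    simp only [pow_zero, inv_one, Complex.ofReal_one, one_mul] at hmean
    have := h.norm_le_mean_add_osc hα n i W M O hi h1 hW.measurable hmean (fun x _ => hW.osc x)
    simp only [wal, walGrid, mul_one, topDigitSum, pow_zero, inv_one]
    refine this.trans (mul_le_mul_of_nonneg_left ?_ hB)
    have := mul_le_mul_of_nonneg_left (hE i h1 (by omega)) hD
    linarith
  | succ N ih =>
    intro n i D W M O hi hD hk hW hM hO
    by_cases hκ : κ N = 0
    · have e : (fun x => W x * wal (N + 1) κ x) = fun x => W x * wal N κ x := by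
        ext x; rw [wal_succ, hκ]; simp
      rw [e]
      have ht : topDigitSum κ (N + 1) n = topDigitSum κ N n := by simp [topDigitSum, hκ]
      rw [ht]
      refine ih n i D W M O hi hD ?_ hW.of_succ hM hO
      rcases hk with h | ⟨j, hj, hj0⟩
      · exact Or.inl h
      · refine Or.inr ⟨j, ?_, hj0⟩
        rcases Nat.lt_succ_iff_lt_or_eq.1 hj with h | h
        · exact h
        · exact absurd (h ▸ hκ) hj0
    · cases n with
      | zero =>
        rw [topDigitSum_zero_right, pow_zero, inv_one, mul_one]
        rw [add_zero] at hi
        subst hi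
        refine h.norm_top_le _ _ (hW.measurable.mul (measurable_wal _ _)) fun x _ => ?_
        rw [norm_mul, norm_wal, mul_one]
        refine (hW.norm_le x).trans ?_
        have := mul_le_mul_of_nonneg_left (hE i hα le_rfl) hD
        linarith
      | succ n =>
        set T : ℝ := (b : ℝ) ^ (N + 1) with hT
        have hTpos : 0 < T := by positivity
        have hV := hW.cellPrimitive hκ
        rw [← hT] at hV
        set μ : ℂ := (T⁻¹ : ℝ) * M / (1 - ZMod.stdAddChar (κ N)) with hμ
        have ht : topDigitSum κ (N + 1) (n + 1) = (N + 1) + topDigitSum κ N n := by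
          simp [topDigitSum, hκ]
        have hWw : BoundedOnUnit fun x => W x * wal (N + 1) κ x :=
          ⟨hW.measurable.mul (measurable_wal _ _), ‖M‖ + O, fun x _ => by
            rw [norm_mul, norm_wal, mul_one]; exact hW.norm_le x⟩
        have hVw : BoundedOnUnit fun x => cellPrimitive N (κ N) W μ x * wal N κ x :=
          ⟨hV.measurable.mul (measurable_wal _ _), _, fun x _ => by
            rw [norm_mul, norm_wal, mul_one]; exact hV.norm_le x⟩
        have e := h.parts i (by omega) _ _ hWw hVw
          (fun x hx => hW.integral_mul_wal hκ hx.1)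
          (by rw [IsCellPeriodic.cellPrimitive_one, zero_mul])
        rw [e, norm_neg, ht, pow_add, ← hT]
        have hE0 : 0 ≤ E := (by positivity : (0 : ℝ) ≤ (m⁻¹) ^ 1).trans (hE 1 le_rfl hα)
        have hm' := two_sin_le_norm hκ
        rw [← hm] at hm'
        have b1 : ‖μ‖ ≤ (T⁻¹ * D) * (m⁻¹) ^ (i + 1) := by
          rw [hμ, norm_div, norm_mul, Complex.norm_real, Real.norm_of_nonneg (by positivity),
            div_eq_mul_inv]
          calc T⁻¹ * ‖M‖ * ‖1 - ZMod.stdAddChar (κ N)‖⁻¹ ≤ T⁻¹ * (D * (m⁻¹) ^ i) * m⁻¹ := by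
                gcongr
            _ = _ := by ring
        -- The factor 2 is the fixed point of the recursion: the mean contributes `E * D` and half
        -- the old oscillation contributes another `E * D`.
        have b2 : T⁻¹ * (‖M‖ / (2 * Real.sin (Real.pi / b)) + O / 2) ≤ 2 * E * (T⁻¹ * D) := by
          rw [← hm]
          have : ‖M‖ / m ≤ D * E := by
            rw [div_eq_mul_inv]
            calc ‖M‖ * m⁻¹ ≤ D * (m⁻¹) ^ i * m⁻¹ := by gcongr
              _ = D * (m⁻¹) ^ (i + 1) := by ring
              _ ≤ _ := by gcongr; exact hE _ (by omega) (by omega)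
          calc T⁻¹ * (‖M‖ / m + O / 2) ≤ T⁻¹ * (D * E + 2 * E * D / 2) := by gcongr
            _ = _ := by ring
        have := ih n (i + 1) (T⁻¹ * D) _ μ _ (by omega) (by positivity) (Or.inl (by omega)) hV b1 b2
        refine this.trans (le_of_eq ?_)
        rw [mul_inv]; ring

theorem norm_wal_le (h : IsDerivFamily α A B) (hα : 1 ≤ α) {E : ℝ}
    (hE : ∀ i, 1 ≤ i → i ≤ α → ((2 * Real.sin (Real.pi / b))⁻¹) ^ i ≤ E)
    {κ : ℕ → ZMod b} {N : ℕ} (hκ : ∃ j < N, κ j ≠ 0) :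
    ‖A 0 (wal N κ)‖ ≤ 3 * E * ((b : ℝ) ^ topDigitSum κ N α)⁻¹ * B := by
  have hE0 : 0 ≤ E := by
    have := sin_pi_div_pos (b := b)
    exact (by positivity : (0 : ℝ) ≤ ((2 * Real.sin (Real.pi / b))⁻¹) ^ 1).trans (hE 1 le_rfl hα)
  have := h.norm_mul_wal_le hα rfl hE κ N α 0 1 (fun _ => 1) 1 0 (by omega) zero_le_one
    (Or.inr hκ) (.const N) (by simp) (by linarith)
  simp only [one_mul, mul_one] at this
  linarith

end IsDerivFamily

/-- The Walsh functions other than the constant one have mean zero. -/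
theorem integral_wal {κ : ℕ → ZMod b} {N : ℕ} (hκ : ∃ j < N, κ j ≠ 0) :
    ∫ x in (0 : ℝ)..1, wal N κ x = 0 := by
  induction N with
  | zero => obtain ⟨j, hj, _⟩ := hκ; omega
  | succ N ih =>
    by_cases h : κ N = 0
    · have : wal (N + 1) κ = wal N κ := by ext x; rw [wal_succ, h]; simp
      rw [this]
      obtain ⟨j, hj, hj0⟩ := hκ
      refine ih ⟨j, ?_, hj0⟩
      rcases Nat.lt_succ_iff_lt_or_eq.1 hj with hh | hh
      · exact hh
      · exact absurd (hh ▸ h) hj0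
    · have := (IsCellPeriodic.const (b := b) (N + 1)).integral_mul_wal h zero_le_one
      simp only [one_mul] at this
      rw [this, IsCellPeriodic.cellPrimitive_one, zero_mul]

end

section
/-! ### Approximation by test functions in one variable -/

/-- Smooth functions with compact support in the open unit interval. -/
structure IsUnitTest (φ : ℝ → ℂ) : Prop where
  contDiff : ContDiff ℝ (⊤ : ℕ∞) φ
  tsupport_subset : tsupport φ ⊆ Set.Ioo 0 1

namespace IsUnitTest

theorem hasCompactSupport {φ : ℝ → ℂ} (h : IsUnitTest φ) : HasCompactSupport φ :=
  isCompact_Icc.of_isClosed_subset (isClosed_tsupport φ)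
    (h.tsupport_subset.trans Set.Ioo_subset_Icc_self)

theorem continuous {φ : ℝ → ℂ} (h : IsUnitTest φ) : Continuous φ := h.contDiff.continuous

theorem deriv {φ : ℝ → ℂ} (h : IsUnitTest φ) : IsUnitTest (deriv φ) where
  contDiff := by
    have := h.contDiff
    rw [show ((⊤ : ℕ∞) : WithTop ℕ∞) = ((⊤ : ℕ∞) : WithTop ℕ∞) + 1 from rfl] at this
    exact (contDiff_succ_iff_deriv.1 this).2.2
  tsupport_subset := (tsupport_deriv_subset (𝕜 := ℝ)).trans h.tsupport_subset

theorem iteratedDeriv {φ : ℝ → ℂ} (h : IsUnitTest φ) (n : ℕ) : IsUnitTest (iteratedDeriv n φ) := by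
  induction n with
  | zero => simpa using h
  | succ n ih => rw [iteratedDeriv_succ]; exact ih.deriv

theorem eq_zero {φ : ℝ → ℂ} (h : IsUnitTest φ) {x : ℝ} (hx : x ∉ Set.Ioo (0 : ℝ) 1) : φ x = 0 :=
  image_eq_zero_of_notMem_tsupport fun h' => hx (h.tsupport_subset h')

theorem exists_bound {φ : ℝ → ℂ} (h : IsUnitTest φ) : ∃ C, ∀ x, ‖φ x‖ ≤ C :=
  h.continuous.bounded_above_of_compact_support h.hasCompactSupport

/-- The primitive of a test function with integral zero. -/
theorem primitive {φ : ℝ → ℂ} (h : IsUnitTest φ) (h0 : ∫ x in (0 : ℝ)..1, φ x = 0) :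
    IsUnitTest fun x => ∫ y in (0 : ℝ)..x, φ y where
  contDiff := by
    have hd : ∀ x, HasDerivAt (fun x => ∫ y in (0 : ℝ)..x, φ y) (φ x) x := fun x =>
      h.continuous.integral_hasStrictDerivAt 0 x |>.hasDerivAt
    rw [show ((⊤ : ℕ∞) : WithTop ℕ∞) = ((⊤ : ℕ∞) : WithTop ℕ∞) + 1 from rfl]
    refine contDiff_succ_iff_deriv.2 ⟨fun x => (hd x).differentiableAt, by simp, ?_⟩
    rw [show _root_.deriv (fun x => ∫ y in (0 : ℝ)..x, φ y) = φ from funext fun x => (hd x).deriv]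
    exact h.contDiff
  tsupport_subset := by
    rcases (tsupport φ).eq_empty_or_nonempty with he | hne
    · have : φ = 0 := tsupport_eq_empty_iff.1 he
      simp [this, tsupport]
    have hc : IsCompact (tsupport φ) := h.hasCompactSupport
    have hlo := h.tsupport_subset (hc.sInf_mem hne)
    have hhi := h.tsupport_subset (hc.sSup_mem hne)
    set l := sInf (tsupport φ)
    set u := sSup (tsupport φ)
    have hsub : tsupport (fun x => ∫ y in (0 : ℝ)..x, φ y) ⊆ Set.Icc l u := by
      refine closure_minimal ?_ isClosed_Icc
      intro x hx
      by_contra hn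
      apply hx
      have hz : ∀ y, y ∉ Set.Icc l u → φ y = 0 := fun y hy =>
        image_eq_zero_of_notMem_tsupport fun hy' =>
          hy ⟨csInf_le hc.bddBelow hy', le_csSup hc.bddAbove hy'⟩
      rw [Set.mem_Icc, not_and_or, not_le, not_le] at hn
      rcases hn with hn | hn
      · have : Set.EqOn φ 0 (Set.uIcc 0 x) := fun y hy => hz y fun hy' => by
          rw [Set.mem_uIcc] at hy
          rcases hy with hy | hy
          · linarith [hy.2, hy'.1]
          · linarith [hy.2, hy'.1, hlo.1]
        exact (intervalIntegral.integral_congr this).trans (by simp)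
      · have e := intervalIntegral.integral_add_adjacent_intervals
          (h.continuous.intervalIntegrable (μ := volume) 0 x)
          (h.continuous.intervalIntegrable (μ := volume) x 1)
        have : Set.EqOn φ 0 (Set.uIcc x 1) := fun y hy => hz y fun hy' => by
          rw [Set.mem_uIcc] at hy
          rcases hy with hy | hy
          · linarith [hy.1, hy'.2]
          · linarith [hy.1, hy'.2, hhi.2]
        rw [intervalIntegral.integral_congr this, h0] at e
        simpa using e
    exact hsub.trans fun x hx => ⟨hlo.1.trans_le hx.1, hx.2.trans_lt hhi.2⟩

end IsUnitTest

open Filter Topology in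
/-- Bounded measurable functions are bounded limits almost everywhere of test functions. -/
theorem exists_test_tendsto {ψ : ℝ → ℂ} (hψ : BoundedOnUnit ψ) :
    ∃ (φ : ℕ → ℝ → ℂ) (C : ℝ), (∀ n, IsUnitTest (φ n)) ∧ (∀ n x, ‖φ n x‖ ≤ C) ∧
      ∀ᵐ x ∂volume.restrict (Set.Icc (0 : ℝ) 1), Tendsto (fun n => φ n x) atTop (𝓝 (ψ x)) := by
  obtain ⟨hm, C, hC⟩ := hψ
  set g : ℝ → ℂ := (Set.Icc (0 : ℝ) 1).indicator ψ with hg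
  have hC0 : 0 ≤ C := (norm_nonneg _).trans (hC 0 (by simp))
  have hgm : Measurable g := hm.indicator measurableSet_Icc
  have hgb : ∀ x, ‖g x‖ ≤ C := by
    intro x
    by_cases hx : x ∈ Set.Icc (0 : ℝ) 1
    · rw [hg, Set.indicator_of_mem hx]; exact hC x hx
    · rw [hg, Set.indicator_of_notMem hx, norm_zero]; exact hC0
  have hgl : LocallyIntegrable g := by
    refine (locallyIntegrable_const (C : ℝ)).mono hgm.aestronglyMeasurable
      (Eventually.of_forall fun x => ?_)
    rw [Real.norm_of_nonneg hC0]; exact hgb x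
  -- Mollifiers with a fixed ratio 2 of the radii, as almost everywhere convergence by
  -- differentiation of integrals requires.
  let β : ℕ → ContDiffBump (0 : ℝ) := fun n =>
    ⟨1 / ((n : ℝ) + 1), 2 / ((n : ℝ) + 1), by positivity, by gcongr; norm_num⟩
  -- Cutoffs whose radii increase to `1 / 2` around the midpoint: each has support inside the open
  -- interval, and at every interior point they are eventually 1.
  let χ : ℕ → ContDiffBump (1 / 2 : ℝ) := fun n =>
    ⟨1 / 2 - 1 / ((n : ℝ) + 3), 1 / 2 - 1 / ((n : ℝ) + 4), by
      have : 1 / ((n : ℝ) + 3) ≤ 1 / 3 := by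
        apply one_div_le_one_div_of_le <;> linarith [(Nat.cast_nonneg n : (0 : ℝ) ≤ n)]
      linarith, by
      have : 1 / ((n : ℝ) + 4) < 1 / ((n : ℝ) + 3) := by
        apply one_div_lt_one_div_of_lt <;> linarith [(Nat.cast_nonneg n : (0 : ℝ) ≤ n)]
      linarith⟩
  let c : ℕ → ℝ → ℂ := fun n => MeasureTheory.convolution ((β n).normed volume) g
    (ContinuousLinearMap.lsmul ℝ ℝ) volume
  have hcd : ∀ n, ContDiff ℝ (⊤ : ℕ∞) (c n) := fun n =>
    (β n).hasCompactSupport_normed.contDiff_convolution_left _ (β n).contDiff_normed hgl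
  have hcb : ∀ n x, ‖c n x‖ ≤ C := by
    intro n x
    simp only [c, MeasureTheory.convolution_def, ContinuousLinearMap.lsmul_apply]
    calc ‖∫ t, (β n).normed volume t • g (x - t)‖ ≤ ∫ t, (β n).normed volume t * C := by
          refine norm_integral_le_of_norm_le ((β n).integrable_normed.mul_const C)
            (Eventually.of_forall fun t => ?_)
          rw [norm_smul, Real.norm_of_nonneg ((β n).nonneg_normed t)]
          exact mul_le_mul_of_nonneg_left (hgb _) ((β n).nonneg_normed t)
      _ = C := by rw [integral_mul_const, (β n).integral_normed, one_mul]
  have hlim : Tendsto (fun n : ℕ => 1 / ((n : ℝ) + 1)) atTop (𝓝 0) :=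
    tendsto_one_div_add_atTop_nhds_zero_nat
  have hct : ∀ᵐ x, Tendsto (fun n => c n x) atTop (𝓝 (g x)) := by
    refine ContDiffBump.ae_convolution_tendsto_right_of_locallyIntegrable (K := 2) ?_ ?_ hgl
    · have := hlim.const_mul 2
      simpa [β, div_eq_mul_inv] using this
    · exact Eventually.of_forall fun n => by simp only [β]; rw [mul_one_div]
  refine ⟨fun n x => (χ n x : ℂ) * c n x, C, fun n => ⟨?_, ?_⟩, fun n x => ?_, ?_⟩
  · exact (Complex.ofRealCLM.contDiff.comp (χ n).contDiff).mul (hcd n)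
  · have h1 : tsupport (fun x => (χ n x : ℂ) * c n x) ⊆ tsupport (χ n) := by
      refine closure_mono fun x hx hx' => hx ?_
      simp only [hx', Complex.ofReal_zero, zero_mul]
    refine h1.trans ?_
    rw [(χ n).tsupport_eq, Real.closedBall_eq_Icc]
    have : (0 : ℝ) < 1 / ((n : ℝ) + 4) := by positivity
    intro x hx
    simp only [χ, Set.mem_Icc] at hx
    constructor <;> linarith [hx.1, hx.2]
  · rw [norm_mul, Complex.norm_real, Real.norm_of_nonneg (χ n).nonneg]
    exact (mul_le_of_le_one_left (norm_nonneg _) (χ n).le_one).trans (hcb n x)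
  · have h01 : ∀ᵐ x ∂volume.restrict (Set.Icc (0 : ℝ) 1), x ∈ Set.Ioo (0 : ℝ) 1 := by
      rw [← restrict_Ioo_eq_restrict_Icc]
      exact ae_restrict_mem measurableSet_Ioo
    filter_upwards [h01, ae_restrict_of_ae hct] with x hx hx2
    have e : g x = ψ x := by rw [hg, Set.indicator_of_mem (Set.Ioo_subset_Icc_self hx)]
    rw [← e]
    refine hx2.congr' ?_
    have hpos : 0 < 1 / 2 - |x - 1 / 2| := by
      have : |x - 1 / 2| < 1 / 2 := by rw [abs_lt]; constructor <;> linarith [hx.1, hx.2]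
      linarith
    filter_upwards [hlim.eventually (gt_mem_nhds hpos)] with n hn
    have : χ n x = 1 := by
      apply (χ n).one_of_mem_closedBall
      rw [Metric.mem_closedBall, Real.dist_eq]
      have : 1 / ((n : ℝ) + 3) ≤ 1 / ((n : ℝ) + 1) := by
        apply one_div_le_one_div_of_le <;> linarith [(Nat.cast_nonneg n : (0 : ℝ) ≤ n)]
      simp only [χ]
      linarith
    rw [this]; simp

theorem exists_unitTest_integral_eq_one : ∃ η : ℝ → ℂ, IsUnitTest η ∧ ∫ x in (0 : ℝ)..1, η x = 1 := by
  let χ : ContDiffBump (1 / 2 : ℝ) := ⟨1 / 8, 1 / 4, by norm_num, by norm_num⟩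
  refine ⟨fun x => (χ.normed volume x : ℂ), ⟨Complex.ofRealCLM.contDiff.comp χ.contDiff_normed, ?_⟩, ?_⟩
  · have h1 : tsupport (fun x => (χ.normed volume x : ℂ)) ⊆ tsupport (χ.normed volume) := by
      refine closure_mono fun x hx hx' => hx ?_
      simp only [hx', Complex.ofReal_zero]
    refine h1.trans ?_
    rw [χ.tsupport_normed_eq, Real.closedBall_eq_Icc]
    intro x hx
    simp only [χ, Set.mem_Icc] at hx
    constructor <;> linarith [hx.1, hx.2]
  · rw [intervalIntegral.integral_ofReal, intervalIntegral.integral_of_le zero_le_one,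
      setIntegral_eq_integral_of_forall_compl_eq_zero, χ.integral_normed]
    · simp
    · intro x hx
      by_contra hne
      have : x ∈ Function.support (χ.normed volume) := hne
      rw [χ.support_normed_eq, Real.ball_eq_Ioo] at this
      simp only [χ, Set.mem_Ioo] at this
      exact hx ⟨by linarith [this.1], by linarith [this.2]⟩

open Filter Topology in
/-- Lipschitz functions vanishing at the end points are, together with their derivatives, bounded
limits of test functions. -/
theorem exists_test_tendsto_deriv {ψ h : ℝ → ℂ} (hψ : BoundedOnUnit ψ)
    (hh : ∀ x ∈ Set.Icc (0 : ℝ) 1, ∫ y in (0 : ℝ)..x, ψ y = h x) (h1 : h 1 = 0) :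
    ∃ (φ : ℕ → ℝ → ℂ) (C : ℝ), (∀ n, IsUnitTest (φ n)) ∧ (∀ n x, ‖φ n x‖ ≤ C) ∧
      (∀ n x, ‖deriv (φ n) x‖ ≤ C) ∧
      (∀ᵐ x ∂volume.restrict (Set.Icc (0 : ℝ) 1), Tendsto (fun n => φ n x) atTop (𝓝 (h x))) ∧
      ∀ᵐ x ∂volume.restrict (Set.Icc (0 : ℝ) 1),
        Tendsto (fun n => deriv (φ n) x) atTop (𝓝 (ψ x)) := by
  obtain ⟨p, C, hp, hpC, hpt⟩ := exists_test_tendsto hψ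
  obtain ⟨η, hη, hη1⟩ := exists_unitTest_integral_eq_one
  obtain ⟨Cη, hCη⟩ := hη.exists_bound
  have hC0 : 0 ≤ C := (norm_nonneg _).trans (hpC 0 0)
  have hCη0 : 0 ≤ Cη := (norm_nonneg _).trans (hCη 0)
  have hlim : ∀ x ∈ Set.Icc (0 : ℝ) 1,
      Tendsto (fun n => ∫ y in (0 : ℝ)..x, p n y) atTop (𝓝 (h x)) := by
    intro x hx
    rw [← hh x hx]
    refine intervalIntegral.tendsto_integral_filter_of_dominated_convergence (fun _ => C)
      (Eventually.of_forall fun n => (hp n).continuous.aestronglyMeasurable)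
      (Eventually.of_forall fun n => Eventually.of_forall fun y _ => hpC n y)
      intervalIntegrable_const ?_
    rw [ae_restrict_iff' measurableSet_Icc] at hpt
    filter_upwards [hpt] with y hy hy'
    rw [Set.uIoc_of_le hx.1] at hy'
    exact hy ⟨hy'.1.le, hy'.2.trans hx.2⟩
  let I : ℕ → ℂ := fun n => ∫ y in (0 : ℝ)..1, p n y
  have hI0 : Tendsto I atTop (𝓝 0) := by
    have := hlim 1 (by simp)
    rwa [h1] at this
  have hIC : ∀ n, ‖I n‖ ≤ C := fun n => by
    have := intervalIntegral.norm_integral_le_of_norm_le_const (f := p n) (a := 0) (b := 1)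
      (C := C) fun x _ => hpC n x
    simpa using this
  -- Subtracting a multiple of `η` makes the integral zero, so that the primitive again has compact
  -- support in the open interval. The correction disappears in the limit because `I n` tends to `h
  -- 1 = 0`.
  let r : ℕ → ℝ → ℂ := fun n x => p n x - I n * η x
  have hr : ∀ n, IsUnitTest (r n) := fun n =>
    ⟨(hp n).contDiff.sub (contDiff_const.mul hη.contDiff), by
      refine (tsupport_sub _ _).trans (Set.union_subset (hp n).tsupport_subset ?_)
      have : tsupport (fun x => I n * η x) ⊆ tsupport η :=
        closure_mono fun x hx hx' => hx (by simp only [hx', mul_zero])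
      exact this.trans hη.tsupport_subset⟩
  have hrI : ∀ n x, ∫ y in (0 : ℝ)..x, r n y =
      (∫ y in (0 : ℝ)..x, p n y) - I n * ∫ y in (0 : ℝ)..x, η y := by
    intro n x
    rw [← intervalIntegral.integral_const_mul]
    exact intervalIntegral.integral_sub ((hp n).continuous.intervalIntegrable _ _)
      ((continuous_const.mul hη.continuous).intervalIntegrable _ _)
  have hr0 : ∀ n, ∫ y in (0 : ℝ)..1, r n y = 0 := fun n => by
    rw [hrI, hη1, mul_one]; exact sub_self _
  have hder : ∀ n, deriv (fun x => ∫ y in (0 : ℝ)..x, r n y) = r n := fun n => funext fun x =>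
    ((hr n).continuous.integral_hasStrictDerivAt 0 x).hasDerivAt.deriv
  have hrb : ∀ n x, ‖r n x‖ ≤ C + C * Cη := fun n x => by
    refine (norm_sub_le _ _).trans (add_le_add (hpC n x) ?_)
    rw [norm_mul]
    exact mul_le_mul (hIC n) (hCη x) (norm_nonneg _) hC0
  refine ⟨fun n x => ∫ y in (0 : ℝ)..x, r n y, C + C * Cη, fun n => (hr n).primitive (hr0 n),
    fun n x => ?_, fun n x => ?_, ?_, ?_⟩
  · change ‖∫ y in (0 : ℝ)..x, r n y‖ ≤ _
    by_cases hx : x ∈ Set.Ioo (0 : ℝ) 1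
    · have := intervalIntegral.norm_integral_le_of_norm_le_const (f := r n) (a := 0) (b := x)
        (C := C + C * Cη) fun x _ => hrb n x
      refine this.trans (mul_le_of_le_one_right (by positivity) ?_)
      rw [sub_zero, abs_of_pos hx.1]; exact hx.2.le
    · have : ∫ y in (0 : ℝ)..x, r n y = 0 := ((hr n).primitive (hr0 n)).eq_zero hx
      rw [this, norm_zero]; positivity
  · rw [hder]; exact hrb n x
  · filter_upwards [ae_restrict_mem measurableSet_Icc] with x hx
    simp only [hrI]
    have := (hlim x hx).sub (hI0.mul_const (∫ y in (0 : ℝ)..x, η y))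
    simpa using this
  · filter_upwards [hpt] with x hx
    simp only [hder]
    have := hx.sub (hI0.mul_const (η x))
    simpa using this

end

section
/-! ### Weak derivatives tested against products -/

variable {s : ℕ}

/-- The real part of a multiple of a product of functions of one variable. -/
def reProd (c : ℂ) (φ : Fin s → ℝ → ℂ) (x : Fin s → ℝ) : ℝ := (c * ∏ i, φ i (x i)).re

theorem contDiff_reProd (c : ℂ) {φ : Fin s → ℝ → ℂ} (hφ : ∀ i, IsUnitTest (φ i)) :
    ContDiff ℝ (⊤ : ℕ∞) (reProd c φ) := by
  have : ContDiff ℝ (⊤ : ℕ∞) fun x : Fin s → ℝ => c * ∏ i, φ i (x i) :=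
    contDiff_const.mul (contDiff_prod fun i _ => (hφ i).contDiff.comp (contDiff_apply ℝ ℝ i))
  exact Complex.reCLM.contDiff.comp this

theorem prod_update_eq (φ : Fin s → ℝ → ℂ) (j : Fin s) (g : ℝ → ℂ) (x : Fin s → ℝ) :
    ∏ i, Function.update φ j g i (x i) = g (x j) * ∏ i ∈ Finset.univ.erase j, φ i (x i) := by
  rw [← Finset.mul_prod_erase Finset.univ _ (Finset.mem_univ j), Function.update_self]
  congr 1
  refine Finset.prod_congr rfl fun i hi => ?_
  rw [Function.update_of_ne (Finset.ne_of_mem_erase hi)]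

theorem partialDeriv_reProd (c : ℂ) {φ : Fin s → ℝ → ℂ} (hφ : ∀ i, IsUnitTest (φ i)) (j : Fin s) :
    partialDeriv j (reProd c φ) = reProd c (Function.update φ j (deriv (φ j))) := by
  ext x
  have hd : DifferentiableAt ℝ (reProd c φ) x :=
    (contDiff_reProd c hφ).differentiable (by simp) x
  rw [partialDeriv, ← hd.lineDeriv_eq_fderiv, lineDeriv]
  have e : (fun t : ℝ => reProd c φ (x + t • Pi.single j 1)) =
      fun t : ℝ => (c * (φ j (x j + t) * ∏ i ∈ Finset.univ.erase j, φ i (x i))).re := by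
    ext t
    rw [reProd, ← Finset.mul_prod_erase Finset.univ _ (Finset.mem_univ j)]
    congr 3
    · simp
    · refine Finset.prod_congr rfl fun i hi => ?_
      simp [Pi.single_eq_of_ne (Finset.ne_of_mem_erase hi)]
  have hφd : HasDerivAt (φ j) (deriv (φ j) (x j + 0)) (x j + 0) :=
    ((hφ j).contDiff.differentiable (by simp) _).hasDerivAt
  have h1 : HasDerivAt (fun t : ℝ => φ j (x j + t)) (deriv (φ j) (x j + 0)) 0 :=
    hφd.comp_const_add (x j) 0
  have h2 := (h1.mul_const (∏ i ∈ Finset.univ.erase j, φ i (x i))).const_mul c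
  have h3 := Complex.reCLM.hasFDerivAt.comp_hasDerivAt (0 : ℝ) h2
  rw [e, reProd, prod_update_eq]
  refine (HasDerivAt.deriv h3).trans ?_
  simp

theorem isUnitTest_update {φ : Fin s → ℝ → ℂ} (hφ : ∀ i, IsUnitTest (φ i)) (j : Fin s)
    {g : ℝ → ℂ} (hg : IsUnitTest g) (i : Fin s) : IsUnitTest (Function.update φ j g i) := by
  by_cases h : i = j
  · subst h; simpa using hg
  · simpa [h] using hφ i

theorem iterate_partialDeriv_reProd (c : ℂ) {φ : Fin s → ℝ → ℂ} (hφ : ∀ i, IsUnitTest (φ i))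
    (j : Fin s) (n : ℕ) :
    (partialDeriv j)^[n] (reProd c φ) = reProd c (Function.update φ j (iteratedDeriv n (φ j))) := by
  induction n with
  | zero => simp
  | succ n ih =>
    rw [Function.iterate_succ_apply', ih,
      partialDeriv_reProd c (isUnitTest_update hφ j ((hφ j).iteratedDeriv n))]
    simp [iteratedDeriv_succ]

theorem mixedPartial_reProd (c : ℂ) {φ : Fin s → ℝ → ℂ} (hφ : ∀ i, IsUnitTest (φ i))
    (ν : Fin s → ℕ) :
    mixedPartial ν (reProd c φ) = reProd c fun i => iteratedDeriv (ν i) (φ i) := by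
  have key : ∀ l : List (Fin s), l.Nodup →
      l.foldr (fun j g => (partialDeriv j)^[ν j] g) (reProd c φ) =
        reProd c fun i => if i ∈ l then iteratedDeriv (ν i) (φ i) else φ i := by
    intro l hl
    induction l with
    | nil => simp
    | cons j l ih =>
      rw [List.nodup_cons] at hl
      rw [List.foldr_cons, ih hl.2, iterate_partialDeriv_reProd]
      · congr 1
        ext i x
        by_cases h : i = j
        · subst h; simp [hl.1]
        · simp [h]
      · intro i
        split_ifs
        · exact (hφ i).iteratedDeriv _
        · exact hφ i
  rw [mixedPartial, key _ (List.nodup_finRange s)]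
  simp

theorem tsupport_reProd_subset (c : ℂ) {φ : Fin s → ℝ → ℂ} :
    tsupport (reProd c φ) ⊆ Set.univ.pi fun i => tsupport (φ i) := by
  refine closure_minimal ?_ (isClosed_set_pi fun i _ => isClosed_tsupport _)
  intro x hx i _
  by_contra hn
  apply hx
  rw [reProd, Finset.prod_eq_zero (Finset.mem_univ i) (image_eq_zero_of_notMem_tsupport (f := φ i) hn)]
  simp

theorem cube_eq_pi (s : ℕ) : cube s = Set.univ.pi fun _ => Set.Icc (0 : ℝ) 1 := by
  rw [cube, ← Set.pi_univ_Icc]; rfl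

theorem restrict_cube (s : ℕ) : (volume.restrict (cube s) : Measure (Fin s → ℝ)) =
    Measure.pi fun _ => volume.restrict (Set.Icc (0 : ℝ) 1) := by
  rw [cube_eq_pi, volume_pi, Measure.restrict_pi_pi]

theorem measurableSet_cube (s : ℕ) : MeasurableSet (cube s) := measurableSet_Icc

instance : IsProbabilityMeasure (volume.restrict (Set.Icc (0 : ℝ) 1)) := ⟨by simp⟩

instance : IsProbabilityMeasure (volume.restrict (cube s)) := by
  rw [restrict_cube]; infer_instance

/-- The integral over the cube of a function times a product of functions of one variable. -/
noncomputable def pairing (G : (Fin s → ℝ) → ℝ) (ψ : Fin s → ℝ → ℂ) : ℂ :=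
  ∫ x in cube s, (G x : ℂ) * ∏ i, ψ i (x i)

theorem measurable_prod_apply {ψ : Fin s → ℝ → ℂ} (hψ : ∀ i, Measurable (ψ i)) :
    Measurable fun x : Fin s → ℝ => ∏ i, ψ i (x i) :=
  Finset.measurable_prod _ fun i _ => (hψ i).comp (measurable_pi_apply i)

theorem norm_prod_apply_le {ψ : Fin s → ℝ → ℂ} {C : Fin s → ℝ}
    (hC : ∀ i, ∀ x ∈ Set.Icc (0 : ℝ) 1, ‖ψ i x‖ ≤ C i) {x : Fin s → ℝ} (hx : x ∈ cube s) :
    ‖∏ i, ψ i (x i)‖ ≤ ∏ i, C i := by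
  rw [norm_prod]
  rw [cube_eq_pi] at hx
  exact Finset.prod_le_prod (fun i _ => norm_nonneg _) fun i _ => hC i _ (hx i (Set.mem_univ i))

theorem integrableOn_pairing {G : (Fin s → ℝ) → ℝ} (hG : IntegrableOn G (cube s))
    {ψ : Fin s → ℝ → ℂ} (hψ : ∀ i, BoundedOnUnit (ψ i)) :
    IntegrableOn (fun x => (G x : ℂ) * ∏ i, ψ i (x i)) (cube s) := by
  choose hm C hC using hψ
  refine hG.ofReal.mul_bdd (c := ∏ i, C i) (measurable_prod_apply hm).aestronglyMeasurable ?_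
  filter_upwards [ae_restrict_mem (measurableSet_cube s)] with x hx
  exact norm_prod_apply_le hC hx

theorem IsUnitTest.boundedOnUnit {φ : ℝ → ℂ} (h : IsUnitTest φ) : BoundedOnUnit φ :=
  ⟨h.continuous.measurable, h.exists_bound.imp fun _ hC x _ => hC x⟩

/-- The definition of a weak derivative admits real test functions only. It is applied to the real
part of `c` times the product; `c = 1` and `c = -i` recover the real and imaginary parts of the
complex identity. -/
theorem IsWeakDeriv.pairing_eq {ν : Fin s → ℕ} {F G : (Fin s → ℝ) → ℝ} (h : IsWeakDeriv ν F G)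
    (hF : IntegrableOn F (cube s)) {φ : Fin s → ℝ → ℂ} (hφ : ∀ i, IsUnitTest (φ i)) :
    pairing F (fun i => iteratedDeriv (ν i) (φ i)) = (-1) ^ (∑ j, ν j) * pairing G φ := by
  have real : ∀ c : ℂ, ∫ x in cube s, F x * reProd c (fun i => iteratedDeriv (ν i) (φ i)) x =
      (-1) ^ (∑ j, ν j) * ∫ x in cube s, G x * reProd c φ x := by
    intro c
    rw [← mixedPartial_reProd c hφ]
    have hsub := tsupport_reProd_subset c (φ := φ)
    refine h.integral_eq _ (contDiff_reProd c hφ) ?_ ?_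
    · exact (isCompact_univ_pi fun i => (hφ i).hasCompactSupport).of_isClosed_subset
        (isClosed_tsupport _) hsub
    · exact hsub.trans (Set.pi_mono fun i _ => (hφ i).tsupport_subset)
  have cplx : ∀ (H : (Fin s → ℝ) → ℝ) (ψ : Fin s → ℝ → ℂ) (c : ℂ), IntegrableOn H (cube s) →
      (∀ i, IsUnitTest (ψ i)) →
      ∫ x in cube s, H x * reProd c ψ x = (c * pairing H ψ).re := by
    intro H ψ c hH hψ
    rw [pairing, ← integral_const_mul]
    have hi := (integrableOn_pairing hH fun i => (hψ i).boundedOnUnit).const_mul c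
    rw [← Complex.reCLM_apply, ← Complex.reCLM.integral_comp_comm hi]
    congr 1
    ext x
    rw [reProd, Complex.reCLM_apply, mul_left_comm, Complex.re_ofReal_mul]
  have key : ∀ c : ℂ, (c * pairing F (fun i => iteratedDeriv (ν i) (φ i))).re =
      (c * ((-1) ^ (∑ j, ν j) * pairing G φ)).re := by
    intro c
    rw [← cplx _ _ _ hF fun i => (hφ i).iteratedDeriv _, real c, cplx _ _ _ h.integrableOn hφ,
      mul_left_comm]
    have : ((-1 : ℂ) ^ (∑ j, ν j)) = (((-1 : ℝ) ^ (∑ j, ν j) : ℝ) : ℂ) := by push_cast; rfl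
    rw [this, Complex.re_ofReal_mul]
  apply Complex.ext
  · simpa using key 1
  · simpa using key (-Complex.I)

/-- Moving all derivatives onto the test functions gives the same pairing with `F` on both sides;
the total orders differ by one, which leaves the sign. -/
theorem IsWeakDeriv.pairing_test {ν : Fin s → ℕ} {F G G' : (Fin s → ℝ) → ℝ} {j : Fin s}
    (h : IsWeakDeriv ν F G) (h' : IsWeakDeriv (Function.update ν j (ν j + 1)) F G')
    (hF : IntegrableOn F (cube s)) {φ : Fin s → ℝ → ℂ} (hφ : ∀ i, IsUnitTest (φ i)) :
    pairing G (Function.update φ j (deriv (φ j))) = -pairing G' φ := by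
  have e1 := h.pairing_eq hF (isUnitTest_update hφ j (hφ j).deriv)
  have e2 := h'.pairing_eq hF hφ
  have e3 : (fun i => iteratedDeriv (ν i) (Function.update φ j (deriv (φ j)) i)) =
      fun i => iteratedDeriv (Function.update ν j (ν j + 1) i) (φ i) := by
    ext i : 1
    by_cases hi : i = j
    · subst hi; simp [iteratedDeriv_succ']
    · simp [hi]
  have e4 : ∑ i, Function.update ν j (ν j + 1) i = ∑ i, ν i + 1 := by
    rw [Finset.sum_update_of_mem (Finset.mem_univ j), Finset.sdiff_singleton_eq_erase,
      ← Finset.add_sum_erase _ ν (Finset.mem_univ j)]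
    ring
  rw [e3, e2, e4, pow_succ] at e1
  have h0 : ((-1 : ℂ) ^ (∑ i, ν i)) ≠ 0 := pow_ne_zero _ (by norm_num)
  apply mul_left_cancel₀ h0
  rw [← e1]; ring

open Filter Topology in
theorem tendsto_pairing {G : (Fin s → ℝ) → ℝ} (hG : IntegrableOn G (cube s))
    {φ : ℕ → Fin s → ℝ → ℂ} {ψ : Fin s → ℝ → ℂ} {C : Fin s → ℝ}
    (hm : ∀ n i, Measurable (φ n i)) (hC : ∀ n i x, ‖φ n i x‖ ≤ C i)
    (hlim : ∀ i, ∀ᵐ x ∂volume.restrict (Set.Icc (0 : ℝ) 1),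
      Tendsto (fun n => φ n i x) atTop (𝓝 (ψ i x))) :
    Tendsto (fun n => pairing G (φ n)) atTop (𝓝 (pairing G ψ)) := by
  refine tendsto_integral_of_dominated_convergence (fun x => ‖G x‖ * ∏ i, C i) (fun n => ?_) ?_
    (fun n => ?_) ?_
  · exact hG.ofReal.aestronglyMeasurable.mul (measurable_prod_apply (hm n)).aestronglyMeasurable
  · exact hG.norm.mul_const _
  · filter_upwards [ae_restrict_mem (measurableSet_cube s)] with x hx
    rw [norm_mul, Complex.norm_real]
    exact mul_le_mul_of_nonneg_left (norm_prod_apply_le (fun i x _ => hC n i x) hx) (norm_nonneg _)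
  · rw [restrict_cube]
    have : ∀ᵐ x ∂(Measure.pi fun _ : Fin s => volume.restrict (Set.Icc (0 : ℝ) 1)),
        ∀ i, Tendsto (fun n => φ n i (x i)) atTop (𝓝 (ψ i (x i))) :=
      eventually_all.2 fun i => (Measure.tendsto_eval_ae_ae
        (μ := fun _ : Fin s => volume.restrict (Set.Icc (0 : ℝ) 1))).eventually (hlim i)
    filter_upwards [this] with x hx
    exact (tendsto_finsetProd _ fun i _ => hx i).const_mul _

open Filter Topology in
/-- Partial integration of weak derivatives against products of bounded measurable functions. -/
theorem IsWeakDeriv.pairing_parts {ν : Fin s → ℕ} {F G G' : (Fin s → ℝ) → ℝ} {j : Fin s}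
    (h : IsWeakDeriv ν F G) (h' : IsWeakDeriv (Function.update ν j (ν j + 1)) F G')
    (hF : IntegrableOn F (cube s)) {ψ : Fin s → ℝ → ℂ} (hψ : ∀ i, BoundedOnUnit (ψ i))
    {g : ℝ → ℂ} (hg : ∀ x ∈ Set.Icc (0 : ℝ) 1, ∫ y in (0 : ℝ)..x, ψ j y = g x) (hg1 : g 1 = 0) :
    pairing G ψ = -pairing G' (Function.update ψ j g) := by
  choose φ C hφ hC hlim using fun i => exists_test_tendsto (hψ i)
  obtain ⟨p, D, hp, hD, hD', hpl, hpl'⟩ := exists_test_tendsto_deriv (hψ j) hg hg1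
  let q : ℕ → Fin s → ℝ → ℂ := fun n => Function.update (fun i => φ i n) j (p n)
  have hq : ∀ n i, IsUnitTest (q n i) := fun n => isUnitTest_update (fun i => hφ i n) j (hp n)
  have hqj : ∀ n, q n j = p n := fun n => Function.update_self ..
  have hqi : ∀ n i, i ≠ j → q n i = φ i n := fun n i hi => Function.update_of_ne hi ..
  have t1 : Tendsto (fun n => pairing G (Function.update (q n) j (deriv (q n j)))) atTop
      (𝓝 (pairing G ψ)) := by
    refine tendsto_pairing h.integrableOn (C := Function.update C j D)
      (fun n i => (isUnitTest_update (hq n) j (hq n j).deriv i).continuous.measurable) ?_ ?_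
    · intro n i x
      by_cases hi : i = j
      · subst hi; simpa [hqj] using hD' n x
      · simpa [hi, hqi] using hC i n x
    · intro i
      by_cases hi : i = j
      · subst hi; simpa [hqj] using hpl'
      · simpa [hi, hqi] using hlim i
  have t2 : Tendsto (fun n => pairing G' (q n)) atTop
      (𝓝 (pairing G' (Function.update ψ j g))) := by
    refine tendsto_pairing h'.integrableOn (C := Function.update C j D)
      (fun n i => (hq n i).continuous.measurable) ?_ ?_
    · intro n i x
      by_cases hi : i = j
      · subst hi; simpa [hqj] using hD n x
      · simpa [hi, hqi] using hC i n x
    · intro i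
      by_cases hi : i = j
      · subst hi; simpa [hqj] using hpl
      · simpa [hi, hqi] using hlim i
  refine tendsto_nhds_unique t1 (t2.neg.congr fun n => ?_)
  exact (h.pairing_test h' hF (hq n)).symm

end

section
/-! ### Decay of Walsh coefficients in several variables -/

variable {s : ℕ}

theorem le_lpSum {ι : Type*} {p : ℝ≥0∞} (hp : p ≠ 0) {S : Finset ι} (a : ι → ℝ≥0∞) {i : ι}
    (hi : i ∈ S) : a i ≤ lpSum p S a := by
  rw [lpSum]
  split_ifs with h
  · exact Finset.le_sup hi
  · have hpos : 0 < p.toReal := ENNReal.toReal_pos hp h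
    have h1 : a i ^ p.toReal ≤ ∑ i ∈ S, a i ^ p.toReal :=
      Finset.single_le_sum (f := fun i => a i ^ p.toReal) (fun _ _ => zero_le) hi
    have h2 := ENNReal.rpow_le_rpow h1 (by positivity : 0 ≤ 1 / p.toReal)
    rwa [← ENNReal.rpow_mul, mul_one_div, div_self hpos.ne', ENNReal.rpow_one] at h2

theorem measurePreserving_piecewise (v : Finset (Fin s)) :
    MeasurePreserving (fun p : (Fin s → ℝ) × (Fin s → ℝ) => v.piecewise p.1 p.2)
      ((volume.restrict (cube s)).prod (volume.restrict (cube s))) (volume.restrict (cube s)) := by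
  have hm : Measurable fun p : (Fin s → ℝ) × (Fin s → ℝ) => v.piecewise p.1 p.2 := by
    refine measurable_pi_lambda _ fun i => ?_
    by_cases hi : i ∈ v
    · simp only [hi, Finset.piecewise_eq_of_mem]; fun_prop
    · simp only [hi, not_false_eq_true, Finset.piecewise_eq_of_notMem]; fun_prop
  refine ⟨hm, ?_⟩
  rw [restrict_cube]
  refine (Measure.pi_eq fun t ht => ?_).symm
  rw [Measure.map_apply hm (MeasurableSet.univ_pi ht)]
  have : (fun p : (Fin s → ℝ) × (Fin s → ℝ) => v.piecewise p.1 p.2) ⁻¹' Set.univ.pi t =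
      (Set.univ.pi fun i => if i ∈ v then t i else Set.univ) ×ˢ
        (Set.univ.pi fun i => if i ∈ v then Set.univ else t i) := by
    ext p
    simp only [Set.mem_preimage, Set.mem_pi, Set.mem_univ, true_imp_iff, Set.mem_prod,
      ← forall_and]
    refine forall_congr' fun i => ?_
    by_cases hi : i ∈ v <;> simp [hi]
  rw [this, Measure.prod_prod, Measure.pi_pi, Measure.pi_pi, ← Finset.prod_mul_distrib]
  refine Finset.prod_congr rfl fun i _ => ?_
  by_cases hi : i ∈ v <;> simp [hi]

/-- The product depends on the coordinates in `v` only, so the other ones can be integrated out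
first, as in the Sobolev norm. On a probability space the `L¹` norm of the result is at most its
`L^q` norm. -/
theorem norm_pairing_le {G : (Fin s → ℝ) → ℝ} (hG : IntegrableOn G (cube s)) (v : Finset (Fin s))
    {ψ : Fin s → ℝ → ℂ} {C : Fin s → ℝ} (h1 : ∀ i ∉ v, ψ i = fun _ => 1)
    (hm : ∀ i ∈ v, Measurable (ψ i)) (hC : ∀ i ∈ v, ∀ x ∈ Set.Icc (0 : ℝ) 1, ‖ψ i x‖ ≤ C i)
    {q : ℝ≥0∞} (hq : 1 ≤ q) {B : ℝ≥0∞} (hB : B ≠ ∞)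
    (hle : eLpNorm (fun y => ∫ z in cube s, G (v.piecewise y z)) q (volume.restrict (cube s)) ≤ B) :
    ‖pairing G ψ‖ ≤ (∏ i ∈ v, C i) * B.toReal := by
  have hm' : ∀ i, Measurable (ψ i) := fun i => by
    by_cases hi : i ∈ v
    · exact hm i hi
    · rw [h1 i hi]; exact measurable_const
  have hb' : ∀ i, BoundedOnUnit (ψ i) := fun i => by
    by_cases hi : i ∈ v
    · exact ⟨hm i hi, C i, hC i hi⟩
    · rw [h1 i hi]; exact ⟨measurable_const, 1, by simp⟩
  have mp := measurePreserving_piecewise v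
  set H : (Fin s → ℝ) → ℝ := fun y => ∫ z in cube s, G (v.piecewise y z) with hH
  have hGp : Integrable (fun p : (Fin s → ℝ) × (Fin s → ℝ) => G (v.piecewise p.1 p.2))
      ((volume.restrict (cube s)).prod (volume.restrict (cube s))) :=
    mp.integrable_comp_of_integrable hG
  have hHi : Integrable H (volume.restrict (cube s)) := hGp.integral_prod_left
  have hprod : ∀ y z : Fin s → ℝ, ∏ i, ψ i (v.piecewise y z i) = ∏ i, ψ i (y i) := fun y z =>
    Finset.prod_congr rfl fun i _ => by
      by_cases hi : i ∈ v
      · simp [hi]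
      · simp [hi, h1 i hi]
  have e1 : pairing G ψ = ∫ y in cube s, (H y : ℂ) * ∏ i, ψ i (y i) := by
    have hi := integrableOn_pairing hG hb'
    have hi' : Integrable (fun p : (Fin s → ℝ) × (Fin s → ℝ) =>
        (G (v.piecewise p.1 p.2) : ℂ) * ∏ i, ψ i (v.piecewise p.1 p.2 i))
        ((volume.restrict (cube s)).prod (volume.restrict (cube s))) :=
      mp.integrable_comp_of_integrable hi
    have e0 : pairing G ψ = ∫ p : (Fin s → ℝ) × (Fin s → ℝ),
        (G (v.piecewise p.1 p.2) : ℂ) * ∏ i, ψ i (v.piecewise p.1 p.2 i)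
        ∂(volume.restrict (cube s)).prod (volume.restrict (cube s)) := by
      rw [pairing]
      conv_lhs => rw [← mp.map_eq]
      exact integral_map mp.measurable.aemeasurable
        (by rw [mp.map_eq]; exact hi.aestronglyMeasurable)
    rw [e0, integral_prod _ hi']
    refine integral_congr_ae (Filter.Eventually.of_forall fun y => ?_)
    simp only [hprod]
    rw [integral_mul_const]
    congr 1
    exact integral_ofReal
  have hC' : ∀ y ∈ cube s, ‖∏ i, ψ i (y i)‖ ≤ ∏ i ∈ v, C i := by
    intro y hy
    have e : ∏ i, ψ i (y i) = ∏ i ∈ v, ψ i (y i) :=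
      (Finset.prod_subset (Finset.subset_univ v) fun i _ hi => by rw [h1 i hi]).symm
    rw [e, norm_prod]
    rw [cube_eq_pi] at hy
    exact Finset.prod_le_prod (fun i _ => norm_nonneg _) fun i hi => hC i hi _ (hy i (Set.mem_univ i))
  have hC0 : 0 ≤ ∏ i ∈ v, C i := (norm_nonneg _).trans (hC' 0 (by simp [cube]))
  calc ‖pairing G ψ‖ ≤ ∫ y in cube s, ‖H y‖ * ∏ i ∈ v, C i := by
        rw [e1]
        refine norm_integral_le_of_norm_le (hHi.norm.mul_const _) ?_
        filter_upwards [ae_restrict_mem (measurableSet_cube s)] with y hy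
        rw [norm_mul, Complex.norm_real]
        exact mul_le_mul_of_nonneg_left (hC' y hy) (norm_nonneg _)
    _ = (∏ i ∈ v, C i) * (eLpNorm H 1 (volume.restrict (cube s))).toReal := by
        rw [integral_mul_const, mul_comm, eLpNorm_one_eq_lintegral_enorm,
          integral_norm_eq_lintegral_enorm hHi.aestronglyMeasurable]
    _ ≤ _ := by
        refine mul_le_mul_of_nonneg_left (ENNReal.toReal_mono hB ?_) hC0
        exact (eLpNorm_le_eLpNorm_of_exponent_le hq hHi.aestronglyMeasurable).trans hle

theorem isWeakDeriv_zero {F : (Fin s → ℝ) → ℝ} (hF : IntegrableOn F (cube s)) :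
    IsWeakDeriv 0 F F where
  integrableOn := hF
  integral_eq φ _ _ _ := by
    have : mixedPartial 0 φ = φ := by
      rw [mixedPartial]
      induction List.finRange s with
      | nil => rfl
      | cons a l _ => simp
    simp [this]

theorem isWeakDeriv_weakDeriv {ν : Fin s → ℕ} {F : (Fin s → ℝ) → ℝ}
    (h : ∃ G, IsWeakDeriv ν F G) : IsWeakDeriv ν F (weakDeriv ν F) := by
  rw [weakDeriv, dif_pos h]; exact h.choose_spec

theorem pairing_update_add {G : (Fin s → ℝ) → ℝ} (hG : IntegrableOn G (cube s))
    {ψ : Fin s → ℝ → ℂ} (hψ : ∀ i, BoundedOnUnit (ψ i)) (a : Fin s) (c : ℂ) {g : ℝ → ℂ}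
    (hg : BoundedOnUnit g) :
    pairing G (Function.update ψ a fun x => c + g x) =
      c * pairing G (Function.update ψ a fun _ => 1) + pairing G (Function.update ψ a g) := by
  have hu : ∀ g : ℝ → ℂ, BoundedOnUnit g → ∀ i, BoundedOnUnit (Function.update ψ a g i) := by
    intro g hg i
    by_cases hi : i = a
    · subst hi; simpa using hg
    · simpa [hi] using hψ i
  have i1 := integrableOn_pairing hG (hu _ ⟨measurable_const, 1, by simp⟩ : ∀ i, BoundedOnUnit
    (Function.update ψ a (fun _ => (1 : ℂ)) i))
  have i2 := integrableOn_pairing hG (hu g hg)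
  rw [pairing, pairing, pairing, ← integral_const_mul, ← integral_add (i1.const_mul c) i2]
  refine integral_congr_ae (Filter.Eventually.of_forall fun x => ?_)
  simp only [prod_update_eq]
  ring

section
variable {b : ℕ} [Fact b.Prime]

/-- Induction over the set `R` of coordinates that still carry a Walsh function and no derivative.
Processing a coordinate moves it either to `v` (all `α` derivatives used, an arbitrary bounded
kernel remains) or to the rest of `u` (fewer derivatives or all of them, paired with the constant
1). With `R` empty, the orders are those of `mixedOrders α u v`, where `hbase` applies. -/
theorem norm_pairing_wal_le {α : ℕ} (hα : 1 ≤ α) {E : ℝ}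
    (hE : ∀ i, 1 ≤ i → i ≤ α → ((2 * Real.sin (Real.pi / b))⁻¹) ^ i ≤ E)
    {F : (Fin s → ℝ) → ℝ} (hF : IntegrableOn F (cube s))
    {G : (Fin s → ℕ) → (Fin s → ℝ) → ℝ}
    (hG : ∀ ν : Fin s → ℕ, (∀ j, ν j ≤ α) → IsWeakDeriv ν F (G ν))
    {u : Finset (Fin s)} {B : ℝ}
    (hbase : ∀ v ⊆ u, ∀ ν ∈ mixedOrders α u v, ∀ (ψ : Fin s → ℝ → ℂ) (C : Fin s → ℝ),
      (∀ i ∉ v, ψ i = fun _ => 1) → (∀ i ∈ v, Measurable (ψ i)) →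
      (∀ i ∈ v, ∀ x ∈ Set.Icc (0 : ℝ) 1, ‖ψ i x‖ ≤ C i) →
      ‖pairing (G ν) ψ‖ ≤ (∏ i ∈ v, C i) * B)
    {N : ℕ} {κ : Fin s → ℕ → ZMod b} (hκ : ∀ j ∈ u, ∃ i < N, κ j i ≠ 0) (R : Finset (Fin s)) :
    ∀ (v : Finset (Fin s)) (ν : Fin s → ℕ) (ψ : Fin s → ℝ → ℂ) (C : Fin s → ℝ),
      R ⊆ u → v ⊆ u → Disjoint R v → (∀ j ∈ v, ν j = α) →
      (∀ j ∈ u, j ∉ v → j ∉ R → 1 ≤ ν j ∧ ν j ≤ α) → (∀ j ∈ R, ν j = 0) → (∀ j ∉ u, ν j = 0) →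
      (∀ j ∉ v, j ∉ R → ψ j = fun _ => 1) → (∀ j ∈ R, ψ j = wal N (κ j)) →
      (∀ j ∈ v, Measurable (ψ j)) → (∀ j ∈ v, ∀ x ∈ Set.Icc (0 : ℝ) 1, ‖ψ j x‖ ≤ C j) →
      ‖pairing (G ν) ψ‖ ≤ (∏ j ∈ R, 3 * E * ((b : ℝ) ^ topDigitSum (κ j) N α)⁻¹) *
        ((∏ j ∈ v, C j) * B) := by
  induction R using Finset.induction with
  | empty =>
    intro v ν ψ C _ hv _ hvα hu _ hu0 h1 _ hm hC
    rw [Finset.prod_empty, one_mul]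
    refine hbase v hv ν ?_ ψ C (fun i hi => h1 i hi (by simp)) hm hC
    rw [mixedOrders, Fintype.mem_piFinset]
    intro j
    by_cases hj : j ∈ v
    · simpa [hj] using hvα j hj
    · by_cases hju : j ∈ u
      · simpa [hj, hju] using hu j hju hj (by simp)
      · simpa [hj, hju] using hu0 j hju
  | insert a R ha ih =>
    intro v ν ψ C hR hv hd hvα hu hR0 hu0 h1 hw hm hC
    rw [Finset.insert_subset_iff] at hR
    rw [Finset.disjoint_insert_left] at hd
    have hψ : ∀ i, BoundedOnUnit (ψ i) := fun i => by
      by_cases hi : i ∈ v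
      · exact ⟨hm i hi, C i, hC i hi⟩
      by_cases hiR : i ∈ insert a R
      · rw [hw i hiR]; exact ⟨measurable_wal _ _, 1, fun x _ => (norm_wal _ _ _).le⟩
      · rw [h1 i hi hiR]; exact ⟨measurable_const, 1, by simp⟩
    have hνα : ∀ i, ν i ≤ α := fun i => by
      by_cases hi : i ∈ v
      · exact (hvα i hi).le
      by_cases hiR : i ∈ insert a R
      · rw [hR0 i hiR]; omega
      by_cases hiu : i ∈ u
      · exact (hu i hiu hi hiR).2
      · rw [hu0 i hiu]; omega
    have hνu : ∀ k ≤ α, ∀ i, Function.update ν a k i ≤ α := fun k hk i => by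
      by_cases hi : i = a
      · subst hi; simpa using hk
      · simpa [hi] using hνα i
    have hψu : ∀ g, BoundedOnUnit g → ∀ i, BoundedOnUnit (Function.update ψ a g i) :=
      fun g hg i => by
        by_cases hi : i = a
        · subst hi; simpa using hg
        · simpa [hi] using hψ i
    have haR : ∀ i ∈ R, i ≠ a := fun i hi h => ha (h ▸ hi)
    have hav : ∀ i ∈ v, i ≠ a := fun i hi h => hd.1 (h ▸ hi)
    have hau : ∀ i ∉ u, i ≠ a := fun i hi h => hi (h ▸ hR.1)
    -- Freeze all coordinates except `a`: order and test function in direction `a` become the two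
    -- variables of a one-dimensional derivative family, whose bounds come from the induction
    -- hypothesis.
    let A : ℕ → (ℝ → ℂ) → ℂ := fun k g =>
      pairing (G (Function.update ν a k)) (Function.update ψ a g)
    have hA : IsDerivFamily α A
        ((∏ j ∈ R, 3 * E * ((b : ℝ) ^ topDigitSum (κ j) N α)⁻¹) * ((∏ j ∈ v, C j) * B)) := by
      constructor
      · intro k hk c g hg
        exact pairing_update_add (hG _ (hνu k hk)).integrableOn hψ a c hg
      · intro k hk g h hg _ hgh h1
        have e : Function.update (Function.update ν a k) a (Function.update ν a k a + 1) =
            Function.update ν a (k + 1) := by simp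
        have hw' := hG _ (hνu (k + 1) hk)
        rw [← e] at hw'
        have := (hG _ (hνu k hk.le)).pairing_parts hw' hF (hψu g hg) (g := h) (by simpa using hgh) h1
        rw [e, Function.update_idem] at this
        exact this
      -- Against the constant 1, coordinate `a` leaves `R` with order `k` and does not enter `v`.
      · intro k hk1 hk
        refine ih v _ _ C hR.2 hv hd.2 ?_ ?_ ?_ ?_ ?_ ?_ ?_ ?_
        · intro j hj; rw [Function.update_of_ne (hav j hj)]; exact hvα j hj
        · intro j hj hjv hjR
          by_cases hja : j = a
          · subst hja; simpa using ⟨hk1, hk⟩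
          · rw [Function.update_of_ne hja]; exact hu j hj hjv (by simp [hja, hjR])
        · intro j hj
          rw [Function.update_of_ne (haR j hj)]; exact hR0 j (Finset.mem_insert_of_mem hj)
        · intro j hj; rw [Function.update_of_ne (hau j hj)]; exact hu0 j hj
        · intro j hjv hjR
          by_cases hja : j = a
          · subst hja; simp
          · rw [Function.update_of_ne hja]; exact h1 j hjv (by simp [hja, hjR])
        · intro j hj
          rw [Function.update_of_ne (haR j hj)]; exact hw j (Finset.mem_insert_of_mem hj)
        · intro j hj; rw [Function.update_of_ne (hav j hj)]; exact hm j hj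
        · intro j hj; rw [Function.update_of_ne (hav j hj)]; exact hC j hj
      -- At order `α` with a bounded kernel, coordinate `a` enters `v`, with bound `D`.
      · intro K D hK hKD
        have hprod : ∏ j ∈ insert a v, Function.update C a D j = D * ∏ j ∈ v, C j := by
          rw [Finset.prod_insert hd.1, Function.update_self]
          congr 1
          exact Finset.prod_congr rfl fun j hj => Function.update_of_ne (hav j hj) _ _
        have := ih (insert a v) (Function.update ν a α) (Function.update ψ a K)
          (Function.update C a D) hR.2 (Finset.insert_subset hR.1 hv)
          (Finset.disjoint_insert_right.2 ⟨ha, hd.2⟩) ?_ ?_ ?_ ?_ ?_ ?_ ?_ ?_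
        · rw [hprod] at this
          refine this.trans (le_of_eq ?_)
          ring
        · intro j hj
          rcases Finset.mem_insert.1 hj with rfl | hj
          · simp
          · rw [Function.update_of_ne (hav j hj)]; exact hvα j hj
        · intro j hj hjv hjR
          rw [Finset.mem_insert, not_or] at hjv
          rw [Function.update_of_ne hjv.1]; exact hu j hj hjv.2 (by simp [hjv.1, hjR])
        · intro j hj
          rw [Function.update_of_ne (haR j hj)]; exact hR0 j (Finset.mem_insert_of_mem hj)
        · intro j hj; rw [Function.update_of_ne (hau j hj)]; exact hu0 j hj
        · intro j hjv hjR
          rw [Finset.mem_insert, not_or] at hjv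
          rw [Function.update_of_ne hjv.1]; exact h1 j hjv.2 (by simp [hjv.1, hjR])
        · intro j hj
          rw [Function.update_of_ne (haR j hj)]; exact hw j (Finset.mem_insert_of_mem hj)
        · intro j hj
          rcases Finset.mem_insert.1 hj with rfl | hj
          · simpa using hK
          · rw [Function.update_of_ne (hav j hj)]; exact hm j hj
        · intro j hj
          rcases Finset.mem_insert.1 hj with rfl | hj
          · simpa using hKD
          · rw [Function.update_of_ne (hav j hj), Function.update_of_ne (hav j hj)]; exact hC j hj
    have key := hA.norm_wal_le hα hE (hκ a hR.1)
    have e0 : A 0 (wal N (κ a)) = pairing (G ν) ψ := by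
      simp only [A]
      rw [← hR0 a (Finset.mem_insert_self _ _), ← hw a (Finset.mem_insert_self _ _),
        Function.update_eq_self, Function.update_eq_self]
    rw [e0] at key
    rw [Finset.prod_insert ha, mul_assoc]
    exact key

theorem MemSobolev.lpSum_le {α : ℕ} {γ : Finset (Fin s) → ℝ≥0} {q : ℝ≥0∞}
    {F : (Fin s → ℝ) → ℝ} (h : MemSobolev α γ q ∞ F) (u : Finset (Fin s)) :
    lpSum q (u.powerset.sigma fun v => mixedOrders α u v) (fun p =>
        eLpNorm (fun y => ∫ z in cube s, weakDeriv p.2 F (p.1.piecewise y z)) q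
          (volume.restrict (cube s))) ≤ γ u * sobolevENorm α γ q ∞ F := by
  have h1 := le_lpSum (p := ∞) (by simp) (S := (Finset.univ : Finset (Finset (Fin s))))
    (fun u => (γ u : ℝ≥0∞)⁻¹ *
      lpSum q (u.powerset.sigma fun v => mixedOrders α u v) fun p =>
        eLpNorm (fun y => ∫ z in cube s, weakDeriv p.2 F (p.1.piecewise y z)) q
          (volume.restrict (cube s))) (Finset.mem_univ u)
  have h2 : (γ u : ℝ≥0∞)⁻¹ *
      lpSum q (u.powerset.sigma fun v => mixedOrders α u v) (fun p =>
        eLpNorm (fun y => ∫ z in cube s, weakDeriv p.2 F (p.1.piecewise y z)) q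
          (volume.restrict (cube s))) ≤ sobolevENorm α γ q ∞ F := h1
  by_cases hγ : γ u = 0
  -- For `γ u = 0` the inverse is `∞`, so a finite norm forces the inner sum to vanish.
  · have h3 := h2.trans_lt h.norm_lt_top
    rw [hγ] at h3
    by_contra hne
    rw [not_le] at hne
    have := (zero_le).trans_lt hne
    rw [ENNReal.coe_zero, ENNReal.inv_zero, ENNReal.top_mul this.ne'] at h3
    exact lt_irrefl _ h3
  · rwa [ENNReal.inv_mul_le_iff (by simpa using hγ) (by simp)] at h2

/-- The Walsh coefficient whose digit functions are nonzero exactly in the coordinates in `u`. -/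
theorem MemSobolev.norm_walsh_le {α : ℕ} (hα : 1 ≤ α) {γ : Finset (Fin s) → ℝ≥0} {q : ℝ≥0∞}
    (hq : 1 ≤ q) {F : (Fin s → ℝ) → ℝ} (h : MemSobolev α γ q ∞ F) {E : ℝ}
    (hE : ∀ i, 1 ≤ i → i ≤ α → ((2 * Real.sin (Real.pi / b))⁻¹) ^ i ≤ E)
    {u : Finset (Fin s)} (hu : u.Nonempty)
    {N : ℕ} {κ : Fin s → ℕ → ZMod b} (hκ : ∀ j ∈ u, ∃ i < N, κ j i ≠ 0)
    (hκ0 : ∀ j ∉ u, ∀ i < N, κ j i = 0) :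
    ‖pairing F fun j => wal N (κ j)‖ ≤
      (∏ j ∈ u, 3 * E * ((b : ℝ) ^ topDigitSum (κ j) N α)⁻¹) *
        (γ u * (sobolevENorm α γ q ∞ F).toReal) := by
  have hF : IntegrableOn F (cube s) := h.continuousOn.integrableOn_compact isCompact_Icc
  classical
  -- At order zero `F` itself is taken, since the chosen `weakDeriv` agrees with it only up to null
  -- sets. The terms of the norm that are used have nonzero order because `u` is nonempty.
  let G : (Fin s → ℕ) → (Fin s → ℝ) → ℝ := fun ν => if ν = 0 then F else weakDeriv ν F
  have hG : ∀ ν : Fin s → ℕ, (∀ j, ν j ≤ α) → IsWeakDeriv ν F (G ν) := by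
    intro ν hν
    by_cases h0 : ν = 0
    · simp only [G, h0, if_true]; exact isWeakDeriv_zero hF
    · simp only [G, h0, if_false]; exact isWeakDeriv_weakDeriv (h.exists_weakDeriv ν hν)
  have hbase : ∀ v ⊆ u, ∀ ν ∈ mixedOrders α u v, ∀ (ψ : Fin s → ℝ → ℂ) (C : Fin s → ℝ),
      (∀ i ∉ v, ψ i = fun _ => 1) → (∀ i ∈ v, Measurable (ψ i)) →
      (∀ i ∈ v, ∀ x ∈ Set.Icc (0 : ℝ) 1, ‖ψ i x‖ ≤ C i) →
      ‖pairing (G ν) ψ‖ ≤ (∏ i ∈ v, C i) * (γ u * (sobolevENorm α γ q ∞ F).toReal) := by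
    intro v hv ν hν ψ C h1 hm hC
    have hν' := hν
    rw [mixedOrders, Fintype.mem_piFinset] at hν'
    have hle : ∀ j, ν j ≤ α := fun j => by
      have := hν' j
      split_ifs at this
      · simp_all
      · exact (Finset.mem_Icc.1 this).2
      · simp_all
    have hne : ν ≠ 0 := by
      rintro rfl
      obtain ⟨j, hj⟩ := hu
      have := hν' j
      simp only [Pi.zero_apply] at this
      split_ifs at this
      · simp at this; omega
      · simp at this
    have hi := hG ν hle
    simp only [G, hne, if_false] at hi ⊢
    have hB := (le_lpSum (zero_lt_one.trans_le hq).ne' (fun p : (_ : Finset (Fin s)) × (Fin s → ℕ) =>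
        eLpNorm (fun y => ∫ z in cube s, weakDeriv p.2 F (p.1.piecewise y z)) q
          (volume.restrict (cube s))) (i := ⟨v, ν⟩)
          (Finset.mem_sigma.2 ⟨Finset.mem_powerset.2 hv, hν⟩)).trans (h.lpSum_le u)
    have := norm_pairing_le hi.integrableOn v h1 hm hC hq
      (ENNReal.mul_ne_top ENNReal.coe_ne_top h.norm_lt_top.ne) hB
    rwa [ENNReal.toReal_mul, ENNReal.coe_toReal] at this
  have key := norm_pairing_wal_le hα hE hF hG hbase hκ u ∅ 0
    (fun j => wal N (κ j)) (fun _ => 1) subset_rfl (by simp) (by simp) (by simp)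
    (fun j hj _ hj' => absurd hj hj') (by simp) (by simp) (fun j _ hj => ?_) (fun _ _ => rfl)
    (by simp) (by simp)
  · simpa [G] using key
  · ext x
    exact wal_of_eq_zero (hκ0 j hj) x

end

end

section
/-! ### Walsh series on the cube -/

variable {s : ℕ} {b : ℕ} [Fact b.Prime] {α : ℕ} [NeZero α]

theorem pow_dvd_of_digits_eq_zero {b M n : ℕ} (h : ∀ a < M, n / b ^ a % b = 0) : b ^ M ∣ n := by
  induction M with
  | zero => simp
  | succ M ih =>
    obtain ⟨c, rfl⟩ := ih fun a ha => h a (by omega)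
    have := h M (by omega)
    rcases Nat.eq_zero_or_pos (b ^ M) with h0 | h0
    · simp [h0]
    · rw [Nat.mul_div_cancel_left _ h0] at this
      rw [pow_succ]
      exact Nat.mul_dvd_mul_left _ (Nat.dvd_of_mod_eq_zero this)

theorem natCast_mod_eq_zero {n : ℕ} : ((n % b : ℕ) : ZMod b) = 0 ↔ n % b = 0 := by
  rw [ZMod.natCast_eq_zero_iff, Nat.dvd_mod_iff dvd_rfl, Nat.dvd_iff_mod_eq_zero]

/-- The digits identify the numbers below `b ^ M` with all digit vectors, so a sum of products over
digits factors. -/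
theorem sum_prod_digits (M : ℕ) (f : Fin M → ZMod b → ℂ) :
    ∑ n ∈ Finset.range (b ^ M), ∏ a : Fin M, f a ((n / b ^ (a : ℕ) % b : ℕ) : ZMod b) =
      ∏ a, ∑ t, f a t := by
  have hb : 0 < b := (Fact.out : b.Prime).pos
  rw [Finset.sum_range, ← Equiv.sum_comp finFunctionFinEquiv]
  have hd : ∀ (g : Fin M → Fin b) (a : Fin M),
      ((finFunctionFinEquiv g : Fin (b ^ M)) : ℕ) / b ^ (a : ℕ) % b = g a := by
    intro g a
    have : finFunctionFinEquiv.symm (finFunctionFinEquiv g) a = g a := by simp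
    rw [← this]
    rfl
  simp only [hd]
  have hs : ∀ h : ZMod b → ℂ, ∑ t, h t = ∑ c : Fin b, h ((c : ℕ) : ZMod b) := by
    intro h
    symm
    refine Fintype.sum_bijective (fun c : Fin b => ((c : ℕ) : ZMod b)) ?_ _ _ (fun _ => rfl)
    rw [Fintype.bijective_iff_injective_and_card]
    refine ⟨fun c d hcd => ?_, by simp [ZMod.card]⟩
    have := congrArg ZMod.val hcd
    simp only [ZMod.val_natCast_of_lt c.2, ZMod.val_natCast_of_lt d.2] at this
    exact Fin.ext this
  simp only [hs]
  rw [Finset.prod_univ_sum, Fintype.piFinset_univ]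

/-- The base `b` digits of the numbers that are interlaced by `l`. -/
def interDigits (b : ℕ) {s α : ℕ} [NeZero α] (l : Fin (s * α) → ℕ) (j : Fin s) (n : ℕ) : ZMod b :=
  ((l (finProdFinEquiv (j, Fin.ofNat α n)) / b ^ (n / α) % b : ℕ) : ZMod b)

/-- The Walsh function on the cube whose indices interlace the first `M` digits of `l`. -/
noncomputable def walProd (b M : ℕ) [Fact b.Prime] (l : Fin (s * α) → ℕ) (x : Fin s → ℝ) : ℂ :=
  ∏ j, wal (M * α) (interDigits b l j) (x j)

/-- All vectors of numbers with at most `M` digits. -/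
def digitBox (b M d : ℕ) : Finset (Fin d → ℕ) := Fintype.piFinset fun _ => Finset.range (b ^ M)

theorem wal_interDigits (M : ℕ) (l : Fin (s * α) → ℕ) (j : Fin s) (x : ℝ) :
    wal (M * α) (interDigits b l j) x = ∏ i : Fin α, ∏ a : Fin M,
      ZMod.stdAddChar (((l (finProdFinEquiv (j, i)) / b ^ (a : ℕ) % b : ℕ) : ZMod b) *
        (⌊x * (b : ℝ) ^ ((i : ℕ) + α * a + 1)⌋ : ZMod b)) := by
  rw [wal_eq_prod, Finset.prod_range, ← Equiv.prod_comp finProdFinEquiv, Fintype.prod_prod_type,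
    Finset.prod_comm]
  refine Finset.prod_congr rfl fun i _ => Finset.prod_congr rfl fun a _ => ?_
  have hα : 0 < α := NeZero.pos α
  simp only [interDigits, finProdFinEquiv_apply_val]
  have h1 : ((i : ℕ) + α * a) / α = a := by
    rw [Nat.add_mul_div_left _ _ hα, Nat.div_eq_of_lt i.2, zero_add]
  have h2 : Fin.ofNat α ((i : ℕ) + α * a) = i := by
    ext; simp [Fin.ofNat, Nat.mod_eq_of_lt i.2]
  rw [h1, h2]

theorem walProd_eq (M : ℕ) (l : Fin (s * α) → ℕ) (x : Fin s → ℝ) :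
    walProd b M l x = ∏ p : Fin (s * α), ∏ a : Fin M,
      ZMod.stdAddChar (((l p / b ^ (a : ℕ) % b : ℕ) : ZMod b) *
        (⌊x (finProdFinEquiv.symm p).1 *
          (b : ℝ) ^ (((finProdFinEquiv.symm p).2 : ℕ) + α * a + 1)⌋ : ZMod b)) := by
  rw [walProd, ← Equiv.prod_comp finProdFinEquiv, Fintype.prod_prod_type]
  refine Finset.prod_congr rfl fun j _ => ?_
  rw [wal_interDigits]
  simp only [Equiv.symm_apply_apply]

theorem conj_stdAddChar (t : ZMod b) :
    (starRingEnd ℂ) (ZMod.stdAddChar t) = ZMod.stdAddChar (-t) := by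
  rw [AddChar.map_neg_eq_conj]

theorem norm_walProd (M : ℕ) (l : Fin (s * α) → ℕ) (x : Fin s → ℝ) : ‖walProd b M l x‖ = 1 := by
  rw [walProd, norm_prod]; exact Finset.prod_eq_one fun _ _ => norm_wal _ _ _

/-- The Dirichlet kernel of the Walsh system. -/
theorem sum_walProd_mul_conj (M : ℕ) (x y : Fin s → ℝ) :
    ∑ l ∈ digitBox b M (s * α), walProd b M l y * (starRingEnd ℂ) (walProd b M l x) =
      ∏ p : Fin (s * α), ∏ a : Fin M,
        if (⌊y (finProdFinEquiv.symm p).1 *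
              (b : ℝ) ^ (((finProdFinEquiv.symm p).2 : ℕ) + α * a + 1)⌋ : ZMod b) =
            (⌊x (finProdFinEquiv.symm p).1 *
              (b : ℝ) ^ (((finProdFinEquiv.symm p).2 : ℕ) + α * a + 1)⌋ : ZMod b)
          then (b : ℂ) else 0 := by
  classical
  have h1 : ∀ p : Fin (s * α), ∏ a : Fin M,
      (if (⌊y (finProdFinEquiv.symm p).1 *
              (b : ℝ) ^ (((finProdFinEquiv.symm p).2 : ℕ) + α * a + 1)⌋ : ZMod b) =
            (⌊x (finProdFinEquiv.symm p).1 *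
              (b : ℝ) ^ (((finProdFinEquiv.symm p).2 : ℕ) + α * a + 1)⌋ : ZMod b)
          then (b : ℂ) else 0) = ∑ n ∈ Finset.range (b ^ M), ∏ a : Fin M,
        ZMod.stdAddChar (((n / b ^ (a : ℕ) % b : ℕ) : ZMod b) *
          ((⌊y (finProdFinEquiv.symm p).1 *
              (b : ℝ) ^ (((finProdFinEquiv.symm p).2 : ℕ) + α * a + 1)⌋ : ZMod b) -
            (⌊x (finProdFinEquiv.symm p).1 *
              (b : ℝ) ^ (((finProdFinEquiv.symm p).2 : ℕ) + α * a + 1)⌋ : ZMod b))) := by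
    intro p
    rw [sum_prod_digits M fun a t => (ZMod.stdAddChar (t *
          ((⌊y (finProdFinEquiv.symm p).1 *
              (b : ℝ) ^ (((finProdFinEquiv.symm p).2 : ℕ) + α * a + 1)⌋ : ZMod b) -
            (⌊x (finProdFinEquiv.symm p).1 *
              (b : ℝ) ^ (((finProdFinEquiv.symm p).2 : ℕ) + α * a + 1)⌋ : ZMod b))) : ℂ)]
    refine Finset.prod_congr rfl fun a _ => ?_
    rw [AddChar.sum_mulShift _ (ZMod.isPrimitive_stdAddChar b), ZMod.card]
    simp only [sub_eq_zero]
    split_ifs <;> simp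
  simp only [h1]
  rw [Finset.prod_univ_sum]
  refine Finset.sum_congr rfl fun l _ => ?_
  rw [walProd_eq, walProd_eq, map_prod, ← Finset.prod_mul_distrib]
  refine Finset.prod_congr rfl fun p _ => ?_
  rw [map_prod, ← Finset.prod_mul_distrib]
  refine Finset.prod_congr rfl fun a _ => ?_
  rw [conj_stdAddChar, ← AddChar.map_add_eq_mul]
  congr 1
  ring

theorem floor_eq_of_digits_eq {x y : ℝ} (hx : x ∈ Set.Ico (0 : ℝ) 1) (hy : y ∈ Set.Ico (0 : ℝ) 1)
    {N : ℕ} (h : ∀ n < N, (⌊y * (b : ℝ) ^ (n + 1)⌋ : ZMod b) = (⌊x * (b : ℝ) ^ (n + 1)⌋ : ZMod b)) :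
    ⌊y * (b : ℝ) ^ N⌋ = ⌊x * (b : ℝ) ^ N⌋ := by
  induction N with
  | zero =>
    simp only [pow_zero, mul_one]
    rw [Int.floor_eq_zero_iff.2 hx, Int.floor_eq_zero_iff.2 hy]
  | succ N ih =>
    have h1 := ih fun n hn => h n (by omega)
    rw [← floor_mul_pow_div y, ← floor_mul_pow_div x] at h1
    have h2 := (ZMod.intCast_eq_intCast_iff' _ _ _).1 (h N (by omega))
    rw [← Int.mul_ediv_add_emod ⌊y * (b : ℝ) ^ (N + 1)⌋ b, h1, h2, Int.mul_ediv_add_emod]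

theorem abs_sub_le_of_floor_eq {x y : ℝ} {N : ℕ}
    (h : ⌊y * (b : ℝ) ^ N⌋ = ⌊x * (b : ℝ) ^ N⌋) : |y - x| ≤ ((b : ℝ) ^ N)⁻¹ := by
  have hb := b_pos b
  have h1 := Int.abs_sub_lt_one_of_floor_eq_floor h
  rw [← sub_mul, abs_mul, abs_of_pos (by positivity : (0 : ℝ) < (b : ℝ) ^ N)] at h1
  rw [← one_div, le_div_iff₀ (by positivity)]
  exact h1.le

/-- The half-open unit cube. -/
def halfOpenCube (s : ℕ) : Set (Fin s → ℝ) := Set.univ.pi fun _ => Set.Ico (0 : ℝ) 1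

/-- Every factor of the kernel is `b` or 0, so it is nonzero only if `x` and `y` share their first
`M * α` digits in each coordinate. -/
theorem dist_le_of_kernel_ne_zero {M : ℕ} {x y : Fin s → ℝ} (hx : x ∈ halfOpenCube s)
    (hy : y ∈ halfOpenCube s)
    (h : ∑ l ∈ digitBox b M (s * α), walProd b M l y * (starRingEnd ℂ) (walProd b M l x) ≠ 0) :
    dist y x ≤ ((b : ℝ) ^ (M * α))⁻¹ := by
  rw [sum_walProd_mul_conj, Finset.prod_ne_zero_iff] at h
  have hα : 0 < α := NeZero.pos α
  refine (dist_pi_le_iff (by positivity)).2 fun j => ?_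
  rw [Real.dist_eq]
  refine abs_sub_le_of_floor_eq (floor_eq_of_digits_eq (hx j trivial) (hy j trivial) fun n hn => ?_)
  have h1 := h (finProdFinEquiv (j, ⟨n % α, Nat.mod_lt _ hα⟩)) (Finset.mem_univ _)
  rw [Finset.prod_ne_zero_iff] at h1
  have h2 := h1 ⟨n / α, (Nat.div_lt_iff_lt_mul hα).2 hn⟩ (Finset.mem_univ _)
  simp only [Equiv.symm_apply_apply, Nat.mod_add_div] at h2
  by_contra hne
  exact h2 (if_neg hne)

theorem exists_interDigits_ne_zero {M : ℕ} {l : Fin (s * α) → ℕ} (hl : l ∈ digitBox b M (s * α))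
    {p : Fin (s * α)} (hp : l p ≠ 0) :
    ∃ n < M * α, interDigits b l (finProdFinEquiv.symm p).1 n ≠ 0 := by
  have hα : 0 < α := NeZero.pos α
  have hlt : l p < b ^ M := Finset.mem_range.1 (Fintype.mem_piFinset.1 hl p)
  by_contra! hn
  have : b ^ M ∣ l p := by
    refine pow_dvd_of_digits_eq_zero fun a ha => ?_
    set i := (finProdFinEquiv.symm p).2 with hi
    have h1 : ((i : ℕ) + α * a) / α = a := by
      rw [Nat.add_mul_div_left _ _ hα, Nat.div_eq_of_lt i.2, zero_add]
    have h2 : Fin.ofNat α ((i : ℕ) + α * a) = i := by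
      ext; simp [Fin.ofNat, Nat.mod_eq_of_lt i.2]
    have h3 := hn ((i : ℕ) + α * a) (by
      have := i.2
      calc (i : ℕ) + α * a < α + α * a := by omega
        _ = (a + 1) * α := by ring
        _ ≤ M * α := Nat.mul_le_mul_right _ (by omega))
    rw [interDigits, h1, h2, hi, Prod.mk.eta, Equiv.apply_symm_apply, natCast_mod_eq_zero] at h3
    exact h3
  exact hp (Nat.eq_zero_of_dvd_of_lt this hlt)

theorem walProd_zero (M : ℕ) (x : Fin s → ℝ) :
    walProd b M (0 : Fin (s * α) → ℕ) x = 1 := by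
  rw [walProd]
  exact Finset.prod_eq_one fun j _ => wal_of_eq_zero (fun i _ => by simp [interDigits]) _

theorem measurable_walProd (M : ℕ) (l : Fin (s * α) → ℕ) : Measurable (walProd (s := s) b M l) :=
  measurable_prod_apply fun _ => measurable_wal _ _

theorem integral_walProd {M : ℕ} {l : Fin (s * α) → ℕ} (hl : l ∈ digitBox b M (s * α)) :
    ∫ y in cube s, walProd b M l y = if l = 0 then 1 else 0 := by
  split_ifs with h
  · subst h; simp [walProd_zero]
  · obtain ⟨p, hp⟩ : ∃ p, l p ≠ 0 := by
      by_contra! hn; exact h (funext hn)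
    simp only [walProd, restrict_cube]
    rw [integral_fintype_prod_eq_prod
      (fun (j : Fin s) (t : ℝ) => wal (M * α) (interDigits b l j) t)]
    refine Finset.prod_eq_zero (Finset.mem_univ (finProdFinEquiv.symm p).1) ?_
    rw [integral_Icc_eq_integral_Ioc, ← intervalIntegral.integral_of_le zero_le_one]
    exact integral_wal (exists_interDigits_ne_zero hl hp)

theorem zero_mem_digitBox (M d : ℕ) : (0 : Fin d → ℕ) ∈ digitBox b M d := by
  rw [digitBox, Fintype.mem_piFinset]
  intro p
  have := (Fact.out : b.Prime).pos
  simpa using pow_pos this M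

theorem ae_mem_halfOpenCube : ∀ᵐ y ∂volume.restrict (cube s), y ∈ halfOpenCube s := by
  rw [restrict_cube]
  have : ∀ᵐ t ∂volume.restrict (Set.Icc (0 : ℝ) 1), t ∈ Set.Ico (0 : ℝ) 1 := by
    rw [← restrict_Ico_eq_restrict_Icc]; exact ae_restrict_mem measurableSet_Ico
  have h2 : ∀ᵐ y ∂(Measure.pi fun _ : Fin s => volume.restrict (Set.Icc (0 : ℝ) 1)),
      ∀ i, y i ∈ Set.Ico (0 : ℝ) 1 :=
    Filter.eventually_all.2 fun i => (Measure.tendsto_eval_ae_ae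
      (μ := fun _ : Fin s => volume.restrict (Set.Icc (0 : ℝ) 1))).eventually this
  filter_upwards [h2] with y hy i _
  exact hy i

theorem halfOpenCube_subset_cube : halfOpenCube s ⊆ cube s := by
  rw [cube_eq_pi]; exact Set.pi_mono fun i _ => Set.Ico_subset_Icc_self

/-- The partial sums of the Walsh series of a continuous function converge uniformly. -/
theorem walsh_partialSum_tendsto {F : (Fin s → ℝ) → ℝ} (hF : ContinuousOn F (cube s)) {ε : ℝ}
    (hε : 0 < ε) :
    ∃ M₀ : ℕ, ∀ M ≥ M₀, ∀ x ∈ halfOpenCube s,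
      ‖∑ l ∈ digitBox b M (s * α), pairing F (fun j => wal (M * α) (interDigits b l j)) *
        (starRingEnd ℂ) (walProd b M l x) - F x‖ ≤ ε := by
  have hb := one_lt_b b
  have hα : 0 < α := NeZero.pos α
  have hFi : IntegrableOn F (cube s) := hF.integrableOn_compact isCompact_Icc
  obtain ⟨δ, hδ, hu⟩ := Metric.uniformContinuousOn_iff_le.1
    (isCompact_Icc.uniformContinuousOn_of_continuous hF) ε hε
  obtain ⟨M₀, hM₀⟩ := exists_pow_lt_of_lt_one hδ (inv_lt_one_of_one_lt₀ hb)
  refine ⟨M₀, fun M hM x hx => ?_⟩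
  have hsmall : ((b : ℝ) ^ (M * α))⁻¹ ≤ δ := by
    refine le_trans ?_ hM₀.le
    rw [inv_pow]
    refine inv_anti₀ (by positivity) (pow_le_pow_right₀ hb.le ?_)
    nlinarith
  -- The partial sum at `x` is the integral of `F` against this kernel. The kernel is nonnegative,
  -- has integral 1 and vanishes unless `y` is within `b ^ (-M α)` of `x`, so uniform continuity of
  -- `F` suffices.
  set K : (Fin s → ℝ) → ℂ := fun y =>
    ∑ l ∈ digitBox b M (s * α), walProd b M l y * (starRingEnd ℂ) (walProd b M l x) with hK
  have iw : ∀ l : Fin (s * α) → ℕ, Integrable (walProd b M l) (volume.restrict (cube s)) := fun l =>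
    (integrable_const (1 : ℂ)).mono (measurable_walProd M l).aestronglyMeasurable
      (Filter.Eventually.of_forall fun y => by rw [norm_walProd]; simp)
  have iK : Integrable K (volume.restrict (cube s)) :=
    integrable_finsetSum _ fun l _ => (iw l).mul_const _
  have hKint : ∫ y in cube s, K y = 1 := by
    rw [hK, integral_finsetSum _ fun l _ => (iw l).mul_const _]
    simp_rw [integral_mul_const]
    rw [Finset.sum_eq_single_of_mem 0 (zero_mem_digitBox M _)]
    · rw [integral_walProd (zero_mem_digitBox M _), walProd_zero]; simp
    · intro l hl hne
      rw [integral_walProd hl, if_neg hne, zero_mul]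
  have hKnn : ∀ y, (‖K y‖ : ℂ) = K y := by
    intro y
    simp only [hK, sum_walProd_mul_conj, norm_prod]
    push_cast
    refine Finset.prod_congr rfl fun p _ => Finset.prod_congr rfl fun a _ => ?_
    split_ifs <;> simp
  have hKnorm : ∫ y in cube s, ‖K y‖ = 1 := by
    have h : ∫ y in cube s, ((‖K y‖ : ℝ) : ℂ) = 1 := by simp_rw [hKnn]; exact hKint
    rw [integral_complex_ofReal] at h
    exact_mod_cast h
  have iFw : ∀ l : Fin (s * α) → ℕ,
      Integrable (fun y => (F y : ℂ) * walProd b M l y) (volume.restrict (cube s)) := fun l =>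
    integrableOn_pairing hFi fun j => ⟨measurable_wal _ _, 1, fun t _ => (norm_wal _ _ _).le⟩
  have e1 : ∑ l ∈ digitBox b M (s * α), pairing F (fun j => wal (M * α) (interDigits b l j)) *
        (starRingEnd ℂ) (walProd b M l x) = ∫ y in cube s, (F y : ℂ) * K y := by
    have : ∀ y, (F y : ℂ) * K y = ∑ l ∈ digitBox b M (s * α),
        (F y : ℂ) * walProd b M l y * (starRingEnd ℂ) (walProd b M l x) := fun y => by
      rw [hK, Finset.mul_sum]
      exact Finset.sum_congr rfl fun l _ => by ring
    simp_rw [this]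
    rw [integral_finsetSum _ fun l _ => (iFw l).mul_const _]
    refine Finset.sum_congr rfl fun l _ => ?_
    rw [integral_mul_const]
    rfl
  have iFK : Integrable (fun y => (F y : ℂ) * K y) (volume.restrict (cube s)) := by
    have : (fun y => (F y : ℂ) * K y) = fun y => ∑ l ∈ digitBox b M (s * α),
        (F y : ℂ) * walProd b M l y * (starRingEnd ℂ) (walProd b M l x) := by
      ext y
      rw [hK, Finset.mul_sum]
      exact Finset.sum_congr rfl fun l _ => by ring
    rw [this]
    exact integrable_finsetSum _ fun l _ => (iFw l).mul_const _
  have e2 : (∫ y in cube s, (F y : ℂ) * K y) - F x =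
      ∫ y in cube s, ((F y : ℂ) * K y - (F x : ℂ) * K y) := by
    rw [integral_sub iFK (iK.const_mul _), integral_const_mul, hKint, mul_one]
  rw [e1, e2]
  calc ‖∫ y in cube s, ((F y : ℂ) * K y - (F x : ℂ) * K y)‖ ≤ ∫ y in cube s, ε * ‖K y‖ := by
        refine norm_integral_le_of_norm_le (iK.norm.const_mul ε) ?_
        filter_upwards [ae_mem_halfOpenCube] with y hy
        rw [← sub_mul, norm_mul]
        by_cases h0 : K y = 0
        · simp [h0]
        · have hd := dist_le_of_kernel_ne_zero hx hy h0
          have := hu y (halfOpenCube_subset_cube hy) x (halfOpenCube_subset_cube hx)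
            (hd.trans hsmall)
          rw [Real.dist_eq] at this
          rw [← Complex.ofReal_sub, Complex.norm_real]
          exact mul_le_mul_of_nonneg_right this (norm_nonneg _)
    _ = ε := by rw [integral_const_mul, hKnorm, mul_one]

end

section
/-! ### Digits of the points -/

variable {s : ℕ} {b : ℕ} [Fact b.Prime] {α : ℕ} [NeZero α]

theorem digitSum_mem_Ico (N : ℕ) :
    ∀ {c : ℕ → ℕ}, (∀ i, c i < b) →
      ∑ i ∈ Finset.range N, (c i : ℝ) / (b : ℝ) ^ (i + 1) ∈ Set.Ico (0 : ℝ) 1 := by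
  have hb := b_pos b
  induction N with
  | zero => intro c _; simp
  | succ N ih =>
    intro c hc
    have h := ih (c := fun i => c (i + 1)) fun i => hc _
    have e : ∑ i ∈ Finset.range (N + 1), (c i : ℝ) / (b : ℝ) ^ (i + 1) =
        (c 0 + ∑ i ∈ Finset.range N, (c (i + 1) : ℝ) / (b : ℝ) ^ (i + 1)) / b := by
      rw [Finset.sum_range_succ', add_div, Finset.sum_div, add_comm]
      congr 1
      · simp
      · refine Finset.sum_congr rfl fun i _ => ?_
        rw [pow_succ _ (i + 1), div_div]
    have h0 : (c 0 : ℝ) + 1 ≤ b := by exact_mod_cast hc 0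
    rw [e]
    constructor
    · have := h.1; positivity
    · rw [div_lt_one hb]; linarith [h.2]

/-- Scaling turns the earlier digits into multiples of `b`, and the tail beyond the `n`-th digit
stays in `[0, 1)`, so only `c n` survives modulo `b`. -/
theorem floor_digitSum (n : ℕ) :
    ∀ {N : ℕ} {c : ℕ → ℕ}, (∀ i, c i < b) → (∀ i ≥ N, c i = 0) →
      (⌊(∑ i ∈ Finset.range N, (c i : ℝ) / (b : ℝ) ^ (i + 1)) * (b : ℝ) ^ (n + 1)⌋ : ZMod b) =
        c n := by
  have hb := b_pos b
  induction n with
  | zero =>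
    intro N c hc hN
    cases N with
    | zero => simp [hN]
    | succ N =>
      have h := digitSum_mem_Ico N (c := fun i => c (i + 1)) fun i => hc _
      have e : (∑ i ∈ Finset.range (N + 1), (c i : ℝ) / (b : ℝ) ^ (i + 1)) * (b : ℝ) ^ (0 + 1) =
          (∑ i ∈ Finset.range N, (c (i + 1) : ℝ) / (b : ℝ) ^ (i + 1)) + (c 0 : ℕ) := by
        rw [Finset.sum_range_succ', add_mul, Finset.sum_mul]
        congr 1
        · refine Finset.sum_congr rfl fun i _ => ?_
          rw [pow_succ _ (i + 1)]; field_simp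
          simp
        · field_simp
      rw [e, Int.floor_add_natCast, Int.floor_eq_zero_iff.2 h]
      simp
  | succ n ih =>
    intro N c hc hN
    cases N with
    | zero => simp [hN]
    | succ N =>
      have e : (∑ i ∈ Finset.range (N + 1), (c i : ℝ) / (b : ℝ) ^ (i + 1)) *
          (b : ℝ) ^ (n + 1 + 1) =
          (∑ i ∈ Finset.range N, (c (i + 1) : ℝ) / (b : ℝ) ^ (i + 1)) * (b : ℝ) ^ (n + 1) +
            ((c 0 * b ^ (n + 1) : ℕ) : ℝ) := by
        rw [Finset.sum_range_succ', add_mul, Finset.sum_mul, Finset.sum_mul]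
        congr 1
        · refine Finset.sum_congr rfl fun i _ => ?_
          rw [pow_succ _ (i + 1), pow_succ _ (n + 1)]; field_simp
        · push_cast; rw [pow_succ _ (n + 1)]; field_simp
      rw [e, Int.floor_add_natCast, Int.cast_add,
        ih (N := N) (c := fun i => c (i + 1)) (fun i => hc _) (fun i hi => hN _ (by omega))]
      simp

theorem digit_lt (x : ℝ) (a : ℕ) : digit b x a < b := Nat.mod_lt _ (Fact.out : b.Prime).pos

theorem digit_cast {x : ℝ} (hx : 0 ≤ x) (a : ℕ) :
    (digit b x a : ZMod b) = (⌊x * (b : ℝ) ^ a⌋ : ZMod b) := by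
  have hb := b_pos b
  rw [digit, ZMod.natCast_mod, mul_comm, ← Int.natCast_floor_eq_floor (by positivity)]
  simp

theorem digit_digitSum {N : ℕ} {c : ℕ → ℕ} (hc : ∀ i, c i < b) (hN : ∀ i ≥ N, c i = 0) (n : ℕ) :
    digit b (∑ i ∈ Finset.range N, (c i : ℝ) / (b : ℝ) ^ (i + 1)) (n + 1) = c n := by
  have h := floor_digitSum n hc hN
  rw [← digit_cast (digitSum_mem_Ico N hc).1] at h
  have := congrArg ZMod.val h
  rwa [ZMod.val_natCast_of_lt (digit_lt _ _), ZMod.val_natCast_of_lt (hc n)] at this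

/-- The digits of `vmap b m L`, continued by zeros. -/
def vmapDigit (b m : ℕ) (L : LaurentSeries (ZMod b)) (a : ℕ) : ZMod b :=
  if a < m then L.coeff ((a + 1 : ℕ) : ℤ) else 0

theorem vmap_eq (m : ℕ) (L : LaurentSeries (ZMod b)) :
    vmap b m L = ∑ i ∈ Finset.range m, ((vmapDigit b m L i).val : ℝ) / (b : ℝ) ^ (i + 1) := by
  rw [vmap, ← Finset.Ico_add_one_right_eq_Icc, Finset.sum_Ico_eq_sum_range]
  refine Finset.sum_congr (by simp) fun i hi => ?_
  rw [add_comm 1 i, vmapDigit, if_pos (Finset.mem_range.1 hi)]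

theorem digit_vmap (m : ℕ) (L : LaurentSeries (ZMod b)) (a : ℕ) :
    digit b (vmap b m L) (a + 1) = (vmapDigit b m L a).val := by
  rw [vmap_eq]
  exact digit_digitSum (c := fun i => (vmapDigit b m L i).val) (fun i => ZMod.val_lt _)
    (fun i hi => by simp [vmapDigit, not_lt.2 hi]) a

/-- Each component has at most `m` nonzero digits, so the series is a finite sum; digit `n` of the
interlaced number is digit `n / α` of component `n % α`. -/
theorem interlace_vmap (m : ℕ) (L : Fin α → LaurentSeries (ZMod b)) :
    interlace b α (fun i => vmap b m (L i)) = ∑ n ∈ Finset.range (m * α),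
      ((vmapDigit b m (L (Fin.ofNat α n)) (n / α)).val : ℝ) / (b : ℝ) ^ (n + 1) := by
  have hα : 0 < α := NeZero.pos α
  rw [interlace]
  simp only [digit_vmap]
  rw [tsum_eq_sum (s := Finset.range m)]
  · rw [Finset.sum_range, Finset.sum_range, ← Equiv.sum_comp finProdFinEquiv,
      Fintype.sum_prod_type]
    refine Finset.sum_congr rfl fun a _ => Finset.sum_congr rfl fun i _ => ?_
    simp only [finProdFinEquiv_apply_val]
    have h1 : ((i : ℕ) + α * a) / α = a := by
      rw [Nat.add_mul_div_left _ _ hα, Nat.div_eq_of_lt i.2, zero_add]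
    have h2 : Fin.ofNat α ((i : ℕ) + α * a) = i := by
      ext; simp [Fin.ofNat, Nat.mod_eq_of_lt i.2]
    rw [h1, h2]
    congr 2
    ring
  · intro a ha
    rw [Finset.mem_range, not_lt] at ha
    simp [vmapDigit, not_lt.2 ha]

theorem interlace_vmap_mem_Ico (m : ℕ) (L : Fin α → LaurentSeries (ZMod b)) :
    interlace b α (fun i => vmap b m (L i)) ∈ Set.Ico (0 : ℝ) 1 := by
  rw [interlace_vmap]
  exact digitSum_mem_Ico _ (c := fun n => (vmapDigit b m (L (Fin.ofNat α n)) (n / α)).val)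
    fun i => ZMod.val_lt _

theorem floor_interlace_vmap (m : ℕ) (L : Fin α → LaurentSeries (ZMod b)) (i : Fin α) (a : ℕ) :
    (⌊interlace b α (fun i => vmap b m (L i)) * (b : ℝ) ^ ((i : ℕ) + α * a + 1)⌋ : ZMod b) =
      vmapDigit b m (L i) a := by
  have hα : 0 < α := NeZero.pos α
  rw [interlace_vmap, floor_digitSum ((i : ℕ) + α * a)
    (c := fun n => (vmapDigit b m (L (Fin.ofNat α n)) (n / α)).val) (fun i => ZMod.val_lt _)]
  · have h1 : ((i : ℕ) + α * a) / α = a := by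
      rw [Nat.add_mul_div_left _ _ hα, Nat.div_eq_of_lt i.2, zero_add]
    have h2 : Fin.ofNat α ((i : ℕ) + α * a) = i := by
      ext; simp [Fin.ofNat, Nat.mod_eq_of_lt i.2]
    simp only [h1, h2, ZMod.natCast_val, ZMod.cast_id', id_eq]
  · intro n hn
    have : m ≤ n / α := (Nat.le_div_iff_mul_le hα).2 hn
    simp [vmapDigit, not_lt.2 this]

/-! ### Laurent series -/

theorem toLaurentInv_eq (p : (ZMod b)[X]) :
    toLaurentInv b p = Polynomial.eval₂RingHom HahnSeries.C (HahnSeries.single (-1 : ℤ) 1) p := rfl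

theorem toLaurentInv_mul (p q : (ZMod b)[X]) :
    toLaurentInv b (p * q) = toLaurentInv b p * toLaurentInv b q := by
  simp only [toLaurentInv_eq, map_mul]

theorem toLaurentInv_add (p q : (ZMod b)[X]) :
    toLaurentInv b (p + q) = toLaurentInv b p + toLaurentInv b q := by
  simp only [toLaurentInv_eq, map_add]

theorem toLaurentInv_sum {ι : Type*} (t : Finset ι) (f : ι → (ZMod b)[X]) :
    toLaurentInv b (∑ i ∈ t, f i) = ∑ i ∈ t, toLaurentInv b (f i) := by
  simp only [toLaurentInv_eq, map_sum]

theorem toLaurentInv_C_mul_X_pow (c : ZMod b) (a : ℕ) :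
    toLaurentInv b (C c * X ^ a) = HahnSeries.single (-(a : ℤ)) c := by
  rw [toLaurentInv, eval₂_mul, eval₂_C, eval₂_pow, eval₂_X, HahnSeries.single_pow, one_pow,
    HahnSeries.C_apply, HahnSeries.single_mul_single]
  simp

theorem coeff_toLaurentInv (p : (ZMod b)[X]) (n : ℕ) :
    (toLaurentInv b p).coeff (-(n : ℤ)) = p.coeff n := by
  conv_lhs => rw [p.as_sum_range_C_mul_X_pow, toLaurentInv_sum]
  simp only [toLaurentInv_C_mul_X_pow]
  rw [HahnSeries.coeff_sum]
  simp only [HahnSeries.coeff_single, neg_inj, Nat.cast_inj]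
  rw [Finset.sum_ite_eq]
  split_ifs with h
  · rfl
  · rw [Finset.mem_range, not_lt] at h
    exact (coeff_eq_zero_of_natDegree_lt (by omega)).symm

theorem coeff_toLaurentInv_of_pos (p : (ZMod b)[X]) {n : ℤ} (hn : 0 < n) :
    (toLaurentInv b p).coeff n = 0 := by
  conv_lhs => rw [p.as_sum_range_C_mul_X_pow, toLaurentInv_sum]
  simp only [toLaurentInv_C_mul_X_pow]
  rw [HahnSeries.coeff_sum]
  refine Finset.sum_eq_zero fun i _ => ?_
  rw [HahnSeries.coeff_single, if_neg (by omega)]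

theorem coeff_toLaurentInv_of_lt (p : (ZMod b)[X]) {n : ℤ} (hn : n < -(p.natDegree : ℤ)) :
    (toLaurentInv b p).coeff n = 0 := by
  obtain ⟨k, rfl⟩ : ∃ k : ℕ, n = -(k : ℤ) := ⟨n.natAbs, by omega⟩
  rw [coeff_toLaurentInv]
  exact coeff_eq_zero_of_natDegree_lt (by omega)

theorem toLaurentInv_ne_zero {p : (ZMod b)[X]} (hp : p ≠ 0) : toLaurentInv b p ≠ 0 := by
  intro h
  have := coeff_toLaurentInv p p.natDegree
  rw [h] at this
  simp only [HahnSeries.coeff_zero, coeff_natDegree] at this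
  exact hp (leadingCoeff_eq_zero.1 this.symm)

theorem order_toLaurentInv {p : (ZMod b)[X]} (hp : p ≠ 0) :
    (toLaurentInv b p).order = -(p.natDegree : ℤ) := by
  refine le_antisymm (HahnSeries.order_le_of_coeff_ne_zero ?_) ?_
  · rw [coeff_toLaurentInv]; simpa using hp
  · by_contra h
    exact HahnSeries.coeff_order_eq_zero.not.2 (toLaurentInv_ne_zero hp)
      (coeff_toLaurentInv_of_lt p (not_le.1 h))

theorem coeff_X_pow_mul (a : ℕ) (c : ZMod b) (L : LaurentSeries (ZMod b)) (n : ℤ) :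
    (toLaurentInv b (C c * X ^ a) * L).coeff n = c * L.coeff (n + a) := by
  rw [toLaurentInv_C_mul_X_pow, HahnSeries.coeff_single_mul]
  simp

/-- The digitwise pairing of an index with a Laurent expansion is the residue of a product; this is
what makes the pairing symmetric in the index and the number of the point. -/
theorem coeff_one_truncPoly_mul (m k : ℕ) (L : LaurentSeries (ZMod b)) :
    (toLaurentInv b (truncPoly b m k) * L).coeff 1 =
      ∑ a ∈ Finset.range m, ((k / b ^ a % b : ℕ) : ZMod b) * L.coeff ((a + 1 : ℕ) : ℤ) := by
  rw [truncPoly, toLaurentInv_sum, Finset.sum_mul, HahnSeries.coeff_sum]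
  refine Finset.sum_congr rfl fun a _ => ?_
  rw [coeff_X_pow_mul]
  congr 2
  push_cast; ring

/-- If the remainder `R` of `Q` modulo `P` were nonzero, `R / P` would have order `deg P - deg R`,
which lies between 1 and `deg P`. Its leading coefficient would be one of those assumed to vanish,
as the polynomial quotient does not affect them. -/
theorem dvd_of_coeff_eq_zero {P Q : (ZMod b)[X]} (hP : P ≠ 0)
    (h : ∀ a < P.natDegree, (toLaurentInv b Q / toLaurentInv b P).coeff ((a + 1 : ℕ) : ℤ) = 0) :
    P ∣ Q := by
  by_contra hn
  have hR : Q % P ≠ 0 := fun h0 => hn ((EuclideanDomain.mod_eq_zero).1 h0)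
  have hP' := toLaurentInv_ne_zero hP
  set H := toLaurentInv b (Q % P) / toLaurentInv b P with hH
  have hdeg : (Q % P).natDegree < P.natDegree := natDegree_lt_natDegree hR (degree_mod_lt Q hP)
  have e : toLaurentInv b Q / toLaurentInv b P = toLaurentInv b (Q / P) + H := by
    conv_lhs => rw [← EuclideanDomain.div_add_mod Q P, toLaurentInv_add, toLaurentInv_mul]
    rw [hH]
    field_simp
  have hHP : toLaurentInv b (Q % P) = H * toLaurentInv b P := by rw [hH]; field_simp
  have hH0 : H ≠ 0 := div_ne_zero (toLaurentInv_ne_zero hR) hP'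
  have ho := order_toLaurentInv hR
  rw [hHP, HahnSeries.order_mul hH0 hP', order_toLaurentInv hP] at ho
  have h1 := h (P.natDegree - (Q % P).natDegree - 1) (by omega)
  have h2 : ((P.natDegree - (Q % P).natDegree - 1 + 1 : ℕ) : ℤ) = H.order := by omega
  rw [e, HahnSeries.coeff_add, coeff_toLaurentInv_of_pos _ (by omega), zero_add, h2] at h1
  exact HahnSeries.coeff_order_eq_zero.not.2 hH0 h1

/-! ### Character sums over the point set -/

theorem interlacedPoint_mem (m : ℕ) (P : (ZMod b)[X]) (g : Fin (s * α) → (ZMod b)[X]) (n : ℕ) :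
    interlacedPoint b m α P g n ∈ halfOpenCube s := fun _ _ => interlace_vmap_mem_Ico m _

/-- The exponent is the residue of `tr(n) * (∑ tr(l p) * g p) / P`. Computed as the pairing of the
digits of `l` with the point, it is the left side; expanded in the digits of `n` instead, it is the
right side. -/
theorem walProd_interlacedPoint {m M : ℕ} (hM : m ≤ M) (P : (ZMod b)[X])
    (g : Fin (s * α) → (ZMod b)[X]) (l : Fin (s * α) → ℕ) (n : ℕ) :
    walProd b M l (interlacedPoint b m α P g n) =
      ∏ a : Fin m, ZMod.stdAddChar (((n / b ^ (a : ℕ) % b : ℕ) : ZMod b) *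
        (toLaurentInv b (∑ p, truncPoly b m (l p) * g p) / toLaurentInv b P).coeff
          ((a + 1 : ℕ) : ℤ)) := by
  have map_sum' : ∀ {ι : Type} (t : Finset ι) (f : ι → ZMod b),
      (ZMod.stdAddChar (∑ i ∈ t, f i) : ℂ) = ∏ i ∈ t, ZMod.stdAddChar (f i) :=
    fun t f => by
      classical
      induction t using Finset.induction with
      | empty => simp
      | insert a t ha ih =>
        rw [Finset.sum_insert ha, Finset.prod_insert ha, AddChar.map_add_eq_mul, ih]
  set L : Fin (s * α) → LaurentSeries (ZMod b) := fun p =>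
    toLaurentInv b (truncPoly b m n) * toLaurentInv b (g p) / toLaurentInv b P with hL
  have h1 : ∀ (p : Fin (s * α)) (a : ℕ),
      (⌊interlacedPoint b m α P g n (finProdFinEquiv.symm p).1 *
          (b : ℝ) ^ (((finProdFinEquiv.symm p).2 : ℕ) + α * a + 1)⌋ : ZMod b) =
        vmapDigit b m (L p) a := by
    intro p a
    have := floor_interlace_vmap (α := α) m
      (fun i => L (finProdFinEquiv ((finProdFinEquiv.symm p).1, i))) (finProdFinEquiv.symm p).2 a
    rw [Prod.mk.eta, Equiv.apply_symm_apply] at this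
    exact this
  have h2 : ∀ p : Fin (s * α), ∏ a : Fin M,
      (ZMod.stdAddChar (((l p / b ^ (a : ℕ) % b : ℕ) : ZMod b) * vmapDigit b m (L p) a) : ℂ) =
        ZMod.stdAddChar ((toLaurentInv b (truncPoly b m (l p)) * L p).coeff 1) := by
    intro p
    rw [coeff_one_truncPoly_mul, map_sum', ← Finset.prod_range (fun a =>
      (ZMod.stdAddChar (((l p / b ^ (a : ℕ) % b : ℕ) : ZMod b) * vmapDigit b m (L p) a) : ℂ))]
    symm
    rw [Finset.prod_subset_one_on_sdiff (Finset.range_subset_range.2 hM)]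
    · intro a ha
      rw [Finset.mem_sdiff, Finset.mem_range, Finset.mem_range] at ha
      simp [vmapDigit, ha.2]
    · intro a ha
      rw [vmapDigit, if_pos (Finset.mem_range.1 ha)]
  rw [walProd_eq]
  simp only [h1, h2]
  have hf : ∀ f : ℕ → ZMod b, ∏ a : Fin m, (ZMod.stdAddChar (f a) : ℂ) =
      ZMod.stdAddChar (∑ a ∈ Finset.range m, f a) := fun f => by
    rw [map_sum', Finset.prod_range]
  rw [hf fun a => ((n / b ^ a % b : ℕ) : ZMod b) *
        (toLaurentInv b (∑ p, truncPoly b m (l p) * g p) / toLaurentInv b P).coeff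
          ((a + 1 : ℕ) : ℤ), ← coeff_one_truncPoly_mul, ← map_sum', ← HahnSeries.coeff_sum]
  congr 2
  rw [toLaurentInv_sum, mul_div_assoc', Finset.mul_sum, Finset.sum_div]
  refine Finset.sum_congr rfl fun p _ => ?_
  rw [hL, toLaurentInv_mul]
  ring

theorem sum_walProd_interlacedPoint {m M : ℕ} (hM : m ≤ M) {P : (ZMod b)[X]} (hP : P ≠ 0)
    (hPm : P.natDegree = m) (g : Fin (s * α) → (ZMod b)[X]) (l : Fin (s * α) → ℕ)
    [Decidable (P ∣ ∑ p, truncPoly b m (l p) * g p)] :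
    ∑ n ∈ Finset.range (b ^ m), walProd b M l (interlacedPoint b m α P g n) =
      if P ∣ ∑ p, truncPoly b m (l p) * g p then (b : ℂ) ^ m else 0 := by
  classical
  simp only [walProd_interlacedPoint hM]
  set Q := ∑ p, truncPoly b m (l p) * g p with hQ
  rw [sum_prod_digits m fun a t => (ZMod.stdAddChar (t *
    (toLaurentInv b Q / toLaurentInv b P).coeff (((a : ℕ) + 1 : ℕ) : ℤ)) : ℂ)]
  simp only [AddChar.sum_mulShift _ (ZMod.isPrimitive_stdAddChar b), ZMod.card]
  split_ifs with hd
  · obtain ⟨A, hA⟩ := hd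
    have : ∀ a : Fin m,
        (toLaurentInv b Q / toLaurentInv b P).coeff (((a : ℕ) + 1 : ℕ) : ℤ) = 0 := fun a => by
      rw [hQ, hA, toLaurentInv_mul, mul_div_cancel_left₀ _ (toLaurentInv_ne_zero hP)]
      exact coeff_toLaurentInv_of_pos _ (by omega)
    simp only [this, if_true]
    simp
  · have : ¬ ∀ a < P.natDegree,
        (toLaurentInv b Q / toLaurentInv b P).coeff ((a + 1 : ℕ) : ℤ) = 0 :=
      fun h => hd (dvd_of_coeff_eq_zero hP h)
    push Not at this
    obtain ⟨a, ha, h0⟩ := this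
    rw [hPm] at ha
    refine Finset.prod_eq_zero (Finset.mem_univ ⟨a, ha⟩) ?_
    rw [if_neg h0]; simp

end

section
/-! ### The worst-case error is bounded by the search criterion -/

variable {s : ℕ} {b : ℕ} [Fact b.Prime] {α : ℕ} [NeZero α]

/-- Depending on whether `m⁻¹` is below or above 1, the largest power occurs at exponent 1 or `α`,
and both are covered by the maximum in `constC`. The second factor of `constC` is at least 1 and the
third at least 3, which absorbs the 3 of the decay estimate. -/
theorem pow_le_constC (hα : 1 < α) {i : ℕ} (h1 : 1 ≤ i) (hi : i ≤ α) :
    ((2 * Real.sin (Real.pi / b))⁻¹) ^ i ≤ constC α b / 3 := by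
  have hb := one_lt_b b
  have hm : 0 < 2 * Real.sin (Real.pi / b) := by have := sin_pi_div_pos (b := b); positivity
  rw [constC]
  set m := 2 * Real.sin (Real.pi / b) with hmdef
  set S := ⨆ z : Finset.Icc 1 (α - 1), 1 / m ^ (z : ℕ) with hS
  have e1 : (m⁻¹) ^ α ≤ max (2 / m ^ α) S := by
    refine le_trans ?_ (le_max_left _ _)
    rw [inv_pow, ← one_div]
    gcongr
    norm_num
  have e2 : m⁻¹ ≤ max (2 / m ^ α) S := by
    refine le_trans ?_ (le_max_right _ _)
    have : 1 / m ^ ((⟨1, Finset.mem_Icc.2 ⟨le_rfl, by omega⟩⟩ : Finset.Icc 1 (α - 1)) : ℕ) ≤ S :=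
      le_ciSup (f := fun z : Finset.Icc 1 (α - 1) => 1 / m ^ (z : ℕ)) (Set.finite_range _).bddAbove _
    simpa using this
  have e3 : (m⁻¹) ^ i ≤ max (2 / m ^ α) S := by
    rcases le_total m⁻¹ 1 with h | h
    · exact le_trans (by simpa using pow_le_pow_of_le_one (by positivity) h h1) e2
    · exact (pow_le_pow_right₀ h hi).trans e1
  have h0 : 0 ≤ max (2 / m ^ α) S := (by positivity : (0 : ℝ) ≤ (m⁻¹) ^ i).trans e3
  have e4 : (1 : ℝ) ≤ (1 + 1 / (b : ℝ) + 1 / ((b : ℝ) * (b + 1))) ^ (α - 2) := by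
    apply one_le_pow₀
    have : 0 ≤ 1 / (b : ℝ) + 1 / ((b : ℝ) * (b + 1)) := by positivity
    linarith
  have e5 : (3 : ℝ) ≤ 3 + 2 / (b : ℝ) + (2 * b + 1) / ((b : ℝ) - 1) := by
    have : 0 ≤ 2 / (b : ℝ) + (2 * b + 1) / ((b : ℝ) - 1) := by
      have : 0 < (b : ℝ) - 1 := by linarith
      positivity
    linarith
  rw [le_div_iff₀ (by norm_num)]
  calc (m⁻¹) ^ i * 3 ≤ max (2 / m ^ α) S * 1 * 3 := by
        rw [mul_one]; exact mul_le_mul_of_nonneg_right e3 (by norm_num)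
    _ ≤ _ := by gcongr

theorem constC_pos (hα : 1 < α) : 0 < constC α b := by
  have hm : 0 < 2 * Real.sin (Real.pi / b) := by have := sin_pi_div_pos (b := b); positivity
  have := pow_le_constC (b := b) hα le_rfl hα.le
  have h2 : 0 < ((2 * Real.sin (Real.pi / b))⁻¹) ^ 1 := by positivity
  linarith

/-- `topDigitSum` selects the largest positions of nonzero digits greedily, so no other choice of at
most `n` such positions has a larger sum. -/
theorem sum_le_topDigitSum {κ : ℕ → ZMod b} (N : ℕ) :
    ∀ (n : ℕ) (T : Finset ℕ), T ⊆ Finset.range N → (∀ t ∈ T, κ t ≠ 0) → T.card ≤ n →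
      ∑ t ∈ T, (t + 1) ≤ topDigitSum κ N n := by
  induction N with
  | zero =>
    intro n T hT _ _
    rw [Finset.range_zero, Finset.subset_empty] at hT
    simp [hT]
  | succ N ih =>
    intro n T hT hκ hn
    have hsub : ∀ {T' : Finset ℕ}, T' ⊆ T → N ∉ T' → T' ⊆ Finset.range N := fun h hN t ht => by
      have := Finset.mem_range.1 (hT (h ht))
      have : t ≠ N := fun e => hN (e ▸ ht)
      rw [Finset.mem_range]; omega
    rw [topDigitSum]
    split_ifs with h
    · rcases h with h | h
      · exact ih n T (hsub subset_rfl fun hN => hκ N hN h) hκ hn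
      · subst h
        rw [Finset.card_eq_zero.1 (Nat.le_zero.1 hn)]; simp
    · rw [not_or] at h
      by_cases hN : N ∈ T
      · rw [← Finset.add_sum_erase T _ hN]
        refine Nat.add_le_add_left (ih _ _ (hsub (Finset.erase_subset _ _) (by simp))
          (fun t ht => hκ t (Finset.mem_of_mem_erase ht)) ?_) _
        rw [Finset.card_erase_of_mem hN]; omega
      -- The top position carries a nonzero digit that `T` misses; trading any element of `T` for it
      -- does not decrease the sum.
      · rcases T.eq_empty_or_nonempty with rfl | ⟨t, ht⟩
        · simp
        · rw [← Finset.add_sum_erase T _ ht]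
          have h1 := Finset.mem_range.1 (hT ht)
          have h2 := ih (n - 1) (T.erase t) (hsub (Finset.erase_subset _ _)
            fun h => hN (Finset.mem_of_mem_erase h))
            (fun t ht => hκ t (Finset.mem_of_mem_erase ht))
            (by rw [Finset.card_erase_of_mem ht]; omega)
          omega

theorem mu1_zero : mu1 b 0 = 0 := by simp [mu1]

theorem mu1_eq {k : ℕ} (hk : k ≠ 0) : mu1 b k = Nat.log b k + 1 :=
  Nat.length_digits b k (Fact.out : b.Prime).one_lt hk

theorem leading_digit_ne_zero {k : ℕ} (hk : k ≠ 0) :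
    ((k / b ^ (mu1 b k - 1) % b : ℕ) : ZMod b) ≠ 0 := by
  have hb := (Fact.out : b.Prime).one_lt
  rw [Ne, natCast_mod_eq_zero, mu1_eq hk, Nat.add_sub_cancel]
  have h1 := Nat.pow_log_le_self b hk
  have h2 := Nat.lt_pow_succ_log_self hb k
  have h3 : 1 ≤ k / b ^ Nat.log b k := (Nat.one_le_div_iff (by positivity)).2 h1
  have h4 : k / b ^ Nat.log b k < b := by
    rw [Nat.div_lt_iff_lt_mul (by positivity)]
    rwa [pow_succ, mul_comm] at h2
  rw [Nat.mod_eq_of_lt h4]; omega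

/-- The leading digit of component `i` lands at the interlaced position `α μ₁ - (α - 1 - i)`,
counted from one. These positions are distinct modulo `α`, so there are at most `α` of them and
`sum_le_topDigitSum` applies; the deficits `α - 1 - i` add up to at most `α (α - 1) / 2`. -/
theorem mul_sum_mu1_le {M : ℕ} {l : Fin (s * α) → ℕ} (hl : l ∈ digitBox b M (s * α)) (j : Fin s) :
    α * ∑ i : Fin α, mu1 b (l (finProdFinEquiv (j, i))) ≤
      topDigitSum (interDigits b l j) (M * α) α + α * (α - 1) / 2 := by
  have hα : 0 < α := NeZero.pos α
  have hb := (Fact.out : b.Prime).one_lt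
  set k : Fin α → ℕ := fun i => l (finProdFinEquiv (j, i)) with hk
  set I : Finset (Fin α) := Finset.univ.filter fun i => k i ≠ 0 with hI
  let pos : Fin α → ℕ := fun i => i + α * (mu1 b (k i) - 1)
  have hmod : ∀ i, pos i % α = i := fun i => by
    simp only [pos, Nat.add_mul_mod_self_left, Nat.mod_eq_of_lt i.2]
  have hdiv : ∀ i, pos i / α = mu1 b (k i) - 1 := fun i => by
    simp only [pos]
    rw [Nat.add_mul_div_left _ _ hα, Nat.div_eq_of_lt i.2, zero_add]
  have hinj : Set.InjOn pos I := fun i _ i' _ h => by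
    apply Fin.ext; rw [← hmod i, ← hmod i', h]
  have key := sum_le_topDigitSum (κ := interDigits b l j) (M * α) α (I.image pos) ?_ ?_ ?_
  · rw [Finset.sum_image hinj] at key
    have hg : ∑ i : Fin α, (α - 1 - (i : ℕ)) = α * (α - 1) / 2 := by
      rw [← Finset.sum_range (fun i => α - 1 - i), Finset.sum_range_reflect (fun i => i),
        Finset.sum_range_id]
    have h1 : α * ∑ i, mu1 b (k i) = ∑ i ∈ I, α * mu1 b (k i) := by
      rw [Finset.mul_sum]
      symm
      refine Finset.sum_subset (Finset.subset_univ _) fun i _ hi => ?_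
      have : k i = 0 := by simpa [hI] using hi
      rw [this, mu1_zero, mul_zero]
    have h2 : ∑ i ∈ I, α * mu1 b (k i) = ∑ i ∈ I, (pos i + 1) + ∑ i ∈ I, (α - 1 - (i : ℕ)) := by
      rw [← Finset.sum_add_distrib]
      refine Finset.sum_congr rfl fun i hi => ?_
      have : k i ≠ 0 := (Finset.mem_filter.1 hi).2
      simp only [pos]
      rw [mu1_eq this, Nat.add_sub_cancel]
      have := i.2
      rw [Nat.mul_add]
      omega
    have h3 : ∑ i ∈ I, (α - 1 - (i : ℕ)) ≤ α * (α - 1) / 2 := by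
      rw [← hg]; exact Finset.sum_le_sum_of_subset (Finset.subset_univ _)
    change α * ∑ i, mu1 b (k i) ≤ _
    rw [h1, h2]
    exact Nat.add_le_add key h3
  · intro t ht
    obtain ⟨i, hi, rfl⟩ := Finset.mem_image.1 ht
    have hne : k i ≠ 0 := (Finset.mem_filter.1 hi).2
    have hlt : k i < b ^ M := Finset.mem_range.1 (Fintype.mem_piFinset.1 hl _)
    rw [Finset.mem_range, ← Nat.div_lt_iff_lt_mul hα, hdiv, mu1_eq hne, Nat.add_sub_cancel]
    exact Nat.log_lt_of_lt_pow hne hlt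
  · intro t ht
    obtain ⟨i, hi, rfl⟩ := Finset.mem_image.1 ht
    have hne : k i ≠ 0 := (Finset.mem_filter.1 hi).2
    rw [interDigits, hdiv]
    have : Fin.ofNat α (pos i) = i := by ext; simp [Fin.ofNat, hmod]
    rw [this]
    exact leading_digit_ne_zero hne
  · exact Finset.card_image_le.trans ((Finset.card_le_univ _).trans (by simp))

/-- The support of a vector of indices. -/
def indexSupport {d : ℕ} (l : Fin d → ℕ) : Finset (Fin d) := Finset.univ.filter fun p => l p ≠ 0

theorem mem_blocks_support {l : Fin (s * α) → ℕ} {j : Fin s} :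
    j ∈ blocks (indexSupport l) ↔ ∃ i, l (finProdFinEquiv (j, i)) ≠ 0 := by
  simp only [blocks, indexSupport, Finset.mem_image, Finset.mem_filter, Finset.mem_univ, true_and]
  constructor
  · rintro ⟨p, hp, rfl⟩
    refine ⟨p.modNat, ?_⟩
    have : finProdFinEquiv (p.divNat, p.modNat) = p := finProdFinEquiv.apply_symm_apply p
    rwa [this]
  · rintro ⟨i, hi⟩
    refine ⟨_, hi, ?_⟩
    exact congrArg Prod.fst (finProdFinEquiv.symm_apply_apply (j, i))

theorem cbcWeight_nonneg (hα : 1 < α) (γ : Finset (Fin s) → ℝ≥0) (v : Finset (Fin (s * α))) :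
    0 ≤ cbcWeight b γ v := by
  have := constC_pos (b := b) hα
  rw [cbcWeight]; positivity

/-- Only the blocks that meet the support of `l` are active. Each contributes `constC` from the
decay and `b ^ (α (α - 1) / 2)` from interlacing, which together with `γ` is precisely `cbcWeight`.
-/
theorem MemSobolev.norm_walsh_le_weight (hα : 1 < α) {γ : Finset (Fin s) → ℝ≥0} {q : ℝ≥0∞}
    (hq : 1 ≤ q) {F : (Fin s → ℝ) → ℝ} (h : MemSobolev α γ q ∞ F) {M : ℕ} {l : Fin (s * α) → ℕ}
    (hl : l ∈ digitBox b M (s * α)) (hl0 : l ≠ 0) :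
    ‖pairing F fun j => wal (M * α) (interDigits b l j)‖ ≤
      cbcWeight b γ (indexSupport l) * ((b : ℝ) ^ (α * ∑ p, mu1 b (l p)))⁻¹ *
        (sobolevENorm α γ q ∞ F).toReal := by
  have hb := b_pos b
  have hC := constC_pos (b := b) hα
  set u := blocks (indexSupport l) with hu
  have hne : u.Nonempty := by
    obtain ⟨p, hp⟩ : ∃ p, l p ≠ 0 := by by_contra! hn; exact hl0 (funext hn)
    exact ⟨p.divNat, Finset.mem_image_of_mem _ (by simp [indexSupport, hp])⟩
  have key := h.norm_walsh_le hα.le hq (b := b) (E := constC α b / 3)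
    (fun i h1 hi => pow_le_constC hα h1 hi) hne (N := M * α) (κ := interDigits b l) ?_ ?_
  · refine key.trans ?_
    rw [← mul_assoc]
    refine mul_le_mul_of_nonneg_right ?_ ENNReal.toReal_nonneg
    have hterm : ∀ j ∈ u, 3 * (constC α b / 3) *
        ((b : ℝ) ^ topDigitSum (interDigits b l j) (M * α) α)⁻¹ ≤
        (constC α b * (b : ℝ) ^ (α * (α - 1) / 2)) *
          ((b : ℝ) ^ (α * ∑ i : Fin α, mu1 b (l (finProdFinEquiv (j, i)))))⁻¹ := by
      intro j _
      have h1 := mul_sum_mu1_le hl j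
      have h2 : (b : ℝ) ^ (α * ∑ i : Fin α, mu1 b (l (finProdFinEquiv (j, i)))) ≤
          (b : ℝ) ^ topDigitSum (interDigits b l j) (M * α) α * (b : ℝ) ^ (α * (α - 1) / 2) := by
        rw [← pow_add]; exact pow_le_pow_right₀ (one_lt_b b).le h1
      have h3 : ((b : ℝ) ^ topDigitSum (interDigits b l j) (M * α) α)⁻¹ ≤
          (b : ℝ) ^ (α * (α - 1) / 2) *
          ((b : ℝ) ^ (α * ∑ i : Fin α, mu1 b (l (finProdFinEquiv (j, i)))))⁻¹ := by
        rw [← div_eq_mul_inv, le_div_iff₀ (by positivity), inv_mul_le_iff₀ (by positivity)]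
        exact h2
      calc _ = constC α b * ((b : ℝ) ^ topDigitSum (interDigits b l j) (M * α) α)⁻¹ := by ring
        _ ≤ _ := mul_le_mul_of_nonneg_left h3 hC.le
        _ = _ := by ring
    have hsum : ∏ j ∈ u, ((b : ℝ) ^ (α * ∑ i : Fin α, mu1 b (l (finProdFinEquiv (j, i)))))⁻¹ =
        ((b : ℝ) ^ (α * ∑ p, mu1 b (l p)))⁻¹ := by
      rw [Finset.prod_inv_distrib, Finset.prod_pow_eq_pow_sum, ← Finset.mul_sum,
        ← Equiv.sum_comp finProdFinEquiv, Fintype.sum_prod_type]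
      congr 3
      refine Finset.sum_subset (Finset.subset_univ _) fun j _ hj => ?_
      refine Finset.sum_eq_zero fun i _ => ?_
      rw [mem_blocks_support] at hj
      push Not at hj
      rw [hj i, mu1_zero]
    calc (∏ j ∈ u, 3 * (constC α b / 3) *
          ((b : ℝ) ^ topDigitSum (interDigits b l j) (M * α) α)⁻¹) * (γ u : ℝ)
        ≤ (∏ j ∈ u, (constC α b * (b : ℝ) ^ (α * (α - 1) / 2)) *
          ((b : ℝ) ^ (α * ∑ i : Fin α, mu1 b (l (finProdFinEquiv (j, i)))))⁻¹) * (γ u : ℝ) := by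
          refine mul_le_mul_of_nonneg_right ?_ (NNReal.coe_nonneg _)
          exact Finset.prod_le_prod (fun j _ => by positivity) hterm
      _ = _ := by
          rw [Finset.prod_mul_distrib, hsum, Finset.prod_const, mul_pow, cbcWeight, ← hu, pow_mul]
          ring
  · intro j hj
    obtain ⟨i, hi⟩ := mem_blocks_support.1 hj
    have := exists_interDigits_ne_zero hl hi
    rwa [Equiv.symm_apply_apply] at this
  · intro j hj n _
    rw [mem_blocks_support] at hj
    push Not at hj
    rw [interDigits, hj]
    simp

theorem truncPoly_zero (m : ℕ) : truncPoly b m 0 = 0 := by simp [truncPoly]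

/-- Group the vectors by support. Since zero entries contribute nothing to the congruence,
restriction to the support embeds each group into the corresponding `dualNet`. -/
theorem sum_indexSupport_le_criterion {m : ℕ} (γ : Finset (Fin s) → ℝ≥0) (P : (ZMod b)[X])
    (g : Fin (s * α) → (ZMod b)[X]) (S : Finset (Fin (s * α) → ℕ))
    (hS : ∀ l ∈ S, l ≠ 0 ∧ P ∣ ∑ p, truncPoly b m (l p) * g p) :
    ∑ l ∈ S, ENNReal.ofReal (cbcWeight b γ (indexSupport l)) *
        ((b : ℝ≥0∞) ^ (α * ∑ p, mu1 b (l p)))⁻¹ ≤ criterion b m γ P (s * α) g := by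
  classical
  have hmaps : ∀ l ∈ S, indexSupport l ∈ Finset.univ.filter
      fun v : Finset (Fin (s * α)) => v.Nonempty ∧ ∀ j ∈ v, j.val < s * α := by
    intro l hl
    rw [Finset.mem_filter]
    refine ⟨Finset.mem_univ _, ?_, fun j _ => j.2⟩
    obtain ⟨p, hp⟩ : ∃ p, l p ≠ 0 := by by_contra! hn; exact (hS l hl).1 (funext hn)
    exact ⟨p, by simp [indexSupport, hp]⟩
  rw [← Finset.sum_fiberwise_of_maps_to hmaps, criterion]
  refine Finset.sum_le_sum fun v _ => ?_
  have e1 : ∑ l ∈ S.filter (fun l => indexSupport l = v),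
      ENNReal.ofReal (cbcWeight b γ (indexSupport l)) *
        ((b : ℝ≥0∞) ^ (α * ∑ p, mu1 b (l p)))⁻¹ =
      ENNReal.ofReal (cbcWeight b γ v) * ∑ l ∈ S.filter (fun l => indexSupport l = v),
        ((b : ℝ≥0∞) ^ (α * ∑ p, mu1 b (l p)))⁻¹ := by
    rw [Finset.mul_sum]
    refine Finset.sum_congr rfl fun l hl => ?_
    rw [(Finset.mem_filter.1 hl).2]
  rw [e1]
  gcongr
  have hz : ∀ l : Fin (s * α) → ℕ, indexSupport l = v → ∀ p ∉ v, l p = 0 := by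
    intro l hl p hp
    by_contra h0
    exact hp (by rw [← hl]; simp [indexSupport, h0])
  let φ : {l // l ∈ S.filter fun l => indexSupport l = v} → dualNet b m P g v := fun l =>
    ⟨fun j => l.1 j, by
      obtain ⟨h1, h2⟩ := Finset.mem_filter.1 l.2
      refine ⟨fun j => ?_, ?_⟩
      · have : (j : Fin (s * α)) ∈ indexSupport l.1 := by rw [h2]; exact j.2
        exact Nat.pos_of_ne_zero (Finset.mem_filter.1 this).2
      · have := (hS l.1 h1).2
        rw [← Finset.sum_subset (Finset.subset_univ v) fun p _ hp => by
          rw [hz l.1 h2 p hp, truncPoly_zero, zero_mul]] at this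
        rwa [← Finset.sum_coe_sort] at this⟩
  have hφ : Function.Injective φ := by
    intro l l' h
    apply Subtype.ext
    funext p
    by_cases hp : p ∈ v
    · exact congrFun (congrArg Subtype.val h) ⟨p, hp⟩
    · rw [hz l.1 (Finset.mem_filter.1 l.2).2 p hp, hz l'.1 (Finset.mem_filter.1 l'.2).2 p hp]
  rw [← Finset.sum_coe_sort, ← tsum_fintype (L := .unconditional _)]
  refine le_trans (le_of_eq (tsum_congr fun l => ?_)) (ENNReal.tsum_comp_le_tsum_of_injective hφ _)
  congr 3
  rw [Finset.sum_coe_sort v fun p => mu1 b (l.1 p)]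
  symm
  refine Finset.sum_subset (Finset.subset_univ v) fun p _ hp => ?_
  rw [hz l.1 (Finset.mem_filter.1 l.2).2 p hp, mu1_zero]

theorem MemSobolev.error_le_criterion {m : ℕ} (hα : 1 < α) {γ : Finset (Fin s) → ℝ≥0} {q : ℝ≥0∞}
    (hq : 1 ≤ q) {F : (Fin s → ℝ) → ℝ} (h : MemSobolev α γ q ∞ F) {P : (ZMod b)[X]} (hP : P ≠ 0)
    (hPm : P.natDegree = m) (g : Fin (s * α) → (ZMod b)[X])
    (hfin : criterion b m γ P (s * α) g ≠ ∞) :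
    |1 / (b : ℝ) ^ m * ∑ n ∈ Finset.range (b ^ m), F (interlacedPoint b m α P g n) -
        ∫ y in cube s, F y| ≤
      (criterion b m γ P (s * α) g).toReal * (sobolevENorm α γ q ∞ F).toReal := by
  classical
  have hb := b_pos b
  set X := (criterion b m γ P (s * α) g).toReal * (sobolevENorm α γ q ∞ F).toReal with hX
  refine le_of_forall_pos_le_add fun ε hε => ?_
  obtain ⟨M₀, hM₀⟩ := walsh_partialSum_tendsto (b := b) (α := α) h.continuousOn hε
  -- Large enough for the Walsh sums to be `ε`-close to `F`, and at least `m` so that all digits of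
  -- the points are seen by the characters.
  set M := max M₀ m with hM
  have hMm : m ≤ M := le_max_right _ _
  have hconv := hM₀ M (le_max_left _ _)
  set c : (Fin (s * α) → ℕ) → ℂ := fun l => pairing F fun j => wal (M * α) (interDigits b l j)
    with hc
  set y : ℕ → Fin s → ℝ := interlacedPoint b m α P g with hy
  set D : (Fin (s * α) → ℕ) → Prop := fun l => P ∣ ∑ p, truncPoly b m (l p) * g p with hD
  have e1 : (1 / (b : ℂ) ^ m) * ∑ n ∈ Finset.range (b ^ m), ∑ l ∈ digitBox b M (s * α),
      c l * (starRingEnd ℂ) (walProd b M l (y n)) = ∑ l ∈ (digitBox b M (s * α)).filter D, c l := by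
    rw [Finset.sum_comm, Finset.mul_sum, Finset.sum_filter]
    refine Finset.sum_congr rfl fun l _ => ?_
    have := congrArg (starRingEnd ℂ) (sum_walProd_interlacedPoint hMm hP hPm g l)
    rw [map_sum] at this
    rw [← Finset.mul_sum, this]
    have hb' : (b : ℂ) ≠ 0 := by exact_mod_cast hb.ne'
    split_ifs
    · simp; field_simp
    · simp
  have h0mem : (0 : Fin (s * α) → ℕ) ∈ (digitBox b M (s * α)).filter D := by
    rw [Finset.mem_filter]
    exact ⟨zero_mem_digitBox M _, by simp [hD, truncPoly_zero]⟩
  have hc0 : c 0 = ((∫ z in cube s, F z : ℝ) : ℂ) := by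
    change pairing F _ = _
    rw [pairing, ← integral_complex_ofReal]
    refine integral_congr_ae (Filter.Eventually.of_forall fun z => ?_)
    have := walProd_zero (b := b) (s := s) (α := α) M z
    rw [walProd] at this
    simp only [this, mul_one]
  have e2 : ‖∑ l ∈ ((digitBox b M (s * α)).filter D).erase 0, c l‖ ≤ X := by
    have hS : ∀ l ∈ ((digitBox b M (s * α)).filter D).erase 0,
        l ≠ 0 ∧ P ∣ ∑ p, truncPoly b m (l p) * g p := fun l hl => by
      rw [Finset.mem_erase, Finset.mem_filter] at hl
      exact ⟨hl.1, hl.2.2⟩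
    have h1 : ∀ l ∈ ((digitBox b M (s * α)).filter D).erase 0, ‖c l‖ ≤
        (ENNReal.ofReal (cbcWeight b γ (indexSupport l)) *
          ((b : ℝ≥0∞) ^ (α * ∑ p, mu1 b (l p)))⁻¹).toReal *
        (sobolevENorm α γ q ∞ F).toReal := fun l hl => by
      rw [Finset.mem_erase, Finset.mem_filter] at hl
      have := h.norm_walsh_le_weight hα hq hl.2.1 hl.1
      rw [ENNReal.toReal_mul, ENNReal.toReal_ofReal (cbcWeight_nonneg hα _ _), ENNReal.toReal_inv,
        ENNReal.toReal_pow, ENNReal.toReal_natCast]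
      exact this
    refine (norm_sum_le_of_le _ h1).trans ?_
    rw [← Finset.sum_mul, hX]
    refine mul_le_mul_of_nonneg_right ?_ ENNReal.toReal_nonneg
    have hsum := sum_indexSupport_le_criterion γ P g _ hS
    rw [← ENNReal.toReal_sum]
    · exact ENNReal.toReal_mono hfin hsum
    · intro l hl
      exact ne_top_of_le_ne_top hfin ((Finset.single_le_sum (f := fun l =>
        ENNReal.ofReal (cbcWeight b γ (indexSupport l)) *
          ((b : ℝ≥0∞) ^ (α * ∑ p, mu1 b (l p)))⁻¹) (fun _ _ => zero_le) hl).trans hsum)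
  have e3 : (1 / (b : ℂ) ^ m) * ∑ n ∈ Finset.range (b ^ m), ∑ l ∈ digitBox b M (s * α),
      c l * (starRingEnd ℂ) (walProd b M l (y n)) - ((∫ z in cube s, F z : ℝ) : ℂ) =
      ∑ l ∈ ((digitBox b M (s * α)).filter D).erase 0, c l := by
    rw [e1, ← Finset.add_sum_erase _ _ h0mem, hc0]; ring
  have e4 : ‖(1 / (b : ℂ) ^ m) * ∑ n ∈ Finset.range (b ^ m), ((F (y n) : ℂ) -
      ∑ l ∈ digitBox b M (s * α), c l * (starRingEnd ℂ) (walProd b M l (y n)))‖ ≤ ε := by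
    rw [norm_mul, norm_div, norm_one, norm_pow, Complex.norm_natCast]
    have : ‖∑ n ∈ Finset.range (b ^ m), ((F (y n) : ℂ) -
      ∑ l ∈ digitBox b M (s * α), c l * (starRingEnd ℂ) (walProd b M l (y n)))‖ ≤
        ∑ n ∈ Finset.range (b ^ m), ε := norm_sum_le_of_le _ fun n _ => by
      rw [norm_sub_rev]; exact hconv _ (interlacedPoint_mem m P g n)
    rw [Finset.sum_const, Finset.card_range, nsmul_eq_mul] at this
    rw [one_div, inv_mul_le_iff₀ (by positivity)]
    refine this.trans (le_of_eq ?_)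
    push_cast; ring
  have e5 : ((1 / (b : ℝ) ^ m * ∑ n ∈ Finset.range (b ^ m), F (y n) - ∫ z in cube s, F z : ℝ) : ℂ) =
      (1 / (b : ℂ) ^ m) * ∑ n ∈ Finset.range (b ^ m), ((F (y n) : ℂ) -
        ∑ l ∈ digitBox b M (s * α), c l * (starRingEnd ℂ) (walProd b M l (y n))) +
      ∑ l ∈ ((digitBox b M (s * α)).filter D).erase 0, c l := by
    rw [← e3, Finset.sum_sub_distrib]
    push_cast; ring
  rw [← Real.norm_eq_abs, ← Complex.norm_real, e5]
  refine (norm_add_le _ _).trans ?_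
  linarith

end

section
/-! ### Sums in `[0,∞]` -/

theorem finsetSum_rpow_le {ι : Type*} (T : Finset ι) (f : ι → ℝ≥0∞) {p : ℝ} (h0 : 0 < p)
    (h1 : p ≤ 1) : (∑ i ∈ T, f i) ^ p ≤ ∑ i ∈ T, f i ^ p := by
  classical
  induction T using Finset.induction with
  | empty => simp [ENNReal.zero_rpow_of_pos h0]
  | insert a T ha ih =>
    rw [Finset.sum_insert ha, Finset.sum_insert ha]
    exact (ENNReal.rpow_add_le_add_rpow _ _ h0.le h1).trans (by gcongr)

theorem tsum_rpow_le {ι : Type*} (f : ι → ℝ≥0∞) {p : ℝ} (h0 : 0 < p) (h1 : p ≤ 1) :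
    (∑' i, f i) ^ p ≤ ∑' i, f i ^ p := by
  have : ∑' i, f i ≤ (∑' i, f i ^ p) ^ p⁻¹ := by
    rw [ENNReal.tsum_eq_iSup_sum]
    refine iSup_le fun T => ?_
    rw [← ENNReal.rpow_le_rpow_iff h0, ← ENNReal.rpow_mul, inv_mul_cancel₀ h0.ne',
      ENNReal.rpow_one]
    exact (finsetSum_rpow_le T f h0 h1).trans (ENNReal.sum_le_tsum T)
  calc (∑' i, f i) ^ p ≤ ((∑' i, f i ^ p) ^ p⁻¹) ^ p := by gcongr
    _ = _ := by rw [← ENNReal.rpow_mul, inv_mul_cancel₀ h0.ne', ENNReal.rpow_one]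

theorem tsum_prod_le {ι : Type*} [Fintype ι] (f : ι → ℕ → ℝ≥0∞) :
    ∑' l : ι → ℕ, ∏ i, f i (l i) ≤ ∏ i, ∑' k, f i k := by
  classical
  rw [ENNReal.tsum_eq_iSup_sum]
  refine iSup_le fun T => ?_
  have hsub : T ⊆ Fintype.piFinset fun i => T.image fun l => l i := fun l hl =>
    Fintype.mem_piFinset.2 fun i => Finset.mem_image_of_mem _ hl
  calc ∑ l ∈ T, ∏ i, f i (l i) ≤ ∑ l ∈ Fintype.piFinset fun i => T.image fun l => l i, ∏ i, f i (l i) :=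
        Finset.sum_le_sum_of_subset hsub
    _ = ∏ i, ∑ k ∈ T.image fun l => l i, f i k := by rw [Finset.prod_univ_sum]
    _ ≤ _ := Finset.prod_le_prod' fun i _ => ENNReal.sum_le_tsum _

/-! ### Sums over the numbers with given digits -/

variable {b : ℕ} [Fact b.Prime]

/-- The term `x ^ μ₁(k)` for `k > 0`. -/
noncomputable def digitTerm (b : ℕ) (x : ℝ) (k : ℕ) : ℝ≥0∞ :=
  if k = 0 then 0 else ENNReal.ofReal x ^ mu1 b k

/-- The value of `∑ x ^ μ₁(k)` over `k > 0`. -/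
noncomputable def digitTotal (b : ℕ) (x : ℝ) : ℝ := ((b : ℝ) - 1) * x / (1 - b * x)

theorem digitTotal_nonneg {x : ℝ} (hx : 0 < x) (hbx : b * x < 1) : 0 ≤ digitTotal b x := by
  have := one_lt_b b
  exact div_nonneg (mul_nonneg (by linarith) hx.le) (by linarith)

theorem tsum_digitTerm_le {x : ℝ} (hx : 0 < x) (hbx : b * x < 1) :
    ∑' k, digitTerm b x k ≤ ENNReal.ofReal (digitTotal b x) := by
  have hb := one_lt_b b
  have hb1 : 1 < b := (Fact.out : b.Prime).one_lt
  -- An exact identity for the partial sums, with geometric remainder: there are `(b - 1) * b ^ T`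
  -- numbers with `T + 1` digits.
  have hreal : ∀ T : ℕ, ∑ k ∈ Finset.range (b ^ T), (if k = 0 then 0 else x ^ mu1 b k) +
      digitTotal b x * (b * x) ^ T = digitTotal b x := by
    intro T
    induction T with
    | zero => simp
    | succ T ih =>
      have h1 : ∑ k ∈ Finset.Ico (b ^ T) (b ^ (T + 1)), (if k = 0 then 0 else x ^ mu1 b k) =
          ((b : ℝ) - 1) * x * (b * x) ^ T := by
        have : ∀ k ∈ Finset.Ico (b ^ T) (b ^ (T + 1)), (if k = 0 then 0 else x ^ mu1 b k) =
            x ^ (T + 1) := by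
          intro k hk
          rw [Finset.mem_Ico] at hk
          have hk0 : k ≠ 0 := by
            have : 0 < b ^ T := by positivity
            omega
          rw [if_neg hk0, mu1_eq hk0, (Nat.log_eq_iff (Or.inr ⟨hb1, hk0⟩)).2 hk]
        rw [Finset.sum_congr rfl this, Finset.sum_const, Nat.card_Ico, nsmul_eq_mul,
          Nat.cast_sub (Nat.pow_le_pow_right (by omega) (by omega))]
        push_cast
        rw [mul_pow]; ring
      have h2 : digitTotal b x * (1 - b * x) = ((b : ℝ) - 1) * x := by
        rw [digitTotal, div_mul_cancel₀]; linarith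
      rw [← Finset.sum_range_add_sum_Ico _ (Nat.pow_le_pow_right (by omega : 0 < b)
        (by omega : T ≤ T + 1)), h1]
      linear_combination ih - (b * x) ^ T * h2
  refine ENNReal.tsum_le_of_sum_range_le fun n => ?_
  have hn : n ≤ b ^ n := (Nat.lt_pow_self hb1).le
  refine (Finset.sum_le_sum_of_subset (Finset.range_subset_range.2 hn)).trans ?_
  have : ∀ k, digitTerm b x k = ENNReal.ofReal (if k = 0 then 0 else x ^ mu1 b k) := fun k => by
    rw [digitTerm]
    split_ifs
    · simp
    · rw [ENNReal.ofReal_pow hx.le]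
  simp only [this]
  rw [← ENNReal.ofReal_sum_of_nonneg fun k _ => by split_ifs <;> positivity]
  refine ENNReal.ofReal_le_ofReal ?_
  have h3 := hreal n
  have h4 : 0 ≤ digitTotal b x * (b * x) ^ n :=
    mul_nonneg (digitTotal_nonneg hx hbx) (by positivity)
  linarith

theorem coeff_truncPoly (m k a : ℕ) :
    (truncPoly b m k).coeff a = if a < m then ((k / b ^ a % b : ℕ) : ZMod b) else 0 := by
  rw [truncPoly, finsetSum_coeff]
  simp only [coeff_C_mul_X_pow]
  rw [Finset.sum_ite_eq]
  simp

theorem degree_truncPoly_lt (m k : ℕ) : (truncPoly b m k).degree < m :=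
  (degree_lt_iff_coeff_zero _ _).2 fun a ha => by rw [coeff_truncPoly, if_neg (not_lt.2 ha)]

theorem pow_dvd_of_truncPoly_eq_zero {m k : ℕ} (h : truncPoly b m k = 0) : b ^ m ∣ k :=
  pow_dvd_of_digits_eq_zero fun a ha => by
    have := coeff_truncPoly (b := b) m k a
    rw [h, coeff_zero, if_pos ha] at this
    exact natCast_mod_eq_zero.1 this.symm

open Classical in
/-- The terms whose index has vanishing first digits have a small sum. -/
theorem mul_tsum_digitTerm_truncPoly_le {m : ℕ} {x : ℝ} (hx : 0 < x) (hbx : b * x < 1) :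
    ((b ^ m - 1 : ℕ) : ℝ≥0∞) *
      ∑' k, (if truncPoly b m k = 0 then digitTerm b x k else 0) ≤
        ENNReal.ofReal (digitTotal b x) := by
  have hb1 : 1 < b := (Fact.out : b.Prime).one_lt
  have hbm : 0 < b ^ m := by positivity
  have hinj : Function.Injective fun q : ℕ => b ^ m * q := fun q q' h =>
    Nat.eq_of_mul_eq_mul_left hbm h
  have h1 : ∑' k, (if truncPoly b m k = 0 then digitTerm b x k else 0) ≤
      ∑' q, digitTerm b x (b ^ m * q) := by
    have e := hinj.tsum_eq (f := fun k => if b ^ m ∣ k then digitTerm b x k else 0) (by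
      intro k hk
      by_contra hn
      apply hk
      simp only
      rw [if_neg]
      rintro ⟨q, rfl⟩
      exact hn ⟨q, rfl⟩)
    simp only [dvd_mul_right, if_true] at e
    rw [e]
    refine ENNReal.tsum_le_tsum fun k => ?_
    split_ifs with h h'
    · exact le_rfl
    · exact absurd (pow_dvd_of_truncPoly_eq_zero h) h'
    · exact zero_le
    · exact zero_le
  have h2 : ∀ q, digitTerm b x (b ^ m * q) = ENNReal.ofReal x ^ m * digitTerm b x q := by
    intro q
    rw [digitTerm, digitTerm]
    by_cases hq : q = 0
    · simp [hq]
    · rw [if_neg (by positivity), if_neg hq, ← pow_add]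
      congr 1
      rw [mu1, Nat.digits_base_pow_mul hb1 (Nat.pos_of_ne_zero hq), mu1]
      simp
  simp only [h2, ENNReal.tsum_mul_left] at h1
  -- Vanishing of the first `m` digits means `b ^ m ∣ k`, which costs `x ^ m`. Since `b * x < 1`,
  -- this outweighs the number `b ^ m - 1` of candidates.
  have h3 : ((b ^ m - 1 : ℕ) : ℝ≥0∞) * ENNReal.ofReal x ^ m ≤ 1 := by
    rw [← ENNReal.ofReal_natCast, ← ENNReal.ofReal_pow hx.le, ← ENNReal.ofReal_mul (by positivity),
      ← ENNReal.ofReal_one]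
    refine ENNReal.ofReal_le_ofReal ?_
    have : ((b ^ m - 1 : ℕ) : ℝ) ≤ (b : ℝ) ^ m := by
      rw [← Nat.cast_pow]; exact_mod_cast Nat.sub_le _ _
    calc ((b ^ m - 1 : ℕ) : ℝ) * x ^ m ≤ (b : ℝ) ^ m * x ^ m := by gcongr
      _ = (b * x) ^ m := by rw [mul_pow]
      _ ≤ 1 := pow_le_one₀ (by have := b_pos b; positivity) hbx.le
  calc _ ≤ ((b ^ m - 1 : ℕ) : ℝ≥0∞) * (ENNReal.ofReal x ^ m * ∑' q, digitTerm b x q) := by gcongr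
    _ = (((b ^ m - 1 : ℕ) : ℝ≥0∞) * ENNReal.ofReal x ^ m) * ∑' q, digitTerm b x q := by ring
    _ ≤ 1 * ENNReal.ofReal (digitTotal b x) := mul_le_mul' h3 (tsum_digitTerm_le hx hbx)
    _ = _ := one_mul _

/-! ### The set of candidates for a component -/

theorem finite_polySet (b m : ℕ) [Fact b.Prime] : (polySet b m).Finite := by
  have : Finite (degreeLT (ZMod b) m) := (degreeLTEquiv (ZMod b) m).toEquiv.finite_iff.2 inferInstance
  have h : ((degreeLT (ZMod b) m : Set (ZMod b)[X])).Finite := this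
  exact h.subset fun p hp => mem_degreeLT.2 hp.2

theorem card_polySet (m : ℕ) : (finite_polySet b m).toFinset.card = b ^ m - 1 := by
  have e : polySet b m = (degreeLT (ZMod b) m : Set (ZMod b)[X]) \ {0} := by
    ext p
    simp only [polySet, Set.mem_ofPred_eq, Set.mem_sdiff, SetLike.mem_coe, mem_degreeLT,
      Set.mem_singleton_iff]
    tauto
  rw [← Set.ncard_eq_toFinset_card _ (finite_polySet b m), e, Set.ncard_sdiff_singleton_of_mem (by simp)]
  congr 1
  have : Nat.card (degreeLT (ZMod b) m) = Nat.card (Fin m → ZMod b) :=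
    Nat.card_congr (degreeLTEquiv (ZMod b) m).toEquiv
  rw [Nat.card_fun] at this
  rw [← Nat.card_coe_set_eq]
  simpa using this

/-- A linear congruence has at most one solution among the candidates. -/
theorem card_solutions_le_one {m : ℕ} {P t R : (ZMod b)[X]} (hP : Irreducible P)
    (hPm : P.natDegree = m) (ht : t ≠ 0) (htm : t.degree < m) [DecidablePred fun p => P ∣ t * p + R] :
    ((finite_polySet b m).toFinset.filter fun p => P ∣ t * p + R).card ≤ 1 := by
  have hdeg : P.degree = m := by rw [degree_eq_natDegree hP.ne_zero, hPm]
  refine Finset.card_le_one.2 fun p hp p' hp' => ?_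
  rw [Finset.mem_filter, Set.Finite.mem_toFinset] at hp hp'
  have h1 : P ∣ t * (p - p') := by
    have := dvd_sub hp.2 hp'.2
    rwa [add_sub_add_right_eq_sub, ← mul_sub] at this
  rcases (hP.prime.dvd_or_dvd h1) with h | h
  · exact absurd (eq_zero_of_dvd_of_degree_lt h (by rwa [hdeg])) ht
  · have := eq_zero_of_dvd_of_degree_lt h (by
      rw [hdeg]; exact (degree_sub_le _ _).trans_lt (max_lt hp.1.2 hp'.1.2))
    exact sub_eq_zero.1 this

end

section
/-! ### The component-by-component construction -/

variable {s : ℕ} {b : ℕ} [Fact b.Prime] {α : ℕ}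

open Classical in
/-- The sum over the dual net that bounds the powers of the terms of the search criterion. -/
noncomputable def dualSum (b m : ℕ) {d : ℕ} (x : ℝ) (P : (ZMod b)[X]) (g : Fin d → (ZMod b)[X])
    (v : Finset (Fin d)) : ℝ≥0∞ :=
  ∑' l : v → ℕ, if P ∣ ∑ j, truncPoly b m (l j) * g j then ∏ j, digitTerm b x (l j) else 0

theorem inv_pow_rpow {α : ℕ} {lam : ℝ} (n : ℕ) :
    ((((b : ℝ≥0∞) ^ (α * n))⁻¹) ^ lam : ℝ≥0∞) =
      ENNReal.ofReal ((b : ℝ) ^ (-((α : ℝ) * lam))) ^ n := by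
  have hb := b_pos b
  rw [← ENNReal.ofReal_natCast, ← ENNReal.ofReal_pow hb.le, ← ENNReal.ofReal_inv_of_pos (by positivity),
    ENNReal.ofReal_rpow_of_pos (by positivity), ← ENNReal.ofReal_pow (by positivity)]
  congr 1
  rw [← Real.rpow_natCast, ← Real.rpow_natCast, ← Real.rpow_neg hb.le, ← Real.rpow_mul hb.le,
    ← Real.rpow_mul hb.le]
  congr 1
  push_cast; ring

/-- Subadditivity of the power `lam ≤ 1` moves it inside the sum and turns `b ^ (-α μ₁)` into `x ^
μ₁` with `x = b ^ (-α lam)`. Positivity of the indices is encoded in `digitTerm`, which is 0 at 0.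
-/
theorem criterionTerm_rpow_le {m d : ℕ} {lam : ℝ} (h0 : 0 < lam) (h1 : lam ≤ 1) (w : ℝ≥0∞)
    (P : (ZMod b)[X]) (g : Fin d → (ZMod b)[X]) (v : Finset (Fin d)) :
    (w * ∑' l : dualNet b m P g v, ((b : ℝ≥0∞) ^ (α * ∑ j, mu1 b (l.1 j)))⁻¹) ^ lam ≤
      w ^ lam * dualSum b m ((b : ℝ) ^ (-((α : ℝ) * lam))) P g v := by
  rw [ENNReal.mul_rpow_of_nonneg _ _ h0.le]
  gcongr
  refine (tsum_rpow_le _ h0 h1).trans ?_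
  simp only [inv_pow_rpow]
  rw [tsum_subtype (dualNet b m P g v) fun l =>
    ENNReal.ofReal ((b : ℝ) ^ (-((α : ℝ) * lam))) ^ ∑ j, mu1 b (l j), dualSum]
  refine ENNReal.tsum_le_tsum fun l => ?_
  by_cases hl : l ∈ dualNet b m P g v
  · rw [Set.indicator_of_mem hl, if_pos hl.2, ← Finset.prod_pow_eq_pow_sum]
    refine le_of_eq (Finset.prod_congr rfl fun j _ => ?_)
    rw [digitTerm, if_neg (hl.1 j).ne']
  · rw [Set.indicator_of_notMem hl]; exact zero_le

/-- Exchange the sums and count, for fixed `l`, the candidates `p` that satisfy the congruence: at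
most one if the truncation of `l j` is nonzero, at most all of them otherwise. Each case contributes
at most one power product of `digitTotal`, hence the factor 2. -/
theorem sum_dualSum_update_le {m d : ℕ} {x : ℝ} (hx : 0 < x) (hbx : b * x < 1) {P : (ZMod b)[X]}
    (hP : Irreducible P) (hPm : P.natDegree = m) (g : Fin d → (ZMod b)[X]) {v : Finset (Fin d)}
    {j : Fin d} (hj : j ∈ v) :
    ∑ p ∈ (finite_polySet b m).toFinset, dualSum b m x P (Function.update g j p) v ≤
      2 * ENNReal.ofReal (digitTotal b x) ^ v.card := by
  classical
  set G := (finite_polySet b m).toFinset with hG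
  set N : ℝ≥0∞ := ((b ^ m - 1 : ℕ) : ℝ≥0∞) with hN
  have hcard : (G.card : ℝ≥0∞) = N := by rw [hG, card_polySet]
  let j' : v := ⟨j, hj⟩
  -- The count of solutions is charged to coordinate `j` alone, so that the bound is a product over
  -- the coordinates.
  let f : v → ℕ → ℝ≥0∞ := fun i k => if i = j'
    then digitTerm b x k + N * (if truncPoly b m k = 0 then digitTerm b x k else 0)
    else digitTerm b x k
  simp only [dualSum]
  rw [← Summable.tsum_finsetSum fun _ _ => ENNReal.summable]
  have hterm : ∀ l : v → ℕ, ∑ p ∈ G, (if P ∣ ∑ i, truncPoly b m (l i) * Function.update g j p i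
      then ∏ i, digitTerm b x (l i) else 0) ≤ ∏ i, f i (l i) := by
    intro l
    set R := ∑ i ∈ Finset.univ.erase j', truncPoly b m (l i) * g i with hR
    have hsum : ∀ p : (ZMod b)[X], ∑ i, truncPoly b m (l i) * Function.update g j p i =
        truncPoly b m (l j') * p + R := by
      intro p
      rw [← Finset.add_sum_erase _ _ (Finset.mem_univ j')]
      congr 1
      · simp [j']
      · refine Finset.sum_congr rfl fun i hi => ?_
        have : (i : Fin d) ≠ j := fun h => Finset.ne_of_mem_erase hi (Subtype.ext h)
        rw [Function.update_of_ne this]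
    simp only [hsum]
    rw [← Finset.sum_filter, Finset.sum_const, nsmul_eq_mul]
    have hprod : ∏ i, f i (l i) = (1 + N * (if truncPoly b m (l j') = 0 then 1 else 0)) *
        ∏ i, digitTerm b x (l i) := by
      rw [← Finset.mul_prod_erase Finset.univ (fun i => f i (l i)) (Finset.mem_univ j'),
        ← Finset.mul_prod_erase Finset.univ (fun i => digitTerm b x (l i)) (Finset.mem_univ j')]
      have : ∏ i ∈ Finset.univ.erase j', f i (l i) =
          ∏ i ∈ Finset.univ.erase j', digitTerm b x (l i) :=
        Finset.prod_congr rfl fun i hi => by simp only [f, if_neg (Finset.ne_of_mem_erase hi)]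
      rw [this]
      simp only [f, if_true]
      split_ifs <;> ring
    rw [hprod]
    gcongr
    split_ifs with h
    · rw [mul_one, ← hcard]
      have : (Finset.filter (fun p => P ∣ truncPoly b m (l j') * p + R) G).card ≤ 1 + G.card :=
        (Finset.card_filter_le _ _).trans (by omega)
      exact_mod_cast this
    · rw [mul_zero, add_zero]
      exact_mod_cast card_solutions_le_one hP hPm h (degree_truncPoly_lt m _)
  refine (ENNReal.tsum_le_tsum hterm).trans ((tsum_prod_le f).trans ?_)
  have hS := tsum_digitTerm_le hx hbx (b := b)
  set S := ENNReal.ofReal (digitTotal b x) with hSdef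
  rw [← Finset.mul_prod_erase Finset.univ _ (Finset.mem_univ j')]
  have h1 : ∑' k, f j' k ≤ 2 * S := by
    simp only [f, if_true]
    rw [ENNReal.tsum_add, ENNReal.tsum_mul_left, two_mul]
    exact add_le_add hS (mul_tsum_digitTerm_truncPoly_le hx hbx)
  have h2 : ∏ i ∈ Finset.univ.erase j', ∑' k, f i k ≤ S ^ (v.card - 1) := by
    calc ∏ i ∈ Finset.univ.erase j', ∑' k, f i k ≤ ∏ i ∈ Finset.univ.erase j', S :=
          Finset.prod_le_prod' fun i hi => by
            simp only [f, if_neg (Finset.ne_of_mem_erase hi)]; exact hS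
      _ = _ := by
          rw [Finset.prod_const, Finset.card_erase_of_mem (Finset.mem_univ _), Finset.card_univ,
            Fintype.card_coe]
  calc _ ≤ 2 * S * S ^ (v.card - 1) := mul_le_mul' h1 h2
    _ = 2 * S ^ v.card := by
        rw [mul_assoc, ← pow_succ', Nat.sub_add_cancel (Finset.card_pos.2 ⟨j, hj⟩)]

/-- For the first component, `g j = 1` and the degree bound force the truncation itself to vanish,
so the rare-index estimate replaces the average over candidates. -/
theorem mul_dualSum_singleton_le {m d : ℕ} {x : ℝ} (hx : 0 < x) (hbx : b * x < 1) {P : (ZMod b)[X]}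
    (hP : Irreducible P) (hPm : P.natDegree = m) {g : Fin d → (ZMod b)[X]} {j : Fin d}
    (hg : g j = 1) :
    ((b ^ m - 1 : ℕ) : ℝ≥0∞) * dualSum b m x P g {j} ≤ ENNReal.ofReal (digitTotal b x) := by
  classical
  refine le_trans ?_ (mul_tsum_digitTerm_truncPoly_le hx hbx (m := m))
  gcongr
  have h1 : dualSum b m x P g {j} ≤ ∑' l : ({j} : Finset (Fin d)) → ℕ,
      ∏ i, (if truncPoly b m (l i) = 0 then digitTerm b x (l i) else 0) := by
    refine ENNReal.tsum_le_tsum fun l => ?_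
    split_ifs with h
    · refine le_of_eq (Finset.prod_congr rfl fun i _ => ?_)
      rw [if_pos]
      have hu : (Finset.univ : Finset ({j} : Finset (Fin d))) = {i} := by
        ext i'
        simp only [Finset.mem_univ, Finset.mem_singleton, true_iff]
        exact Subsingleton.elim _ _
      have hi : (i : Fin d) = j := Finset.mem_singleton.1 i.2
      rw [hu, Finset.sum_singleton, hi, hg, mul_one] at h
      refine eq_zero_of_dvd_of_degree_lt h ?_
      rw [degree_eq_natDegree hP.ne_zero, hPm]
      exact degree_truncPoly_lt m _
    · exact zero_le
  refine h1.trans ((tsum_prod_le fun _ k =>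
    if truncPoly b m k = 0 then digitTerm b x k else 0).trans ?_)
  rw [Finset.prod_const, Finset.card_univ, Fintype.card_coe, Finset.card_singleton, pow_one]

/-- The term of the search criterion that belongs to a set of components. -/
noncomputable def criterionTerm (b m : ℕ) {s α : ℕ} (γ : Finset (Fin s) → ℝ≥0) (P : (ZMod b)[X])
    (g : Fin (s * α) → (ZMod b)[X]) (v : Finset (Fin (s * α))) : ℝ≥0∞ :=
  ENNReal.ofReal (cbcWeight b γ v) *
      ∑' l : dualNet b m P g v, ((b : ℝ≥0∞) ^ (α * ∑ j, mu1 b (l.1 j)))⁻¹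

/-- The nonempty sets among the first `d` components. -/
def initialSets (n d : ℕ) : Finset (Finset (Fin n)) :=
  Finset.univ.filter fun v => v.Nonempty ∧ ∀ j ∈ v, j.val < d

/-- The sets of components with largest element `j`. -/
def setsEndingAt {n : ℕ} (j : Fin n) : Finset (Finset (Fin n)) :=
  Finset.univ.filter fun v => j ∈ v ∧ ∀ i ∈ v, i.val ≤ j.val

theorem criterion_eq (b m : ℕ) (γ : Finset (Fin s) → ℝ≥0) (P : (ZMod b)[X]) (d : ℕ)
    (g : Fin (s * α) → (ZMod b)[X]) :
    criterion b m γ P d g = ∑ v ∈ initialSets (s * α) d, criterionTerm b m γ P g v := rfl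

theorem sum_initialSets_succ {n : ℕ} (j : Fin n) (f : Finset (Fin n) → ℝ≥0∞) :
    ∑ v ∈ initialSets n (j.val + 1), f v =
      ∑ v ∈ initialSets n j.val, f v + ∑ v ∈ setsEndingAt j, f v := by
  have hd : Disjoint (initialSets n j.val) (setsEndingAt j) := by
    rw [Finset.disjoint_left]
    intro v hv hv'
    exact lt_irrefl _ ((Finset.mem_filter.1 hv).2.2 j (Finset.mem_filter.1 hv').2.1)
  rw [← Finset.sum_union hd]
  refine Finset.sum_congr ?_ fun _ _ => rfl
  ext v
  simp only [initialSets, setsEndingAt, Finset.mem_union, Finset.mem_filter, Finset.mem_univ,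
    true_and, Nat.lt_succ_iff]
  constructor
  · rintro ⟨h1, h2⟩
    by_cases hj : j ∈ v
    · exact Or.inr ⟨hj, h2⟩
    · refine Or.inl ⟨h1, fun i hi => lt_of_le_of_ne (h2 i hi) fun h => hj ?_⟩
      rwa [← Fin.ext h]
  · rintro (⟨h1, h2⟩ | ⟨h1, h2⟩)
    · exact ⟨h1, fun i hi => (h2 i hi).le⟩
    · exact ⟨⟨j, h1⟩, h2⟩

theorem dualNet_congr {m d : ℕ} {P : (ZMod b)[X]} {g g' : Fin d → (ZMod b)[X]}
    {v : Finset (Fin d)} (h : ∀ i ∈ v, g i = g' i) : dualNet b m P g v = dualNet b m P g' v := by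
  have : ∀ l : v → ℕ, ∑ j, truncPoly b m (l j) * g j = ∑ j, truncPoly b m (l j) * g' j :=
    fun l => Finset.sum_congr rfl fun j _ => by rw [h j j.2]
  simp only [dualNet, this]

theorem criterionTerm_congr {m : ℕ} {γ : Finset (Fin s) → ℝ≥0} {P : (ZMod b)[X]}
    {g g' : Fin (s * α) → (ZMod b)[X]} {v : Finset (Fin (s * α))} (h : ∀ i ∈ v, g i = g' i) :
    criterionTerm b m γ P g v = criterionTerm b m γ P g' v := by
  rw [criterionTerm, criterionTerm, dualNet_congr h]

theorem criterion_congr {m d : ℕ} {γ : Finset (Fin s) → ℝ≥0} {P : (ZMod b)[X]}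
    {g g' : Fin (s * α) → (ZMod b)[X]} (h : ∀ i : Fin (s * α), i.val < d → g i = g' i) :
    criterion b m γ P d g = criterion b m γ P d g' := by
  rw [criterion_eq, criterion_eq]
  exact Finset.sum_congr rfl fun v hv =>
    criterionTerm_congr fun i hi => h i ((Finset.mem_filter.1 hv).2.2 i hi)

/-- Induction on `d`: the terms new at component `j` belong to the sets with largest element `j`.
The power `lam` of their sum is bounded by its average over the candidates, and subadditivity joins
it to the earlier part. -/
theorem IsCBC.mul_criterion_rpow_le {m : ℕ} (hm : 1 ≤ m) {γ : Finset (Fin s) → ℝ≥0}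
    {P : (ZMod b)[X]} (hP : Irreducible P) (hPm : P.natDegree = m)
    {g : Fin (s * α) → (ZMod b)[X]} (hg : IsCBC b m γ P g) {lam : ℝ} (h0 : 0 < lam) (h1 : lam ≤ 1)
    (hlam : 1 < α * lam) (d : ℕ) (hd : d ≤ s * α) :
    ((b ^ m - 1 : ℕ) : ℝ≥0∞) * criterion b m γ P d g ^ lam ≤
      2 * ∑ v ∈ initialSets (s * α) d, ENNReal.ofReal (cbcWeight b γ v) ^ lam *
        ENNReal.ofReal (digitTotal b ((b : ℝ) ^ (-((α : ℝ) * lam)))) ^ v.card := by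
  have hb := one_lt_b b
  set x := (b : ℝ) ^ (-((α : ℝ) * lam)) with hx
  set S := ENNReal.ofReal (digitTotal b x) with hS
  set N : ℝ≥0∞ := ((b ^ m - 1 : ℕ) : ℝ≥0∞) with hN
  have hx0 : 0 < x := by positivity
  have hbx : b * x < 1 := by
    rw [hx]
    nth_rewrite 1 [← Real.rpow_one (b : ℝ)]
    rw [← Real.rpow_add (by linarith)]
    exact Real.rpow_lt_one_of_one_lt_of_neg hb (by linarith)
  have hN0 : N ≠ 0 := by
    have : b ≤ b ^ m := Nat.le_self_pow (by omega) b
    have h2 := (Fact.out : b.Prime).two_le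
    rw [hN, Nat.cast_ne_zero]; omega
  have hterm : ∀ (g' : Fin (s * α) → (ZMod b)[X]) (T : Finset (Finset (Fin (s * α)))),
      (∑ v ∈ T, criterionTerm b m γ P g' v) ^ lam ≤
        ∑ v ∈ T, ENNReal.ofReal (cbcWeight b γ v) ^ lam * dualSum b m x P g' v := fun g' T =>
    (finsetSum_rpow_le T _ h0 h1).trans
      (Finset.sum_le_sum fun v _ => criterionTerm_rpow_le h0 h1 _ P g' v)
  induction d with
  | zero =>
    have : initialSets (s * α) 0 = ∅ := by
      rw [initialSets, Finset.filter_eq_empty_iff]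
      rintro v _ ⟨⟨j, hj⟩, h⟩
      exact absurd (h j hj) (by omega)
    rw [criterion_eq, this]
    simp [ENNReal.zero_rpow_of_pos h0]
  | succ d ih =>
    have ih := ih (by omega)
    set j : Fin (s * α) := ⟨d, by omega⟩ with hj
    -- Finiteness, available from the induction hypothesis, is needed to cancel the old part in
    -- `[0,∞]`.
    have hne : criterion b m γ P d g ≠ ∞ := by
      intro htop
      rw [htop, ENNReal.top_rpow_of_pos h0, ENNReal.mul_top hN0, top_le_iff] at ih
      refine absurd ih (ENNReal.mul_ne_top (by simp) (ENNReal.sum_ne_top.2 fun v _ => ?_))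
      exact ENNReal.mul_ne_top (ENNReal.rpow_ne_top_of_nonneg h0.le ENNReal.ofReal_ne_top)
        (ENNReal.pow_ne_top ENNReal.ofReal_ne_top)
    have split : ∀ g' : Fin (s * α) → (ZMod b)[X], criterion b m γ P (d + 1) g' =
        criterion b m γ P d g' + ∑ v ∈ setsEndingAt j, criterionTerm b m γ P g' v := fun g' =>
      sum_initialSets_succ j _
    have key : N * (∑ v ∈ setsEndingAt j, criterionTerm b m γ P g v) ^ lam ≤
        2 * ∑ v ∈ setsEndingAt j, ENNReal.ofReal (cbcWeight b γ v) ^ lam * S ^ v.card := by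
      by_cases hd0 : d = 0
      · have hsets : setsEndingAt j = {{j}} := by
          ext v
          simp only [setsEndingAt, Finset.mem_filter, Finset.mem_univ, true_and,
            Finset.mem_singleton]
          constructor
          · rintro ⟨hjv, hle⟩
            refine Finset.eq_singleton_iff_unique_mem.2 ⟨hjv, fun i hi => Fin.ext ?_⟩
            have := hle i hi
            simp only [hj] at this ⊢
            omega
          · rintro rfl; simp
        refine (mul_le_mul_right (hterm g _) N).trans ?_
        rw [hsets, Finset.sum_singleton, Finset.sum_singleton, Finset.card_singleton, pow_one]
        have h2 := mul_dualSum_singleton_le hx0 hbx hP hPm (hg.first j hd0)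
        calc N * (ENNReal.ofReal (cbcWeight b γ {j}) ^ lam * dualSum b m x P g {j})
            = ENNReal.ofReal (cbcWeight b γ {j}) ^ lam * (N * dualSum b m x P g {j}) := by ring
          _ ≤ ENNReal.ofReal (cbcWeight b γ {j}) ^ lam * S := by gcongr
          _ ≤ 2 * (ENNReal.ofReal (cbcWeight b γ {j}) ^ lam * S) := by
              rw [two_mul]; exact le_self_add
      -- The criterion of the earlier components does not see component `j`, so minimizing the full
      -- criterion minimizes the new terms.
      · have hmin : ∀ p ∈ (finite_polySet b m).toFinset,
            ∑ v ∈ setsEndingAt j, criterionTerm b m γ P g v ≤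
              ∑ v ∈ setsEndingAt j, criterionTerm b m γ P (Function.update g j p) v := by
          intro p hp
          have h2 := hg.minimal j (Nat.pos_of_ne_zero hd0) p
            ((Set.Finite.mem_toFinset _).1 hp)
          have h3 : criterion b m γ P d (Function.update g j p) = criterion b m γ P d g :=
            criterion_congr fun i hi => Function.update_of_ne (fun h => by
              rw [h] at hi; exact lt_irrefl _ hi) _ _
          change criterion b m γ P (d + 1) g ≤ criterion b m γ P (d + 1) _ at h2
          rw [split, split, h3] at h2
          exact (ENNReal.add_le_add_iff_left hne).1 h2
        calc N * (∑ v ∈ setsEndingAt j, criterionTerm b m γ P g v) ^ lam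
            = ∑ p ∈ (finite_polySet b m).toFinset,
                (∑ v ∈ setsEndingAt j, criterionTerm b m γ P g v) ^ lam := by
              rw [Finset.sum_const, card_polySet, nsmul_eq_mul]
          _ ≤ ∑ p ∈ (finite_polySet b m).toFinset, ∑ v ∈ setsEndingAt j,
                ENNReal.ofReal (cbcWeight b γ v) ^ lam *
                  dualSum b m x P (Function.update g j p) v :=
              Finset.sum_le_sum fun p hp =>
                (ENNReal.rpow_le_rpow (hmin p hp) h0.le).trans (hterm _ _)
          _ = ∑ v ∈ setsEndingAt j, ENNReal.ofReal (cbcWeight b γ v) ^ lam *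
                ∑ p ∈ (finite_polySet b m).toFinset,
                  dualSum b m x P (Function.update g j p) v := by
              rw [Finset.sum_comm]
              simp only [Finset.mul_sum]
          _ ≤ ∑ v ∈ setsEndingAt j, ENNReal.ofReal (cbcWeight b γ v) ^ lam * (2 * S ^ v.card) := by
              refine Finset.sum_le_sum fun v hv => ?_
              gcongr
              exact sum_dualSum_update_le hx0 hbx hP hPm g (Finset.mem_filter.1 hv).2.1
          _ = _ := by
              rw [Finset.mul_sum]
              exact Finset.sum_congr rfl fun v _ => by ring
    calc N * criterion b m γ P (d + 1) g ^ lam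
        ≤ N * (criterion b m γ P d g ^ lam +
            (∑ v ∈ setsEndingAt j, criterionTerm b m γ P g v) ^ lam) := by
          rw [split]
          gcongr
          exact ENNReal.rpow_add_le_add_rpow _ _ h0.le h1
      _ ≤ _ := by
          rw [mul_add]
          refine (add_le_add ih key).trans (le_of_eq ?_)
          have := sum_initialSets_succ j fun v =>
            ENNReal.ofReal (cbcWeight b γ v) ^ lam * S ^ v.card
          rw [← mul_add]
          exact congrArg _ this.symm

/-- The components can be constructed one after the other. -/
theorem exists_isCBC {m : ℕ} (hm : 1 ≤ m) (γ : Finset (Fin s) → ℝ≥0) (P : (ZMod b)[X]) :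
    ∃ g : Fin (s * α) → (ZMod b)[X], IsCBC b m γ P g := by
  have hone : (1 : (ZMod b)[X]) ∈ polySet b m :=
    ⟨one_ne_zero, by rw [degree_one]; exact_mod_cast hm⟩
  have key : ∀ d ≤ s * α, ∃ g : Fin (s * α) → (ZMod b)[X], (∀ j, g j ∈ polySet b m) ∧
      (∀ j : Fin (s * α), j.val = 0 → g j = 1) ∧
      ∀ j : Fin (s * α), 0 < j.val → j.val < d → ∀ p ∈ polySet b m,
        criterion b m γ P (j.val + 1) g ≤ criterion b m γ P (j.val + 1) (Function.update g j p) := by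
    intro d
    induction d with
    | zero => exact fun _ => ⟨fun _ => 1, fun _ => hone, fun _ _ => rfl, by omega⟩
    | succ d ih =>
      intro hd
      obtain ⟨g, h1, h2, h3⟩ := ih (by omega)
      by_cases hd0 : d = 0
      · exact ⟨g, h1, h2, by omega⟩
      set k : Fin (s * α) := ⟨d, by omega⟩ with hk
      obtain ⟨p, hp, hmin⟩ := (finite_polySet b m).toFinset.exists_min_image
        (fun p => criterion b m γ P (d + 1) (Function.update g k p))
        ⟨1, (Set.Finite.mem_toFinset _).2 hone⟩
      rw [Set.Finite.mem_toFinset] at hp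
      refine ⟨Function.update g k p, fun j => ?_, fun j hj => ?_, fun j hj hjd r hr => ?_⟩
      · by_cases hjk : j = k
        · rw [hjk, Function.update_self]; exact hp
        · rw [Function.update_of_ne hjk]; exact h1 j
      · rw [Function.update_of_ne]
        · exact h2 j hj
        · rintro rfl; exact hd0 hj
      · by_cases hjk : j = k
        · subst hjk
          rw [Function.update_idem]
          exact hmin r ((Set.Finite.mem_toFinset _).2 hr)
        · have hlt : j.val < d := by
            refine lt_of_le_of_ne (Nat.lt_succ_iff.1 hjd) fun h => hjk (Fin.ext h)
          -- Changing component `k` leaves all earlier criteria, and with them the earlier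
          -- minimality, unchanged.
          have e : ∀ g' : Fin (s * α) → (ZMod b)[X], criterion b m γ P (j.val + 1)
              (Function.update g' k p) = criterion b m γ P (j.val + 1) g' := fun g' =>
            criterion_congr fun i hi => Function.update_of_ne (fun h => by
              rw [h, hk] at hi; simp only at hi; omega) _ _
          rw [Function.update_comm (Ne.symm hjk), e, e]
          exact h3 j hj hlt r hr
  obtain ⟨g, h1, h2, h3⟩ := key (s * α) le_rfl
  exact ⟨g, h1, h2, fun j hj p hp => h3 j hj j.2 p hp⟩

/-- There are irreducible polynomials of each positive degree over a prime field. -/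
theorem exists_isModulus {m : ℕ} (hm : 1 ≤ m) : ∃ P : (ZMod b)[X], IsModulus b m P := by
  -- The minimal polynomial of a generator of the field with `b ^ m` elements is irreducible of
  -- degree `m`.
  obtain ⟨θ, hθ⟩ := Field.exists_primitive_element (ZMod b) (GaloisField b m)
  have hi : IsIntegral (ZMod b) θ := Algebra.IsIntegral.isIntegral θ
  refine ⟨minpoly (ZMod b) θ, minpoly.irreducible hi, ?_⟩
  rw [← IntermediateField.adjoin.finrank hi, hθ, IntermediateField.finrank_top',
    GaloisField.finrank b (by omega)]

end

/-! ### Grouping index sets by blocks, and the final bound on the criterion. -/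

section
variable {s α b : ℕ}

/-- The part of an index set in the `j`-th block. -/
def blockPart (v : Finset (Fin (s * α))) (j : Fin s) : Finset (Fin α) :=
  Finset.univ.filter fun i => finProdFinEquiv (j, i) ∈ v

theorem mem_blockPart {v : Finset (Fin (s * α))} {j : Fin s} {i : Fin α} :
    i ∈ blockPart v j ↔ finProdFinEquiv (j, i) ∈ v := by simp [blockPart]

theorem mem_blocks {v : Finset (Fin (s * α))} {j : Fin s} :
    j ∈ blocks v ↔ blockPart v j ≠ ∅ := by
  rw [← Finset.nonempty_iff_ne_empty, blocks, Finset.mem_image]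
  constructor
  · rintro ⟨p, hp, rfl⟩
    refine ⟨p.modNat, mem_blockPart.2 ?_⟩
    have : finProdFinEquiv (p.divNat, p.modNat) = p := finProdFinEquiv.apply_symm_apply p
    rwa [this]
  · rintro ⟨i, hi⟩
    refine ⟨_, mem_blockPart.1 hi, ?_⟩
    exact congrArg Prod.fst (finProdFinEquiv.symm_apply_apply (j, i))

theorem sum_card_blockPart (v : Finset (Fin (s * α))) :
    ∑ j, (blockPart v j).card = v.card := by
  simp_rw [blockPart, Finset.card_filter]
  rw [← Fintype.sum_prod_type', Equiv.sum_comp finProdFinEquiv (fun p => if p ∈ v then 1 else 0),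
    ← Finset.card_filter, Finset.filter_univ_mem]

theorem sum_pow_card_univ (S : ℝ) :
    ∑ A : Finset (Fin α), S ^ A.card = (1 + S) ^ α := by
  have h := Fintype.sum_pow_mul_eq_add_pow (Fin α) S 1
  simpa [add_comm] using h

/-- An index set meeting exactly the blocks in `u` amounts to an independent choice of a nonempty
subset of `Fin α` for each block of `u`; one block contributes `(1 + S) ^ α - 1`. -/
theorem sum_pow_card_of_blocks_eq (S : ℝ) (u : Finset (Fin s)) :
    ∑ v : Finset (Fin (s * α)) with blocks v = u, S ^ v.card = ((1 + S) ^ α - 1) ^ u.card := by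
  set t : Fin s → Finset (Finset (Fin α)) := fun j =>
    if j ∈ u then Finset.univ.erase ∅ else {∅} with ht
  have h1 : ∏ j, ∑ A ∈ t j, S ^ A.card = ((1 + S) ^ α - 1) ^ u.card := by
    have : ∀ j, ∑ A ∈ t j, S ^ A.card = if j ∈ u then (1 + S) ^ α - 1 else 1 := fun j => by
      by_cases hj : j ∈ u
      · simp only [ht, hj, if_true]
        rw [← sum_pow_card_univ, ← Finset.add_sum_erase _ _ (Finset.mem_univ ∅)]
        simp
      · simp [ht, hj]
    simp_rw [this]
    rw [Finset.prod_ite_mem, Finset.univ_inter, Finset.prod_const]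
  rw [← h1, Finset.prod_univ_sum]
  refine Finset.sum_bij' (fun v _ => blockPart v)
    (fun f _ => Finset.univ.filter fun p => (finProdFinEquiv.symm p).2 ∈ f (finProdFinEquiv.symm p).1)
    ?_ ?_ ?_ ?_ ?_
  · intro v hv
    obtain rfl := (Finset.mem_filter.1 hv).2
    rw [Fintype.mem_piFinset]
    intro j
    by_cases hj : j ∈ blocks v
    · simpa [ht, hj] using mem_blocks.1 hj
    · simpa [ht, hj] using not_not.1 (mt mem_blocks.2 hj)
  · intro f hf
    rw [Fintype.mem_piFinset] at hf
    refine Finset.mem_filter.2 ⟨Finset.mem_univ _, ?_⟩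
    ext j
    have e : blockPart (Finset.univ.filter fun p =>
        (finProdFinEquiv.symm p).2 ∈ f (finProdFinEquiv.symm p).1) j = f j := by
      ext i; rw [mem_blockPart, Finset.mem_filter, Equiv.symm_apply_apply]; simp
    rw [mem_blocks, e]
    have := hf j
    by_cases hj : j ∈ u
    · simp only [ht, hj, if_true, Finset.mem_erase] at this; simp [hj, this.1]
    · simp only [ht, hj, if_false, Finset.mem_singleton] at this; simp [hj, this]
  · intro v _
    ext p
    rw [Finset.mem_filter, mem_blockPart, Prod.mk.eta, Equiv.apply_symm_apply]; simp
  · intro f _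
    funext j
    ext i; rw [mem_blockPart, Finset.mem_filter, Equiv.symm_apply_apply]; simp
  · intro v _
    rw [Finset.prod_pow_eq_pow_sum, sum_card_blockPart]

section

variable [Fact b.Prime] [NeZero α]

theorem digitTotal_rpow {t : ℝ} (ht : 1 < t) :
    digitTotal b ((b : ℝ) ^ (-t)) = ((b : ℝ) - 1) / ((b : ℝ) ^ t - b) := by
  have hb : (1 : ℝ) < b := by exact_mod_cast (Fact.out : b.Prime).one_lt
  have h0 : (0 : ℝ) < (b : ℝ) ^ t := Real.rpow_pos_of_pos (by linarith) _
  have h1 : (b : ℝ) < (b : ℝ) ^ t := by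
    simpa using Real.rpow_lt_rpow_of_exponent_lt hb ht
  rw [digitTotal, Real.rpow_neg (by linarith)]
  have h2 : (b : ℝ) ^ t - b ≠ 0 := by linarith
  have h3 : 1 - (b : ℝ) * ((b : ℝ) ^ t)⁻¹ ≠ 0 := by
    have : 1 - (b : ℝ) * ((b : ℝ) ^ t)⁻¹ = ((b : ℝ) ^ t - b) / (b : ℝ) ^ t := by
      field_simp
    rw [this]; exact div_ne_zero h2 h0.ne'
  rw [div_eq_div_iff h3 h2]
  field_simp

theorem cbcWeight_rpow (hα : 1 < α) (γ : Finset (Fin s) → ℝ≥0) (v : Finset (Fin (s * α)))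
    (lam : ℝ) : cbcWeight b γ v ^ lam = (γ (blocks v) : ℝ) ^ lam *
      ((constC α b * (b : ℝ) ^ (α * (α - 1) / 2)) ^ lam) ^ (blocks v).card := by
  have hC : 0 ≤ constC α b := (constC_pos hα).le
  rw [cbcWeight, pow_mul, mul_right_comm, ← mul_pow, mul_comm,
    Real.mul_rpow (by positivity) (by positivity), Real.rpow_pow_comm (by positivity)]

/-- The weight depends on `v` only through `blocks v`, so summing over the fibres of `blocks` leaves
one factor `rho` per block. -/
theorem sum_cbcWeight_rpow (hα : 1 < α) (γ : Finset (Fin s) → ℝ≥0) {lam : ℝ}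
    (hlam : 1 < α * lam) :
    ∑ v ∈ initialSets (s * α) (s * α), cbcWeight b γ v ^ lam *
        digitTotal b ((b : ℝ) ^ (-((α : ℝ) * lam))) ^ v.card =
      ∑ u : Finset (Fin s) with u.Nonempty, (γ u : ℝ) ^ lam * rho α b lam ^ u.card := by
  have hmaps : ∀ v ∈ initialSets (s * α) (s * α),
      blocks v ∈ Finset.univ.filter (fun u : Finset (Fin s) => u.Nonempty) := fun v hv => by
    rw [Finset.mem_filter]
    exact ⟨Finset.mem_univ _, Finset.image_nonempty.2 (Finset.mem_filter.1 hv).2.1⟩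
  rw [← Finset.sum_fiberwise_of_maps_to hmaps]
  refine Finset.sum_congr rfl fun u hu => ?_
  have e : (initialSets (s * α) (s * α)).filter (fun v => blocks v = u) =
      Finset.univ.filter fun v : Finset (Fin (s * α)) => blocks v = u := by
    ext v
    simp only [initialSets, Finset.mem_filter, Finset.mem_univ, true_and, and_iff_right_iff_imp]
    rintro rfl
    exact ⟨Finset.image_nonempty.1 (Finset.mem_filter.1 hu).2, fun j _ => j.2⟩
  rw [e, rho, mul_pow, ← digitTotal_rpow hlam, ← sum_pow_card_of_blocks_eq, Finset.mul_sum,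
    Finset.mul_sum]
  refine Finset.sum_congr rfl fun v hv => ?_
  rw [cbcWeight_rpow hα, (Finset.mem_filter.1 hv).2, mul_assoc]

/-- The criterion of a component-by-component construction is finite and is bounded in terms of
the weights. -/
theorem IsCBC.criterion_le {m : ℕ} {γ : Finset (Fin s) → ℝ≥0} {P : (ZMod b)[X]}
    {g : Fin (s * α) → (ZMod b)[X]} (hα : 1 < α) (hm : 1 ≤ m) (hP : Irreducible P)
    (hPm : P.natDegree = m) (hg : IsCBC b m γ P g) {lam : ℝ} (h0 : 0 < lam) (h1 : lam ≤ 1)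
    (hlam : 1 < α * lam) :
    criterion b m γ P (s * α) g ≠ ∞ ∧ (criterion b m γ P (s * α) g).toReal ≤
      (2 / ((b : ℝ) ^ m - 1) * ∑ u : Finset (Fin s) with u.Nonempty,
        (γ u : ℝ) ^ lam * rho α b lam ^ u.card) ^ (1 / lam) := by
  have hb : 1 < b := (Fact.out : b.Prime).one_lt
  have hbm : 1 < b ^ m := Nat.one_lt_pow (by omega) hb
  have hbm' : (0 : ℝ) < (b : ℝ) ^ m - 1 := by
    have : (1 : ℝ) < (b : ℝ) ^ m := by exact_mod_cast hbm
    linarith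
  have hcast : ((b ^ m - 1 : ℕ) : ℝ≥0∞) = ENNReal.ofReal ((b : ℝ) ^ m - 1) := by
    rw [← ENNReal.ofReal_natCast, Nat.cast_sub hbm.le]; norm_num
  have hS : 0 ≤ digitTotal b ((b : ℝ) ^ (-((α : ℝ) * lam))) := by
    rw [digitTotal_rpow hlam]
    have h2 : (1 : ℝ) < b := by exact_mod_cast hb
    have h3 : (b : ℝ) < (b : ℝ) ^ ((α : ℝ) * lam) := by
      simpa using Real.rpow_lt_rpow_of_exponent_lt h2 hlam
    exact div_nonneg (by linarith) (by linarith)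
  have key := hg.mul_criterion_rpow_le hm hP hPm h0 h1 hlam (s * α) le_rfl
  have hsum : ∑ v ∈ initialSets (s * α) (s * α), ENNReal.ofReal (cbcWeight b γ v) ^ lam *
        ENNReal.ofReal (digitTotal b ((b : ℝ) ^ (-((α : ℝ) * lam)))) ^ v.card =
      ENNReal.ofReal (∑ u : Finset (Fin s) with u.Nonempty,
        (γ u : ℝ) ^ lam * rho α b lam ^ u.card) := by
    rw [← sum_cbcWeight_rpow hα γ hlam, ENNReal.ofReal_sum_of_nonneg]
    · refine Finset.sum_congr rfl fun v _ => ?_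
      rw [ENNReal.ofReal_mul (Real.rpow_nonneg (cbcWeight_nonneg hα γ v) _),
        ENNReal.ofReal_pow hS, ENNReal.ofReal_rpow_of_nonneg (cbcWeight_nonneg hα γ v) h0.le]
    · exact fun v _ => mul_nonneg (Real.rpow_nonneg (cbcWeight_nonneg hα γ v) _) (pow_nonneg hS _)
  have hR : 0 ≤ ∑ u : Finset (Fin s) with u.Nonempty, (γ u : ℝ) ^ lam * rho α b lam ^ u.card := by
    rw [← sum_cbcWeight_rpow hα γ hlam]
    exact Finset.sum_nonneg fun v _ =>
      mul_nonneg (Real.rpow_nonneg (cbcWeight_nonneg hα γ v) _) (pow_nonneg hS _)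
  rw [hsum, hcast, mul_comm, ← ENNReal.le_div_iff_mul_le
    (Or.inl (ENNReal.ofReal_pos.2 hbm').ne') (Or.inl ENNReal.ofReal_ne_top)] at key
  have h2 : (2 : ℝ≥0∞) = ENNReal.ofReal 2 := by simp
  rw [h2, ← ENNReal.ofReal_mul (by norm_num), ← ENNReal.ofReal_div_of_pos hbm',
    mul_div_right_comm] at key
  have hX : 0 ≤ 2 / ((b : ℝ) ^ m - 1) * ∑ u : Finset (Fin s) with u.Nonempty,
      (γ u : ℝ) ^ lam * rho α b lam ^ u.card := by positivity
  have hle := (ENNReal.le_rpow_inv_iff h0).2 key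
  rw [ENNReal.ofReal_rpow_of_nonneg hX (by positivity), ← one_div] at hle
  exact ⟨ne_top_of_le_ne_top ENNReal.ofReal_ne_top hle,
    ENNReal.toReal_le_of_le_ofReal (Real.rpow_nonneg hX _) hle⟩

end

end

end IPL

theorem mainTheorem5 (α s m b : ℕ) [Fact b.Prime] (hα : 1 < α) (hs : 1 ≤ s) (hm : 1 ≤ m)
    (q : ℝ≥0∞) (hq : 1 ≤ q) (γ : Finset (Fin s) → ℝ≥0) :
    (∃ P : (ZMod b)[X], IPL.IsModulus b m P) ∧
    ∀ P : (ZMod b)[X], IPL.IsModulus b m P →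
      (∃ g : Fin (s * α) → (ZMod b)[X], IPL.IsCBC b m γ P g) ∧
      ∀ g : Fin (s * α) → (ZMod b)[X], IPL.IsCBC b m γ P g →
        ∀ lam : ℝ, 1 / (α : ℝ) < lam → lam ≤ 1 →
        ∀ F : (Fin s → ℝ) → ℝ, IPL.MemSobolev α γ q ∞ F →
          |1 / (b : ℝ) ^ m * ∑ n ∈ Finset.range (b ^ m), F (IPL.interlacedPoint b m α P g n)
              - ∫ y in IPL.cube s, F y| ≤
            (2 / ((b : ℝ) ^ m - 1) *
                ∑ u : Finset (Fin s) with u.Nonempty,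
                  (γ u : ℝ) ^ lam * IPL.rho α b lam ^ u.card) ^ (1 / lam) *
              (IPL.sobolevENorm α γ q ∞ F).toReal := by
  have : NeZero α := ⟨by omega⟩
  refine ⟨IPL.exists_isModulus hm, fun P hP => ⟨IPL.exists_isCBC hm γ P, ?_⟩⟩
  intro g hg lam h1 h2 F hF
  have hα0 : (0 : ℝ) < α := by exact_mod_cast (by omega : 0 < α)
  have h0 : 0 < lam := (one_div_pos.2 hα0).trans h1
  -- The condition `lam > 1 / α` is what makes the sums of `b ^ (-α lam μ₁(k))` converge.
  have hlam : 1 < α * lam := by rw [div_lt_iff₀ hα0] at h1; linarith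
  obtain ⟨hfin, hle⟩ := hg.criterion_le hα hm hP.1 hP.2 h0 h2 hlam
  exact (hF.error_le_criterion hα hq hP.1.ne_zero hP.2 g hfin).trans
    (mul_le_mul_of_nonneg_right hle ENNReal.toReal_nonneg)
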